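/- **Setting.** Let $\mathcal B$ be a unital $\mathrm C^*$-algebra. A $\mathcal B$-$\mathcal B$-correspondence is a $\mathcal B$-$\mathcal B$-bimodule $\mathcal H$ with a $\mathcal B$-valued inner product (right $\mathcal B$-linear in the second variable), complete for $\|h\|=\|\langle h,h\rangle\|^{1/2}$, on which $\mathcal B$ acts from the left through a unital $*$-homomorphism into the algebra $\mathcal L(\mathcal H)$ of bounded, right $\mathcal B$-modular, adjointable operators. A vector $\xi\in\mathcal H$ is a $\mathcal B$-central unit vector if $\langle\xi,\xi\rangle=1$ and $b\xi=\xi b$ for all $b\in\mathcal B$; put $\mathcal H^\circ=\{h:\langle h,\xi\rangle=0\}$. *Trees.* $\mathrm{Tree}(N)$ is the set of connected subgraphs $\mathcal T$ containing the empty string $\emptyset$ of the graph whose vertices are the strings $j_1\cdots j_\ell$ over $[N]=\{1,\dots,N\}$ with $j_i\ne j_{i+1}$, and whose edges are $s\sim js$; $\mathcal T$ is identified with its vertex set. For $\mathcal T\in\mathrm{Tree}(k)$, $\mathcal T_j\in\mathrm{Tree}(n_j)$ $(1\le j\le k)$, put $N=n_1+\dots+n_k$ and $\iota_j:[n_j]\to[N]$,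 $\iota_j(i)=n_1+\dots+n_{j-1}+i$. The composition $\mathcal T(\mathcal T_1,\dots,\mathcal T_k)\in\mathrm{Tree}(N)$ has as vertices all concatenations $(\iota_{i_1})_*(s_1)\cdots(\iota_{i_\ell})_*(s_\ell)$ with $\ell\ge 0$, $i_1\cdots i_\ell\in\mathcal T$ and $s_r\in\mathcal T_{i_r}\setminus\{\emptyset\}$, where $(\iota_i)_*$ applies $\iota_i$ to each letter. The identity is $\mathrm{id}=\{\emptyset,1\}\in\mathrm{Tree}(1)$. *$\mathcal T$-free products.* Let $\mathcal T\in\mathrm{Tree}(N)$ and let $(\mathcal H_j,\xi_j)$, $j\in[N]$, be $\mathcal B$-$\mathcal B$-correspondences with $\mathcal B$-central unit vectors. Their $\mathcal T$-free product is $\mathcal H=\bigoplus_{s\in\mathcal T}\mathcal H_s^\circ$ with $\mathcal H_\emptyset^\circ=\mathcal B$, $\mathcal H_{j_1\cdots j_\ell}^\circ=\mathcal H_{j_1}^\circ\otimes_{\mathcal B}\cdots\otimes_{\mathcal B}\mathcal H_{j_\ell}^\circ$, and with the vector $\xi=1\in\mathcal H_\emptyset^\circ$. With $S_{\mathcal T,j}=\{s\in\mathcal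 T: s \text{ does not begin with } j,\ js\in\mathcal T\}$, the identification $\mathcal H_s^\circ\oplus\mathcal H_{js}^\circ\cong\mathcal H_j\otimes_{\mathcal B}\mathcal H_s^\circ$ gives a unitary $U_{\mathcal T,j}$ from $\mathcal H$ onto $\bigl[\mathcal H_j\otimes_{\mathcal B}\bigoplus_{s\in S_{\mathcal T,j}}\mathcal H_s^\circ\bigr]$ plus the sum of the $\mathcal H_s^\circ$ over the other $s\in\mathcal T$ that do not begin with $j$, and $\lambda_{\mathcal T,j}:\mathcal L(\mathcal H_j)\to\mathcal L(\mathcal H)$ is $\lambda_{\mathcal T,j}(x)=U_{\mathcal T,j}^*([x\otimes\mathrm{id}]\oplus 0)U_{\mathcal T,j}$. *Laws.* $\mathcal B\langle X\rangle$ is the universal unital $*$-algebra generated by $\mathcal B$ and a self-adjoint $X$. $\Sigma(\mathcal B)$ is the set of $\mathcal B$-valued laws: unital $\mathcal B$-$\mathcal B$-bimodule maps $\mu:\mathcal B\langle X\rangle\to\mathcal B$ that are completely positive ($\mu^{(n)}(P^*P)\ge 0$ for all $n$ and $P\in M_n(\mathcal B\langle X\rangle)$) and exponentially bounded (there are $M,R>0$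 with $\|\mu(b_0Xb_1\cdots Xb_\ell)\|\le MR^\ell\|b_0\|\cdots\|b_\ell\|$ for all $\ell \ge 0$ and $b_i\in\mathcal B$). The law of a self-adjoint $Y\in\mathcal L(\mathcal H)$, for $(\mathcal H,\xi)$ as above, is $p\mapsto\langle\xi,p(Y)\xi\rangle$. For $\mathcal T\in\mathrm{Tree}(N)$ and $\mu_1,\dots,\mu_N\in\Sigma(\mathcal B)$, $\boxplus_{\mathcal T}(\mu_1,\dots,\mu_N)\in\Sigma(\mathcal B)$ is the law of $\sum_j\lambda_{\mathcal T,j}(X_j)$ on the $\mathcal T$-free product of the $\mathcal H_j=L^2(\mathcal B\langle X\rangle,\mu_j)$ (the separation-completion of $\mathcal B\langle X\rangle$ for $\langle p,q\rangle=\mu_j(p^*q)$, with $\xi_j$ the class of $1$), where $X_j$ is the operator of left multiplication by $X$ on $\mathcal H_j$. **Theorem.** Let $\mathcal T\in\mathrm{Tree}(k)$, $\mathcal T_j\in\mathrm{Tree}(n_j)$ for $j\in[k]$, $\mathcal T'=\mathcal T(\mathcal T_1,\dots,\mathcal T_k)$ and $N=n_1+\dots+n_k$. 1. Let $(\mathcal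 H_{j,i},\xi_{j,i})$, $j\in[k]$, $i\in[n_j]$, be $\mathcal B$-$\mathcal B$-correspondences with $\mathcal B$-central unit vectors. Let $(\mathcal H_j,\xi_j)$ be the $\mathcal T_j$-free product of $(\mathcal H_{j,1},\xi_{j,1}),\dots,(\mathcal H_{j,n_j},\xi_{j,n_j})$, let $(\mathcal H,\xi)$ be the $\mathcal T$-free product of $(\mathcal H_1,\xi_1),\dots,(\mathcal H_k,\xi_k)$, and let $(\mathcal K,\zeta)$ be the $\mathcal T'$-free product of the family $(\mathcal H_{1,1},\xi_{1,1}),\dots,(\mathcal H_{k,n_k},\xi_{k,n_k})$, where $(\mathcal H_{j,i},\xi_{j,i})$ has index $\iota_j(i)$. Then there is a unique unitary isomorphism $\Phi:\mathcal H\to\mathcal K$ of $\mathcal B$-$\mathcal B$-correspondences with $\Phi\xi=\zeta$ and $$\Phi\,\lambda_{\mathcal T,j}(\lambda_{\mathcal T_j,i}(x))\,\Phi^*=\lambda_{\mathcal T',\iota_j(i)}(x)\qquad\text{for all } j\in[k],\ i\in[n_j],\ x\in\mathcal L(\mathcal H_{j,i}).$$ 2. $\boxplus_{\mathcal T'}=\boxplus_{\mathcal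 T}(\boxplus_{\mathcal T_1},\dots,\boxplus_{\mathcal T_k})$ as functions $\Sigma(\mathcal B)^N\to\Sigma(\mathcal B)$, that is, for all laws $\mu_{j,i}$, $$\boxplus_{\mathcal T'}(\mu_{1,1},\dots,\mu_{k,n_k})=\boxplus_{\mathcal T}\bigl(\boxplus_{\mathcal T_1}(\mu_{1,1},\dots,\mu_{1,n_1}),\dots,\boxplus_{\mathcal T_k}(\mu_{k,1},\dots,\mu_{k,n_k})\bigr).$$ 3. $\boxplus_{\mathrm{id}}(\mu)=\mu$ for all $\mu\in\Sigma(\mathcal B)$. In other words, by 2 and 3, $\mathcal T\mapsto\boxplus_{\mathcal T}$ respects the compositions and the identities of the operad of trees and of the operad of functions $\Sigma(\mathcal B)^N\to\Sigma(\mathcal B)$. -/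

import Mathlib

open scoped TensorProduct
open MulOpposite (op)

universe u

set_option linter.unusedSectionVars false

/-- Commuting left and right actions of a unital `C*`-algebra `B` on a complex vector space `V`,
with a `B`-valued semi-inner product (linear in the second variable) for which the right action is
the module structure and the left action is by `*`-compatible operators. -/
structure SemiCorr (B : Type u) [CStarAlgebra B] [PartialOrder B]
    (V : Type u) [AddCommGroup V] [Module ℂ V] where
  /-- the left action `b, v ↦ b v` -/
  left : B →ₐ[ℂ] Module.End ℂ V
  /-- the right action `b, v ↦ v b` -/
  right : Bᵐᵒᵖ →ₐ[ℂ] Module.End ℂ V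
  left_right : ∀ a b v, left a (right (op b) v) = right (op b) (left a v)
  /-- the semi-inner product -/
  ip : V → V → B
  ip_add_right : ∀ u v w, ip u (v + w) = ip u v + ip u w
  ip_right : ∀ u v b, ip u (right (op b) v) = ip u v * b
  ip_star : ∀ u v, star (ip u v) = ip v u
  ip_nonneg : ∀ v, 0 ≤ ip v v
  ip_left : ∀ b u v, ip (left b u) v = ip u (left (star b) v)

theorem exists_eq_star_mul_self {A : Type*} [CStarAlgebra A] [PartialOrder A] [StarOrderedRing A]
    {M : A} (hM : 0 ≤ M) : ∃ C : A, M = star C * C :=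
  CStarAlgebra.nonneg_iff_eq_star_mul_self.mp hM

theorem exists_negPart_witness {A : Type*} [CStarAlgebra A] [PartialOrder A] [StarOrderedRing A]
    {M : A} (hM : IsSelfAdjoint M) :
    ∃ N : A, star N * M * N = -(N ^ 3) ∧ 0 ≤ N ^ 3 ∧ (N ^ 3 = 0 → 0 ≤ M) := by
  have hN : 0 ≤ M⁻ := CFC.negPart_nonneg M
  have hNs : star M⁻ = M⁻ := hN.isSelfAdjoint
  refine ⟨M⁻, ?_, ?_, fun h0 => ?_⟩
  · calc star M⁻ * M * M⁻ = M⁻ * (M⁺ - M⁻) * M⁻ := by rw [hNs, CFC.posPart_sub_negPart M hM]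
      _ = -(M⁻ ^ 3) := by simp [mul_sub, pow_succ]
  · have := star_left_conjugate_nonneg hN M⁻
    rwa [hNs, ← pow_two, ← pow_succ] at this
  · have h4 : star (M⁻ * M⁻) * (M⁻ * M⁻) = 0 := by
      rw [star_mul, hNs]
      have : M⁻ * M⁻ * (M⁻ * M⁻) = M⁻ ^ 3 * M⁻ := by simp [pow_succ, mul_assoc]
      rw [this, h0, zero_mul]
    have h5 : star M⁻ * M⁻ = 0 := by
      rw [hNs]; exact CStarRing.star_mul_self_eq_zero_iff _ |>.mp h4
    have h1 : M⁻ = 0 := CStarRing.star_mul_self_eq_zero_iff _ |>.mp h5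
    rw [← CFC.posPart_sub_negPart M hM, h1, sub_zero]
    exact CFC.posPart_nonneg M

namespace CStarMatrix

variable {B : Type u} [CStarAlgebra B] [PartialOrder B] [StarOrderedRing B] {n : ℕ}

theorem diag_nonneg {M : CStarMatrix (Fin n) (Fin n) B} (hM : 0 ≤ M) (i : Fin n) : 0 ≤ M i i := by
  obtain ⟨C, rfl⟩ := exists_eq_star_mul_self hM
  rw [CStarMatrix.mul_apply]
  refine Finset.sum_nonneg fun k _ => ?_
  exact star_mul_self_nonneg (C k i)

theorem eq_zero_of_diag {M : CStarMatrix (Fin n) (Fin n) B} (hM : 0 ≤ M)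
    (h : ∀ i, M i i = 0) : M = 0 := by
  obtain ⟨C, rfl⟩ := exists_eq_star_mul_self hM
  have hC : C = 0 := by
    ext k i
    have := h i
    rw [CStarMatrix.mul_apply] at this
    change ∑ k, star (C k i) * C k i = 0 at this
    rw [Finset.sum_eq_zero_iff_of_nonneg (fun k _ => star_mul_self_nonneg (C k i))] at this
    exact CStarRing.star_mul_self_eq_zero_iff _ |>.mp (this k (Finset.mem_univ _))
  simp [hC]

/-- A self-adjoint matrix over `B` whose compressions all have nonnegative diagonal is positive. -/
theorem nonneg_of_diag {M : CStarMatrix (Fin n) (Fin n) B} (hM : IsSelfAdjoint M)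
    (h : ∀ N : CStarMatrix (Fin n) (Fin n) B, ∀ i, 0 ≤ (star N * M * N) i i) : 0 ≤ M := by
  obtain ⟨N, h3, h3n, hN⟩ := exists_negPart_witness hM
  refine hN (eq_zero_of_diag h3n fun i => le_antisymm ?_ (diag_nonneg h3n i))
  have := h N i
  rw [h3] at this
  exact neg_nonneg.mp this

end CStarMatrix

namespace SemiCorr

variable {B : Type u} [CStarAlgebra B] [PartialOrder B]
variable {V : Type u} [AddCommGroup V] [Module ℂ V] (F : SemiCorr B V)

theorem ip_add_left (u v w : V) : F.ip (u + v) w = F.ip u w + F.ip v w := by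
  rw [← F.ip_star, F.ip_add_right, star_add, F.ip_star, F.ip_star]

theorem ip_right_left (u v : V) (b : B) : F.ip (F.right (op b) u) v = star b * F.ip u v := by
  rw [← F.ip_star, F.ip_right, star_mul, F.ip_star]

theorem right_algebraMap (z : ℂ) (v : V) : F.right (op (algebraMap ℂ B z)) v = z • v := by
  have : op (algebraMap ℂ B z) = algebraMap ℂ Bᵐᵒᵖ z := rfl
  rw [this, AlgHom.commutes]; rfl

theorem ip_smul_right (u v : V) (z : ℂ) : F.ip u (z • v) = z • F.ip u v := by
  rw [← F.right_algebraMap, F.ip_right, Algebra.smul_def, Algebra.commutes]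

theorem ip_smul_left (u v : V) (z : ℂ) : F.ip (z • u) v = star z • F.ip u v := by
  rw [← F.ip_star, F.ip_smul_right, star_smul, F.ip_star]

/-- The semi-inner product as a sesquilinear map. -/
noncomputable def ipL : V →ₗ⋆[ℂ] V →ₗ[ℂ] B :=
  LinearMap.mk₂'ₛₗ (starRingEnd ℂ) (RingHom.id ℂ) F.ip F.ip_add_left
    (fun z u v => F.ip_smul_left u v z) F.ip_add_right (fun z u v => F.ip_smul_right u v z)

@[simp] theorem ipL_apply (u v : V) : F.ipL u v = F.ip u v := rfl

theorem ip_zero_left (v : V) : F.ip 0 v = 0 := by simp [← ipL_apply]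
theorem ip_zero_right (v : V) : F.ip v 0 = 0 := by simp [← ipL_apply]
theorem ip_sub_left (u v w : V) : F.ip (u - v) w = F.ip u w - F.ip v w := by simp [← ipL_apply]
theorem ip_sub_right (u v w : V) : F.ip u (v - w) = F.ip u v - F.ip u w := by simp [← ipL_apply]
theorem ip_sum_left {ι : Type*} (s : Finset ι) (f : ι → V) (w : V) :
    F.ip (∑ i ∈ s, f i) w = ∑ i ∈ s, F.ip (f i) w := by simp [← ipL_apply]
theorem ip_sum_right {ι : Type*} (s : Finset ι) (f : ι → V) (w : V) :
    F.ip w (∑ i ∈ s, f i) = ∑ i ∈ s, F.ip w (f i) := by simp [← ipL_apply]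

section gram

variable [StarOrderedRing B]

/-- Gram matrices are positive. -/
theorem gram_nonneg {n : ℕ} (c : Fin n → V) :
    0 ≤ (CStarMatrix.ofMatrix fun i j => F.ip (c i) (c j) : CStarMatrix (Fin n) (Fin n) B) := by
  apply CStarMatrix.nonneg_of_diag
  · ext i j
    exact F.ip_star (c j) (c i)
  · intro N i
    have := F.ip_nonneg (∑ k, F.right (op (N k i)) (c k))
    convert this using 1
    simp only [CStarMatrix.mul_apply, F.ip_sum_left, F.ip_sum_right, F.ip_right, F.ip_right_left,
      CStarMatrix.star_apply, Finset.sum_mul]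
    rw [Finset.sum_comm]
    simp only [mul_assoc]
    rfl

end gram

/-- The seminorm of a vector. -/
noncomputable def nrm (v : V) : ℝ := √‖F.ip v v‖

theorem nrm_nonneg (v : V) : 0 ≤ F.nrm v := Real.sqrt_nonneg _
theorem nrm_sq (v : V) : F.nrm v ^ 2 = ‖F.ip v v‖ := Real.sq_sqrt (norm_nonneg _)

theorem nrm_smul (z : ℂ) (v : V) : F.nrm (z • v) = ‖z‖ * F.nrm v := by
  rw [nrm, F.ip_smul_left, F.ip_smul_right, norm_smul, norm_smul, norm_star, ← mul_assoc,
    Real.sqrt_mul (by positivity), Real.sqrt_mul_self (norm_nonneg z), nrm]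

theorem nrm_right_le (b : B) (v : V) : F.nrm (F.right (op b) v) ≤ ‖b‖ * F.nrm v := by
  refine Real.sqrt_le_iff.mpr ⟨mul_nonneg (norm_nonneg _) (F.nrm_nonneg v), ?_⟩
  rw [F.ip_right, F.ip_right_left, mul_pow, F.nrm_sq]
  calc _ ≤ ‖star b‖ * ‖F.ip v v‖ * ‖b‖ :=
        (norm_mul_le _ _).trans (mul_le_mul_of_nonneg_right (norm_mul_le _ _) (norm_nonneg _))
    _ = _ := by rw [norm_star]; ring

variable [StarOrderedRing B]

theorem norm_ip_le (u v : V) : ‖F.ip u v‖ ≤ F.nrm u * F.nrm v := by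
  set a := F.ip u v with ha
  have key : ∀ t : ℝ, 0 < t → F.nrm u ^ 2 ≤ t → (2 * t - F.nrm u ^ 2) * ‖a‖ ^ 2 ≤ t ^ 2 * F.nrm v ^ 2 := by
    intro t ht hu
    have h1 := F.ip_nonneg (F.right (op a) u - (t : ℂ) • v)
    have h2 : F.ip (F.right (op a) u - (t : ℂ) • v) (F.right (op a) u - (t : ℂ) • v)
        = star a * F.ip u u * a - (2 * t) • (star a * a) + t ^ 2 • F.ip v v := by
      simp only [F.ip_sub_left, F.ip_sub_right, F.ip_right, F.ip_right_left, F.ip_smul_left,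
        F.ip_smul_right, ← ha]
      rw [← F.ip_star u v, ← ha]
      simp only [two_mul, add_smul, pow_two, mul_smul, Complex.coe_smul]
      simp
      abel
    have h3 : star a * F.ip u u * a ≤ F.nrm u ^ 2 • (star a * a) := by
      rw [F.nrm_sq]
      exact CStarAlgebra.star_left_conjugate_le_norm_smul (hb := (F.ip_nonneg u).isSelfAdjoint)
    have h4 : (2 * t - F.nrm u ^ 2) • (star a * a) ≤ t ^ 2 • F.ip v v := by
      rw [h2] at h1
      rw [sub_smul, sub_le_iff_le_add]
      calc (2 * t) • (star a * a) ≤ star a * F.ip u u * a + t ^ 2 • F.ip v v := by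
            have := add_le_add_left h1 ((2 * t) • (star a * a))
            convert this using 1 <;> abel
        _ ≤ _ := by rw [add_comm]; gcongr
    have h5 := CStarAlgebra.norm_le_norm_of_nonneg_of_le
      (smul_nonneg (by linarith) (star_mul_self_nonneg a)) h4
    rw [norm_smul, norm_smul, CStarRing.norm_star_mul_self, ← F.nrm_sq, Real.norm_of_nonneg (by linarith),
      Real.norm_of_nonneg (by positivity)] at h5
    linarith
  have hu := F.nrm_nonneg u
  have hv := F.nrm_nonneg v
  have : ‖a‖ ^ 2 ≤ (F.nrm u * F.nrm v) ^ 2 := by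
    rcases hu.eq_or_lt with h0 | h0
    · rw [← h0] at key ⊢
      by_contra! hc
      have hpos : 0 < ‖a‖ ^ 2 := by simpa using hc
      have := key (‖a‖ ^ 2 / (F.nrm v ^ 2 + 1)) (by positivity) (by simp; positivity)
      have h6 : ‖a‖ ^ 2 / (F.nrm v ^ 2 + 1) * (F.nrm v ^ 2 + 1) = ‖a‖ ^ 2 := by field_simp
      set t := ‖a‖ ^ 2 / (F.nrm v ^ 2 + 1)
      have ht : 0 < t := by positivity
      nlinarith [sq_nonneg (F.nrm v)]
    · have := key (F.nrm u ^ 2) (by positivity) le_rfl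
      have h7 : F.nrm u ^ 2 * ‖a‖ ^ 2 ≤ F.nrm u ^ 2 * (F.nrm u * F.nrm v) ^ 2 := by nlinarith
      exact le_of_mul_le_mul_left h7 (by positivity)
  exact abs_le_of_sq_le_sq' this (by positivity) |>.2

theorem nrm_add_le (u v : V) : F.nrm (u + v) ≤ F.nrm u + F.nrm v := by
  have : F.nrm (u + v) ^ 2 ≤ (F.nrm u + F.nrm v) ^ 2 := by
    rw [F.nrm_sq, F.ip_add_left, F.ip_add_right, F.ip_add_right]
    calc _ ≤ ‖F.ip u u‖ + ‖F.ip u v‖ + (‖F.ip v u‖ + ‖F.ip v v‖) :=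
          (norm_add_le _ _).trans (add_le_add (norm_add_le _ _) (norm_add_le _ _))
      _ ≤ F.nrm u ^ 2 + F.nrm u * F.nrm v + (F.nrm v * F.nrm u + F.nrm v ^ 2) := by
          rw [F.nrm_sq, F.nrm_sq]
          gcongr <;> exact F.norm_ip_le _ _
      _ = _ := by ring
  exact abs_le_of_sq_le_sq' this (add_nonneg (F.nrm_nonneg u) (F.nrm_nonneg v)) |>.2

theorem nrm_left_le (b : B) (v : V) : F.nrm (F.left b v) ≤ ‖b‖ * F.nrm v := by
  refine Real.sqrt_le_iff.mpr ⟨mul_nonneg (norm_nonneg _) (F.nrm_nonneg v), ?_⟩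
  have h0 : (0 : B) ≤ algebraMap ℝ B (‖b‖ ^ 2) - star b * b :=
    sub_nonneg.mpr CStarAlgebra.star_mul_le_algebraMap_norm_sq
  obtain ⟨c, hc⟩ := CStarAlgebra.nonneg_iff_eq_star_mul_self.mp h0
  have h1 : F.ip (F.left b v) (F.left b v) ≤ ‖b‖ ^ 2 • F.ip v v := by
    have h2 := F.ip_nonneg (F.left c v)
    rw [F.ip_left, ← Module.End.mul_apply, ← map_mul, ← hc, map_sub] at h2
    have h3 : F.left (algebraMap ℝ B (‖b‖ ^ 2)) v = ((‖b‖ ^ 2 : ℝ) : ℂ) • v := by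
      rw [IsScalarTower.algebraMap_apply ℝ ℂ B, AlgHom.commutes]; rfl
    rw [LinearMap.sub_apply, F.ip_sub_right, h3, F.ip_smul_right, Complex.coe_smul, map_mul,
      Module.End.mul_apply, ← F.ip_left] at h2
    exact sub_nonneg.mp h2
  have := CStarAlgebra.norm_le_norm_of_nonneg_of_le (F.ip_nonneg _) h1
  rwa [norm_smul, Real.norm_of_nonneg (by positivity), ← F.nrm_sq v, ← mul_pow] at this

/-- A symmetric operator whose powers grow at most like `R ^ m` on each vector is bounded
by `R`. -/
theorem nrm_le_of_growth (S : Module.End ℂ V) (hS : ∀ u v, F.ip (S u) v = F.ip u (S v))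
    {R : ℝ} (hR : 0 ≤ R) (u : V) {C : ℝ} (hC : ∀ m : ℕ, F.nrm ((S ^ m) u) ≤ C * R ^ m) :
    F.nrm (S u) ≤ R * F.nrm u := by
  have hpow : ∀ (m : ℕ) u v, F.ip ((S ^ m) u) v = F.ip u ((S ^ m) v) := by
    intro m
    induction m with
    | zero => simp
    | succ m ih =>
      intro u v
      rw [pow_succ, Module.End.mul_apply, ih, hS, ← Module.End.mul_apply, ← pow_succ']
      rfl
  have h2 : ∀ m : ℕ, F.nrm ((S ^ m) u) ^ 2 ≤ F.nrm u * F.nrm ((S ^ (2 * m)) u) := by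
    intro m
    rw [F.nrm_sq, hpow, ← Module.End.mul_apply, ← pow_add, ← two_mul]
    exact F.norm_ip_le _ _
  have hu := F.nrm_nonneg u
  set p := F.nrm (S u) with hp
  have hp0 : 0 ≤ p := F.nrm_nonneg _
  have h3 : ∀ n : ℕ, p ^ (2 ^ n) * F.nrm u ≤ F.nrm u ^ (2 ^ n) * F.nrm ((S ^ (2 ^ n)) u) := by
    intro n
    induction n with
    | zero => simp [hp, mul_comm]
    | succ n ih =>
      rcases hu.eq_or_lt with h0 | h0
      · rw [← h0]; simp
      have h4 := h2 (2 ^ n)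
      have h5 := pow_le_pow_left₀ (by positivity) ih 2
      have h6 : F.nrm u * (p ^ (2 ^ (n + 1)) * F.nrm u)
          ≤ F.nrm u * (F.nrm u ^ (2 ^ (n + 1)) * F.nrm ((S ^ (2 ^ (n + 1))) u)) := by
        calc F.nrm u * (p ^ (2 ^ (n + 1)) * F.nrm u) = (p ^ 2 ^ n * F.nrm u) ^ 2 := by
              rw [pow_succ, pow_mul]; ring
          _ ≤ (F.nrm u ^ 2 ^ n * F.nrm ((S ^ 2 ^ n) u)) ^ 2 := h5
          _ = F.nrm u ^ (2 ^ (n + 1)) * F.nrm ((S ^ 2 ^ n) u) ^ 2 := by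
              rw [pow_succ 2 n, pow_mul, mul_pow]
          _ ≤ F.nrm u ^ (2 ^ (n + 1)) * (F.nrm u * F.nrm ((S ^ (2 * 2 ^ n)) u)) := by gcongr
          _ = _ := by rw [pow_succ' 2 n]; ring
      exact le_of_mul_le_mul_left h6 h0
  rcases hu.eq_or_lt with h0 | h0
  · have := h2 1
    rw [← h0, pow_one, zero_mul] at this
    rw [← h0, mul_zero]
    nlinarith
  by_contra! hc
  have hq : ∀ n : ℕ, p ^ (2 ^ n) * F.nrm u ≤ C * (R * F.nrm u) ^ (2 ^ n) := by
    intro n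
    calc _ ≤ _ := h3 n
      _ ≤ F.nrm u ^ (2 ^ n) * (C * R ^ (2 ^ n)) := by gcongr; exact hC _
      _ = _ := by rw [mul_pow]; ring
  rcases (mul_nonneg hR hu).eq_or_lt with hr | hr
  · have := hq 0
    rw [← hr] at this hc
    simp at this
    nlinarith
  · have h1 : 1 < p / (R * F.nrm u) := (one_lt_div hr).mpr hc
    obtain ⟨n, hn⟩ := pow_unbounded_of_one_lt (C / F.nrm u) h1
    have hle : (p / (R * F.nrm u)) ^ n ≤ (p / (R * F.nrm u)) ^ (2 ^ n) :=
      pow_le_pow_right₀ h1.le (Nat.lt_two_pow_self).le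
    have h8 := hn.trans_le hle
    rw [div_pow, div_lt_div_iff₀ h0 (by positivity)] at h8
    exact absurd (hq n) (not_le.mpr h8)

end SemiCorr

/-- A semi-inner-product `B`-`B`-bimodule (before separation and completion). -/
structure PreCorr (B : Type u) [CStarAlgebra B] [PartialOrder B] where
  carrier : Type u
  [grp : AddCommGroup carrier]
  [mod : Module ℂ carrier]
  form : SemiCorr B carrier

attribute [instance] PreCorr.grp PreCorr.mod

/-- A `B`-`B`-correspondence: a `B`-`B`-bimodule with a `B`-valued inner product, complete for the
norm `‖v‖ = ‖⟨v, v⟩‖ ^ (1/2)`, on which `B` acts from the left by adjointable operators. -/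
structure HilbertCorr (B : Type u) [CStarAlgebra B] [PartialOrder B] where
  carrier : Type u
  [grp : NormedAddCommGroup carrier]
  [mod : NormedSpace ℂ carrier]
  [complete : CompleteSpace carrier]
  form : SemiCorr B carrier
  norm_eq : ∀ v, ‖v‖ = √‖form.ip v v‖

attribute [instance] HilbertCorr.grp HilbertCorr.mod HilbertCorr.complete

/-- A `B`-`B`-correspondence with a `B`-central unit vector `ξ`. -/
structure PointedCorr (B : Type u) [CStarAlgebra B] [PartialOrder B] extends HilbertCorr B where
  ξ : carrier
  ip_ξ : form.ip ξ ξ = 1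
  central : ∀ b, form.left b ξ = form.right (op b) ξ

namespace SemiCorr

open UniformSpace (Completion)

variable {B : Type u} [CStarAlgebra B] [PartialOrder B] [StarOrderedRing B]
variable {V : Type u} [AddCommGroup V] [Module ℂ V] (F : SemiCorr B V)
variable {W : Type u} [AddCommGroup W] [Module ℂ W] (G : SemiCorr B W)

/-- A copy of `V`, seminormed by `‖v‖ = ‖⟨v, v⟩‖ ^ (1/2)`. -/
def Pre (_ : SemiCorr B V) : Type u := V

instance : AddCommGroup F.Pre := inferInstanceAs (AddCommGroup V)
instance : Module ℂ F.Pre := inferInstanceAs (Module ℂ V)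
noncomputable instance : Norm F.Pre := ⟨F.nrm⟩

theorem preCore : SeminormedSpace.Core ℂ F.Pre where
  norm_nonneg := F.nrm_nonneg
  norm_smul := F.nrm_smul
  norm_triangle := F.nrm_add_le

noncomputable instance : SeminormedAddCommGroup F.Pre :=
  SeminormedAddCommGroup.ofCore F.preCore
noncomputable instance : NormedSpace ℂ F.Pre where
  norm_smul_le z v := (F.nrm_smul z v).le

/-- The separation-completion of `V`. -/
abbrev Hat : Type u := Completion F.Pre

/-- The canonical map to the separation-completion. -/
noncomputable def toHat : V →ₗ[ℂ] F.Hat :=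
  (Completion.toComplL : F.Pre →L[ℂ] Completion F.Pre).toLinearMap

theorem norm_toHat (v : V) : ‖F.toHat v‖ = F.nrm v := Completion.norm_coe (E := F.Pre) v

theorem hat_ext {X : Type*} [TopologicalSpace X] [T2Space X] {f g : F.Hat → X}
    (hf : Continuous f) (hg : Continuous g) (h : ∀ v, f (F.toHat v) = g (F.toHat v)) : f = g :=
  funext fun x => Completion.induction_on (α := F.Pre) x (isClosed_eq hf hg) h

theorem hat_ind {p : F.Hat → Prop} (x : F.Hat) (hp : IsClosed {x | p x})
    (h : ∀ v, p (F.toHat v)) : p x :=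
  Completion.induction_on (α := F.Pre) x hp h

theorem hat_ind₂ {p : F.Hat → F.Hat → Prop} (x y : F.Hat)
    (hp : IsClosed {x : F.Hat × F.Hat | p x.1 x.2})
    (h : ∀ u v, p (F.toHat u) (F.toHat v)) : p x y :=
  Completion.induction_on₂ (α := F.Pre) (β := F.Pre) x y hp h

theorem hat_ind₃ {p : F.Hat → F.Hat → F.Hat → Prop} (x y z : F.Hat)
    (hp : IsClosed {x : F.Hat × F.Hat × F.Hat | p x.1 x.2.1 x.2.2})
    (h : ∀ u v w, p (F.toHat u) (F.toHat v) (F.toHat w)) : p x y z :=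
  Completion.induction_on₃ (α := F.Pre) (β := F.Pre) (γ := F.Pre) x y z hp h

variable {F G}

/-- The extension to the separation-completions of a bounded operator. -/
noncomputable def hatMap (T : V →ₗ[ℂ] W) (h : ∃ C, ∀ v, G.nrm (T v) ≤ C * F.nrm v) :
    F.Hat →L[ℂ] G.Hat :=
  ContinuousLinearMap.completion
    (⟨T, (LinearMap.mkContinuousOfExistsBound (E := F.Pre) (F := G.Pre) T h).cont⟩ :
      F.Pre →L[ℂ] G.Pre)

theorem hatMap_toHat (T : V →ₗ[ℂ] W) (h : ∃ C, ∀ v, G.nrm (T v) ≤ C * F.nrm v) (v : V) :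
    hatMap T h (F.toHat v) = G.toHat (T v) :=
  Completion.map_coe (α := F.Pre) (β := G.Pre)
    (ContinuousLinearMap.uniformContinuous (E₁ := F.Pre) (E₂ := G.Pre)
      (LinearMap.mkContinuousOfExistsBound (E := F.Pre) (F := G.Pre) T h)) v

variable (F)

noncomputable def ipHat : F.Hat → F.Hat → B :=
  Function.curry <| (Completion.isDenseInducing_coe.prodMap Completion.isDenseInducing_coe).extend
    (fun p : F.Pre × F.Pre => F.ip p.1 p.2)

theorem continuous_ip : Continuous (fun p : F.Pre × F.Pre => F.ip p.1 p.2) := by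
  let Φ : F.Pre →L⋆[ℂ] F.Pre →L[ℂ] B :=
    LinearMap.mkContinuous₂ (E := F.Pre) (F := F.Pre) F.ipL 1 fun u v => by
      rw [one_mul]; exact F.norm_ip_le u v
  exact (Φ.continuous.comp continuous_fst).clm_apply continuous_snd

theorem ipHat_toHat (u v : V) : F.ipHat (F.toHat u) (F.toHat v) = F.ip u v :=
  (Completion.isDenseInducing_coe.prodMap Completion.isDenseInducing_coe).extend_eq
    F.continuous_ip (u, v)

theorem continuous_ipHat : Continuous (fun p : F.Hat × F.Hat => F.ipHat p.1 p.2) := by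
  let ip' : F.Pre →+ F.Pre →+ B :=
    { toFun := fun x => (F.ipL x).toAddMonoidHom
      map_zero' := by ext x; exact F.ip_zero_left _
      map_add' := fun x y => by ext z; exact F.ip_add_left _ _ _ }
  have h : Continuous fun p : F.Pre × F.Pre => ip' p.1 p.2 := F.continuous_ip
  exact (Completion.isDenseInducing_toCompl F.Pre).extend_Z_bilin
    (Completion.isDenseInducing_toCompl F.Pre) h

theorem _root_.Continuous.ipHat {X : Type*} [TopologicalSpace X] {f g : X → F.Hat}
    (hf : Continuous f) (hg : Continuous g) : Continuous fun x => F.ipHat (f x) (g x) :=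
  F.continuous_ipHat.comp (hf.prodMk hg)

variable {F}

/-- The extension to the separation-completion of a bounded representation. -/
noncomputable def hatHom {A : Type*} [Semiring A] [Algebra ℂ A] (ρ : A →ₐ[ℂ] Module.End ℂ V)
    (h : ∀ a, ∃ C, ∀ v, F.nrm (ρ a v) ≤ C * F.nrm v) : A →ₐ[ℂ] Module.End ℂ F.Hat :=
  AlgHom.ofLinearMap
    { toFun := fun a => (hatMap (ρ a) (h a)).toLinearMap
      map_add' := fun a b => LinearMap.ext <| congrFun <| F.hat_ext (hatMap _ (h (a + b))).continuous
        ((hatMap _ (h a)).continuous.add (hatMap _ (h b)).continuous) fun v => by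
          rw [LinearMap.add_apply]
          simp only [ContinuousLinearMap.coe_coe, hatMap_toHat, map_add, LinearMap.add_apply]
      map_smul' := fun z a => LinearMap.ext <| congrFun <| F.hat_ext
        (hatMap _ (h (z • a))).continuous ((hatMap _ (h a)).continuous.const_smul z) fun v => by
          rw [LinearMap.smul_apply]
          simp only [ContinuousLinearMap.coe_coe, hatMap_toHat, map_smul, LinearMap.smul_apply,
            RingHom.id_apply] }
    (LinearMap.ext <| congrFun <| F.hat_ext (hatMap _ (h 1)).continuous continuous_id fun v => by
      change hatMap _ (h 1) (F.toHat v) = F.toHat v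
      rw [hatMap_toHat, map_one]; rfl)
    (fun a b => LinearMap.ext <| congrFun <| F.hat_ext (hatMap _ (h (a * b))).continuous
      ((hatMap _ (h a)).continuous.comp (hatMap _ (h b)).continuous) fun v => by
        change hatMap _ (h (a * b)) (F.toHat v) = hatMap _ (h a) (hatMap _ (h b) (F.toHat v))
        rw [hatMap_toHat, hatMap_toHat, hatMap_toHat, map_mul]; rfl)

theorem hatHom_toHat {A : Type*} [Semiring A] [Algebra ℂ A] (ρ : A →ₐ[ℂ] Module.End ℂ V)
    (h : ∀ a, ∃ C, ∀ v, F.nrm (ρ a v) ≤ C * F.nrm v) (a : A) (v : V) :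
    hatHom ρ h a (F.toHat v) = F.toHat (ρ a v) :=
  hatMap_toHat (ρ a) (h a) v

theorem continuous_hatHom {A : Type*} [Semiring A] [Algebra ℂ A] (ρ : A →ₐ[ℂ] Module.End ℂ V)
    (h : ∀ a, ∃ C, ∀ v, F.nrm (ρ a v) ≤ C * F.nrm v) (a : A) : Continuous (hatHom ρ h a) :=
  (hatMap (ρ a) (h a)).continuous

variable (F)

noncomputable def hatLeft : B →ₐ[ℂ] Module.End ℂ F.Hat :=
  hatHom F.left fun b => ⟨‖b‖, F.nrm_left_le b⟩

noncomputable def hatRight : Bᵐᵒᵖ →ₐ[ℂ] Module.End ℂ F.Hat :=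
  hatHom F.right fun b => ⟨‖b.unop‖, F.nrm_right_le b.unop⟩

theorem hatLeft_toHat (b : B) (v : V) : F.hatLeft b (F.toHat v) = F.toHat (F.left b v) :=
  hatHom_toHat _ _ _ _

theorem hatRight_toHat (b : Bᵐᵒᵖ) (v : V) : F.hatRight b (F.toHat v) = F.toHat (F.right b v) :=
  hatHom_toHat _ _ _ _

theorem continuous_hatLeft (b : B) : Continuous (F.hatLeft b) := continuous_hatHom _ _ b
theorem continuous_hatRight (b : Bᵐᵒᵖ) : Continuous (F.hatRight b) := continuous_hatHom _ _ b

/-- The bimodule structure and inner product of the separation-completion. -/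
noncomputable def hatForm : SemiCorr B F.Hat where
  left := F.hatLeft
  right := F.hatRight
  left_right a b := congrFun <| F.hat_ext
    ((F.continuous_hatLeft a).comp (F.continuous_hatRight (op b)))
    ((F.continuous_hatRight (op b)).comp (F.continuous_hatLeft a)) fun v => by
      simp only [hatLeft_toHat, hatRight_toHat, F.left_right]
  ip := F.ipHat
  ip_add_right u v w := F.hat_ind₃ (p := fun u v w => F.ipHat u (v + w) = F.ipHat u v + F.ipHat u w) u v w
    (isClosed_eq (Continuous.ipHat F (by fun_prop) (by fun_prop))
      ((Continuous.ipHat F (by fun_prop) (by fun_prop)).add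
        (Continuous.ipHat F (by fun_prop) (by fun_prop)))) fun a b c => by
      rw [← map_add, ipHat_toHat, ipHat_toHat, ipHat_toHat, F.ip_add_right]
  ip_right u v b := F.hat_ind₂ (p := fun u v => F.ipHat u (F.hatRight (op b) v) = F.ipHat u v * b) u v
    (isClosed_eq (Continuous.ipHat F continuous_fst
      ((F.continuous_hatRight (op b)).comp continuous_snd))
      ((Continuous.ipHat F continuous_fst continuous_snd).mul continuous_const)) fun a c => by
      rw [hatRight_toHat, ipHat_toHat, ipHat_toHat, F.ip_right]
  ip_star u v := F.hat_ind₂ (p := fun u v => star (F.ipHat u v) = F.ipHat v u) u v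
    (isClosed_eq (continuous_star.comp (Continuous.ipHat F continuous_fst continuous_snd))
      (Continuous.ipHat F continuous_snd continuous_fst)) fun a c => by
      rw [ipHat_toHat, ipHat_toHat, F.ip_star]
  ip_nonneg u := F.hat_ind (p := fun u => 0 ≤ F.ipHat u u) u
    (CStarAlgebra.isClosed_nonneg.preimage (Continuous.ipHat F continuous_id continuous_id))
    fun a => by
      rw [ipHat_toHat]; exact F.ip_nonneg a
  ip_left b u v := F.hat_ind₂
    (p := fun u v => F.ipHat (F.hatLeft b u) v = F.ipHat u (F.hatLeft (star b) v)) u v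
    (isClosed_eq (Continuous.ipHat F ((F.continuous_hatLeft b).comp continuous_fst) continuous_snd)
      (Continuous.ipHat F continuous_fst ((F.continuous_hatLeft (star b)).comp continuous_snd)))
    fun a c => by
      rw [hatLeft_toHat, hatLeft_toHat, ipHat_toHat, ipHat_toHat, F.ip_left]

theorem norm_hat (x : F.Hat) : ‖x‖ = √‖F.ipHat x x‖ :=
  congrFun (F.hat_ext (f := fun x => ‖x‖) (g := fun x => √‖F.ipHat x x‖) continuous_norm
    (Continuous.sqrt (Continuous.norm (Continuous.ipHat F continuous_id continuous_id)))
    fun v => by simp only [norm_toHat, ipHat_toHat]; rfl) x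

end SemiCorr

namespace PreCorr

variable {B : Type u} [CStarAlgebra B] [PartialOrder B] [StarOrderedRing B]

/-- The separation-completion of a semi-inner-product bimodule. -/
noncomputable def completion (V : PreCorr B) : HilbertCorr B where
  carrier := V.form.Hat
  form := V.form.hatForm
  norm_eq := V.form.norm_hat

/-- The separation-completion, pointed by the class of a central unit vector. -/
noncomputable def pointedCompletion (V : PreCorr B) (ξ : V.carrier) (h1 : V.form.ip ξ ξ = 1)
    (hc : ∀ b, V.form.left b ξ = V.form.right (op b) ξ) : PointedCorr B where
  toHilbertCorr := V.completion
  ξ := V.form.toHat ξ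
  ip_ξ := by rw [← h1]; exact V.form.ipHat_toHat ξ ξ
  central b := by
    change V.form.hatLeft b (V.form.toHat ξ) = V.form.hatRight (op b) (V.form.toHat ξ)
    rw [V.form.hatLeft_toHat, V.form.hatRight_toHat, hc]

end PreCorr

namespace SemiCorr

variable {B : Type u} [CStarAlgebra B] [PartialOrder B]
variable {V : Type u} [AddCommGroup V] [Module ℂ V] (F : SemiCorr B V)
variable {W : Type u} [AddCommGroup W] [Module ℂ W] (G : SemiCorr B W)

/-- `B` as a bimodule over itself, with `⟨a, b⟩ = a* b`. -/
noncomputable def unit (B : Type u) [CStarAlgebra B] [PartialOrder B] [StarOrderedRing B] :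
    SemiCorr B B where
  left := Algebra.lmul ℂ B
  right := Algebra.lsmul ℂ ℂ B
  left_right a b v := (mul_assoc a v b).symm
  ip a b := star a * b
  ip_add_right u v w := mul_add _ _ _
  ip_right u v b := (mul_assoc _ _ _).symm
  ip_star u v := by simp
  ip_nonneg v := star_mul_self_nonneg v
  ip_left b u v := by simp [mul_assoc]

/-- The restriction to a sub-bimodule. -/
def restrict (K : Submodule ℂ V) (hl : ∀ b, ∀ v ∈ K, F.left b v ∈ K)
    (hr : ∀ b, ∀ v ∈ K, F.right b v ∈ K) : SemiCorr B K where
  left := AlgHom.ofLinearMap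
    { toFun := fun b => (F.left b).restrict (hl b)
      map_add' := fun a b => by ext v; simp
      map_smul' := fun z b => by ext v; simp }
    (by ext v; simp) (fun a b => by ext v; simp)
  right := AlgHom.ofLinearMap
    { toFun := fun b => (F.right b).restrict (hr b)
      map_add' := fun a b => by ext v; simp
      map_smul' := fun z b => by ext v; simp }
    (by ext v; simp) (fun a b => by ext v; simp)
  left_right a b v := Subtype.ext (F.left_right a b v)
  ip u v := F.ip u v
  ip_add_right u v w := F.ip_add_right u v w
  ip_right u v b := F.ip_right u v b
  ip_star u v := F.ip_star u v
  ip_nonneg v := F.ip_nonneg v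
  ip_left b u v := F.ip_left b u v

/-- The functional `v' ⊗ w' ↦ ⟨w, ⟨v, v'⟩ w'⟩`. -/
noncomputable def tensorIpAux (v : V) (w : W) : V ⊗[ℂ] W →ₗ[ℂ] B :=
  TensorProduct.lift <| LinearMap.mk₂ ℂ (fun v' w' => G.ip w (G.left (F.ip v v') w'))
    (fun a b c => by simp [F.ip_add_right, G.ip_add_right])
    (fun z a c => by simp [F.ip_smul_right, G.ip_smul_right])
    (fun a b c => by simp [G.ip_add_right])
    (fun z a c => by simp [G.ip_smul_right])

/-- The semi-inner product of a tensor product over `B`, as a sesquilinear map. -/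
noncomputable def tensorIp : V ⊗[ℂ] W →ₗ⋆[ℂ] V ⊗[ℂ] W →ₗ[ℂ] B :=
  TensorProduct.lift <| LinearMap.mk₂'ₛₗ (starRingEnd ℂ) (starRingEnd ℂ) (F.tensorIpAux G)
    (fun a b c => TensorProduct.ext' fun x y => by
      simp [tensorIpAux, F.ip_add_left, G.ip_add_right])
    (fun z a c => TensorProduct.ext' fun x y => by
      simp [tensorIpAux, F.ip_smul_left, G.ip_smul_right])
    (fun a b c => TensorProduct.ext' fun x y => by
      simp [tensorIpAux, G.ip_add_left])
    (fun z a c => TensorProduct.ext' fun x y => by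
      simp [tensorIpAux, G.ip_smul_left])

theorem tensorIp_tmul (v v' : V) (w w' : W) :
    F.tensorIp G (v ⊗ₜ w) (v' ⊗ₜ w') = G.ip w (G.left (F.ip v v') w') := by
  simp [tensorIp, tensorIpAux]

theorem tensorIp_nonneg [StarOrderedRing B] (x : V ⊗[ℂ] W) : 0 ≤ F.tensorIp G x x := by
  obtain ⟨n, v, w, rfl⟩ : ∃ (n : ℕ) (v : Fin n → V) (w : Fin n → W), x = ∑ i, v i ⊗ₜ[ℂ] w i := by
    obtain ⟨s, hs⟩ := TensorProduct.exists_multiset x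
    obtain ⟨l, rfl⟩ := Quot.exists_rep s
    refine ⟨l.length, fun i => (l.get i).1, fun i => (l.get i).2, ?_⟩
    rw [hs]
    rw [← List.sum_ofFn]
    change (List.map (fun i : V × W => i.1 ⊗ₜ[ℂ] i.2) l).sum = _
    congr 1
    apply List.ext_getElem <;> simp
  obtain ⟨C, hC⟩ := exists_eq_star_mul_self (F.gram_nonneg v)
  have key : ∀ i j, F.ip (v i) (v j) = ∑ k, star (C k i) * C k j := fun i j => by
    have := congrFun (congrFun hC i) j
    exact this.trans (CStarMatrix.mul_apply ..)
  have : F.tensorIp G (∑ i, v i ⊗ₜ[ℂ] w i) (∑ i, v i ⊗ₜ[ℂ] w i) =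
      ∑ k, G.ip (∑ i, G.left (C k i) (w i)) (∑ i, G.left (C k i) (w i)) := by
    simp only [map_sum, LinearMap.sum_apply, tensorIp_tmul, key, G.ip_sum_right, G.ip_sum_left,
      G.ip_left, map_mul, Module.End.mul_apply]
    rw [Finset.sum_comm]
    refine (Finset.sum_congr rfl fun i _ => Finset.sum_comm).trans ?_
    rw [Finset.sum_comm]
    exact Finset.sum_congr rfl fun k _ => Finset.sum_comm
  rw [this]
  exact Finset.sum_nonneg fun k _ => G.ip_nonneg _

/-- The algebraic tensor product of bimodules with the semi-inner product
`⟨v ⊗ w, v' ⊗ w'⟩ = ⟨w, ⟨v, v'⟩ w'⟩`. Tensors are taken over `ℂ`; the elements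
`v b ⊗ w - v ⊗ b w` are null vectors, so that the separation-completion is the tensor product
over `B`. -/
noncomputable def tensor [StarOrderedRing B] : SemiCorr B (V ⊗[ℂ] W) where
  left := (Module.End.rTensorAlgHom ℂ V W).comp F.left
  right := (Module.End.lTensorAlgHom ℂ W V).comp G.right
  left_right a b x := by
    induction x with
    | zero => simp
    | tmul v w => rfl
    | add x y hx hy => rw [map_add, map_add, hx, hy, map_add, map_add]
  ip x y := F.tensorIp G x y
  ip_add_right x y z := map_add _ _ _
  ip_right x y b := by
    induction x with
    | zero => simp
    | add x x' hx hx' => simp only [map_add, LinearMap.add_apply, add_mul, hx, hx']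
    | tmul v w =>
      induction y with
      | zero => simp
      | add y y' hy hy' => rw [map_add, map_add, hy, hy', map_add, add_mul]
      | tmul v' w' =>
        change F.tensorIp G (v ⊗ₜ w) (v' ⊗ₜ G.right (op b) w') = _
        rw [tensorIp_tmul, tensorIp_tmul, G.left_right, G.ip_right]
  ip_star x y := by
    induction x with
    | zero => simp
    | add x x' hx hx' => simp only [map_add, LinearMap.add_apply, star_add, hx, hx']
    | tmul v w =>
      induction y with
      | zero => simp
      | add y y' hy hy' => rw [map_add, star_add, hy, hy', map_add, LinearMap.add_apply]
      | tmul v' w' =>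
        rw [tensorIp_tmul, tensorIp_tmul, G.ip_star, G.ip_left, F.ip_star]
  ip_nonneg x := F.tensorIp_nonneg G x
  ip_left b x y := by
    induction x with
    | zero => simp
    | add x x' hx hx' => simp only [map_add, LinearMap.add_apply, hx, hx']
    | tmul v w =>
      induction y with
      | zero => simp
      | add y y' hy hy' => rw [map_add, hy, hy', map_add, map_add]
      | tmul v' w' =>
        change F.tensorIp G (F.left b v ⊗ₜ w) (v' ⊗ₜ w') =
          F.tensorIp G (v ⊗ₜ w) (F.left (star b) v' ⊗ₜ w')
        rw [tensorIp_tmul, tensorIp_tmul, F.ip_left]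

variable {ι : Type} {X : ι → Type u} [∀ i, AddCommGroup (X i)] [∀ i, Module ℂ (X i)]
  (E : ∀ i, SemiCorr B (X i))

theorem finite_support_ip (f g : Π₀ i, X i) :
    (Function.support fun i => (E i).ip (f i) (g i)).Finite :=
  (DFinsupp.finite_support f).subset fun i hi h0 => hi (by simp [h0, ip_zero_left])

/-- The algebraic direct sum, with `⟨f, g⟩ = ∑ i, ⟨f i, g i⟩`. -/
noncomputable def directSum [StarOrderedRing B] : SemiCorr B (Π₀ i, X i) where
  left := AlgHom.ofLinearMap
    { toFun := fun b => DFinsupp.mapRange.linearMap fun i => (E i).left b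
      map_add' := fun a b => by ext; simp
      map_smul' := fun z b => by ext; simp }
    (by ext; simp) (fun a b => by ext; simp)
  right := AlgHom.ofLinearMap
    { toFun := fun b => DFinsupp.mapRange.linearMap fun i => (E i).right b
      map_add' := fun a b => by ext; simp
      map_smul' := fun z b => by ext; simp }
    (by ext; simp) (fun a b => by ext; simp)
  left_right a b f := by ext i; simp [(E i).left_right]
  ip f g := ∑ᶠ i, (E i).ip (f i) (g i)
  ip_add_right f g h := by
    simp only [DFinsupp.add_apply, ip_add_right]
    exact finsum_add_distrib (finite_support_ip E f g) (finite_support_ip E f h)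
  ip_right f g b := by
    rw [finsum_mul' _ _ (finite_support_ip E f g)]
    exact finsum_congr fun i => (E i).ip_right _ _ _
  ip_star f g := by
    have := (starAddEquiv (R := B)).toAddMonoidHom.map_finsum (finite_support_ip E f g)
    refine this.trans (finsum_congr fun i => (E i).ip_star _ _)
  ip_nonneg f := finsum_nonneg fun i => (E i).ip_nonneg _
  ip_left b f g := finsum_congr fun i => (E i).ip_left _ _ _

theorem directSum_ip_single [StarOrderedRing B] [DecidableEq ι] (i : ι) (v w : X i) :
    (directSum E).ip (DFinsupp.single i v) (DFinsupp.single i w) = (E i).ip v w := by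
  change ∑ᶠ j, _ = _
  rw [finsum_eq_single _ i]
  · simp
  · intro j hj; rw [DFinsupp.single_eq_of_ne hj, ip_zero_left]

theorem directSum_ip_single_ne [StarOrderedRing B] [DecidableEq ι] {i j : ι} (h : i ≠ j) (v : X i)
    (w : X j) : (directSum E).ip (DFinsupp.single i v) (DFinsupp.single j w) = 0 := by
  change ∑ᶠ k, _ = _
  refine finsum_eq_zero_of_forall_eq_zero fun k => ?_
  by_cases hk : k = i
  · subst hk; rw [DFinsupp.single_eq_of_ne h, ip_zero_right]
  · rw [DFinsupp.single_eq_of_ne hk, ip_zero_left]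

end SemiCorr

namespace PointedCorr

variable {B : Type u} [CStarAlgebra B] [PartialOrder B] (H : PointedCorr B)

/-- The orthogonal complement `H°` of the unit vector. -/
noncomputable def complSubmodule : Submodule ℂ H.carrier := LinearMap.ker (H.form.ipL H.ξ)

theorem mem_compl {h : H.carrier} : h ∈ H.complSubmodule ↔ H.form.ip H.ξ h = 0 := Iff.rfl

/-- `H°` as a bimodule. -/
noncomputable def compl : PreCorr B where
  carrier := H.complSubmodule
  form := H.form.restrict H.complSubmodule
    (fun b v hv => by
      rw [mem_compl] at hv ⊢
      rw [← star_star b, ← H.form.ip_left, H.central, H.form.ip_right_left, hv, mul_zero])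
    (fun b v hv => by
      rw [mem_compl] at hv ⊢
      rw [← MulOpposite.op_unop b, H.form.ip_right, hv, zero_mul])

/-- The orthogonal projection `h ↦ h - ξ ⟨ξ, h⟩` onto `H°`. -/
noncomputable def proj : H.carrier →ₗ[ℂ] H.compl.carrier :=
  LinearMap.codRestrict H.complSubmodule
    { toFun := fun h => h - H.form.right (op (H.form.ip H.ξ h)) H.ξ
      map_add' := fun h k => by simp [H.form.ip_add_right]; abel
      map_smul' := fun z h => by simp [H.form.ip_smul_right, smul_sub] }
    (fun h => by
      rw [mem_compl]
      simp [H.form.ip_sub_right, H.form.ip_right, H.ip_ξ])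

/-- The inclusion of `H°`. -/
noncomputable def incl : H.compl.carrier →ₗ[ℂ] H.carrier := H.complSubmodule.subtype

theorem incl_proj (h : H.carrier) :
    H.incl (H.proj h) = h - H.form.right (op (H.form.ip H.ξ h)) H.ξ := rfl

theorem ip_ξ_incl (h : H.compl.carrier) : H.form.ip H.ξ (H.incl h) = 0 :=
  H.mem_compl.mp (show H.complSubmodule from h).2

theorem proj_incl (h : H.compl.carrier) : H.proj (H.incl h) = h := by
  have hi : Function.Injective H.incl := Subtype.val_injective
  apply hi
  rw [incl_proj, ip_ξ_incl]
  simp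

theorem proj_ξ : H.proj H.ξ = 0 := by
  have hi : Function.Injective H.incl := Subtype.val_injective
  apply hi
  rw [incl_proj, H.ip_ξ]
  simp

theorem ip_incl (h k : H.compl.carrier) :
    H.form.ip (H.incl h) (H.incl k) = H.compl.form.ip h k := rfl

theorem incl_left (b : B) (h : H.compl.carrier) :
    H.incl (H.compl.form.left b h) = H.form.left b (H.incl h) := rfl

theorem ip_proj_left (h : H.carrier) (k : H.compl.carrier) :
    H.compl.form.ip (H.proj h) k = H.form.ip h (H.incl k) := by
  rw [← ip_incl, incl_proj, H.form.ip_sub_left, H.form.ip_right_left, ip_ξ_incl]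
  simp

end PointedCorr

namespace SemiCorr

variable {B : Type u} [CStarAlgebra B] [PartialOrder B] [StarOrderedRing B]
variable {V : Type u} [AddCommGroup V] [Module ℂ V] (F : SemiCorr B V)
variable {W : Type u} [AddCommGroup W] [Module ℂ W] (G : SemiCorr B W)

theorem tensor_ip_tmul (v v' : V) (w w' : W) :
    (F.tensor G).ip (v ⊗ₜ w) (v' ⊗ₜ w') = G.ip w (G.left (F.ip v v') w') :=
  F.tensorIp_tmul G v v' w w'

theorem nrm_tmul_le (v : V) (w : W) : (F.tensor G).nrm (v ⊗ₜ w) ≤ F.nrm v * G.nrm w := by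
  refine Real.sqrt_le_iff.mpr ⟨mul_nonneg (F.nrm_nonneg v) (G.nrm_nonneg w), ?_⟩
  rw [tensor_ip_tmul]
  calc _ ≤ G.nrm w * G.nrm (G.left (F.ip v v) w) := G.norm_ip_le _ _
    _ ≤ G.nrm w * (‖F.ip v v‖ * G.nrm w) := by
        gcongr
        exacts [G.nrm_nonneg w, G.nrm_left_le _ _]
    _ = _ := by rw [← F.nrm_sq]; ring

theorem ip_rTensor {T S : Module.End ℂ V} (hT : ∀ u v, F.ip (T u) v = F.ip u (S v))
    (x y : V ⊗[ℂ] W) :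
    (F.tensor G).ip (T.rTensor W x) y = (F.tensor G).ip x (S.rTensor W y) := by
  induction x with
  | zero => simp [ip_zero_left]
  | add x x' hx hx' => rw [map_add, ip_add_left, ip_add_left, hx, hx']
  | tmul v w =>
    induction y with
    | zero => simp [ip_zero_right]
    | add y y' hy hy' => rw [map_add, ip_add_right, ip_add_right, hy, hy']
    | tmul v' w' => simp only [LinearMap.rTensor_tmul, tensor_ip_tmul, hT]

/-- Boundedness of `T ⊗ 1`. -/
theorem nrm_rTensor_le {T S : Module.End ℂ V} (hT : ∀ u v, F.ip (T u) v = F.ip u (S v))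
    {c : ℝ} (hc0 : 0 ≤ c) (hc : ∀ v, F.nrm (S (T v)) ≤ c * F.nrm v) (x : V ⊗[ℂ] W) :
    (F.tensor G).nrm (T.rTensor W x) ≤ √c * (F.tensor G).nrm x := by
  have hS : ∀ u v, F.ip (S u) v = F.ip u (T v) := fun u v => by
    rw [← F.ip_star, ← hT, F.ip_star]
  have hQ : ∀ u v, F.ip ((S * T) u) v = F.ip u ((S * T) v) := fun u v => by
    rw [Module.End.mul_apply, hS, hT]; rfl
  have hpow : ∀ (m : ℕ) v, F.nrm (((S * T) ^ m) v) ≤ c ^ m * F.nrm v := by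
    intro m
    induction m with
    | zero => simp
    | succ m ih =>
      intro v
      rw [pow_succ', Module.End.mul_apply]
      calc _ ≤ c * F.nrm (((S * T) ^ m) v) := hc _
        _ ≤ c * (c ^ m * F.nrm v) := by gcongr; exact ih v
        _ = _ := by ring
  have hgrow : ∃ C, ∀ m : ℕ, (F.tensor G).nrm ((((S * T).rTensor W) ^ m) x) ≤ C * c ^ m := by
    induction x with
    | zero => exact ⟨0, fun m => by simp [nrm, ip_zero_left]⟩
    | add x y hx hy =>
      obtain ⟨C, hC⟩ := hx
      obtain ⟨C', hC'⟩ := hy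
      refine ⟨C + C', fun m => ?_⟩
      rw [map_add, add_mul]
      exact (nrm_add_le _ _ _).trans (add_le_add (hC m) (hC' m))
    | tmul v w =>
      refine ⟨F.nrm v * G.nrm w, fun m => ?_⟩
      rw [LinearMap.rTensor_pow, LinearMap.rTensor_tmul]
      refine (F.nrm_tmul_le G _ _).trans ?_
      calc _ ≤ c ^ m * F.nrm v * G.nrm w := by
            gcongr
            exacts [G.nrm_nonneg w, hpow m v]
        _ = _ := by ring
  obtain ⟨C, hC⟩ := hgrow
  have h1 := (F.tensor G).nrm_le_of_growth _ (F.ip_rTensor G hQ) hc0 x hC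
  have h2 : (F.tensor G).nrm (T.rTensor W x) ^ 2 ≤ (√c * (F.tensor G).nrm x) ^ 2 := by
    rw [nrm_sq, F.ip_rTensor G hT, mul_pow, Real.sq_sqrt hc0]
    have h3 : S.rTensor W (T.rTensor W x) = (S * T).rTensor W x := by
      rw [LinearMap.rTensor_mul]; rfl
    rw [h3]
    calc _ ≤ (F.tensor G).nrm x * (F.tensor G).nrm ((S * T).rTensor W x) := norm_ip_le _ _ _
      _ ≤ (F.tensor G).nrm x * (c * (F.tensor G).nrm x) := by
          gcongr
          exact nrm_nonneg _ _
      _ = _ := by ring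
  exact abs_le_of_sq_le_sq' h2 (mul_nonneg (Real.sqrt_nonneg _) (nrm_nonneg _ _)) |>.2

end SemiCorr

namespace HilbertCorr

variable {B : Type u} [CStarAlgebra B] [PartialOrder B] (H : HilbertCorr B)

/-- The algebra `L(H)` of bounded, right `B`-modular, adjointable operators on `H`. -/
def L : Subalgebra ℂ (H.carrier →L[ℂ] H.carrier) where
  carrier := {T | (∀ b v, T (H.form.right (op b) v) = H.form.right (op b) (T v)) ∧
    ∃ S : H.carrier →L[ℂ] H.carrier, ∀ u v, H.form.ip (T u) v = H.form.ip u (S v)}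
  mul_mem' := by
    rintro T T' ⟨hT, S, hS⟩ ⟨hT', S', hS'⟩
    exact ⟨fun b v => by simp [hT, hT'], S' * S, fun u v => by simp [hS, hS']⟩
  add_mem' := by
    rintro T T' ⟨hT, S, hS⟩ ⟨hT', S', hS'⟩
    exact ⟨fun b v => by simp [hT, hT'], S + S', fun u v => by
      simp [hS, hS', H.form.ip_add_left, H.form.ip_add_right]⟩
  algebraMap_mem' z := by
    refine ⟨fun b v => by simp [Algebra.algebraMap_eq_smul_one],
      algebraMap ℂ _ (star z), fun u v => ?_⟩
    simp [Algebra.algebraMap_eq_smul_one, H.form.ip_smul_left, H.form.ip_smul_right]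

theorem eq_of_ip {x y : H.carrier} (h : ∀ w, H.form.ip x w = H.form.ip y w) : x = y := by
  have : ‖x - y‖ = 0 := by
    rw [H.norm_eq, H.form.ip_sub_left, h, sub_self, norm_zero, Real.sqrt_zero]
  exact sub_eq_zero.mp (norm_eq_zero.mp this)

variable {H}

theorem mem_L_of_adjoint {T S : H.carrier →L[ℂ] H.carrier}
    (h : ∀ u v, H.form.ip (T u) v = H.form.ip u (S v)) : T ∈ H.L :=
  ⟨fun b v => H.eq_of_ip fun w => by
    rw [h, H.form.ip_right_left, H.form.ip_right_left, h], S, h⟩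

end HilbertCorr

/-- Alternating strings on the alphabet `ι`. -/
abbrev AltString (ι : Type) : Type := {s : List ι // s.IsChain (· ≠ ·)}

/-- The graph of alternating strings, with edges `s ~ j s`. -/
def freeTree (ι : Type) : SimpleGraph (AltString ι) where
  Adj s t := (∃ j, t.1 = j :: s.1) ∨ ∃ j, s.1 = j :: t.1
  symm := ⟨fun _ _ h => h.symm⟩
  loopless := ⟨fun s h => by
    rcases h with ⟨j, h⟩ | ⟨j, h⟩ <;> exact absurd (congrArg List.length h) (by simp)⟩

/-- Rooted subtrees of `freeTree ι`: connected subgraphs containing the empty string, given by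
their vertex sets. -/
@[ext]
structure StringTree (ι : Type) where
  verts : Set (AltString ι)
  root_mem : ⟨[], List.isChain_nil⟩ ∈ verts
  connected : ((freeTree ι).induce verts).Connected

namespace StringTree

variable {ι : Type} (T : StringTree ι)

/-- The vertices of `T` as a set of strings. -/
def strings : Set (List ι) := {s | ∃ h : s.IsChain (· ≠ ·), (⟨s, h⟩ : AltString ι) ∈ T.verts}

theorem nil_mem : [] ∈ T.strings := ⟨_, T.root_mem⟩

theorem alternating {s : List ι} (h : s ∈ T.strings) : s.IsChain (· ≠ ·) := h.1

theorem mem_of_cons {j : ι} {s : List ι} (h : j :: s ∈ T.strings) : s ∈ T.strings := by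
  by_contra hs
  obtain ⟨hc, hv⟩ := h
  have key : ∀ a b : T.verts, (freeTree ι).induce T.verts |>.Reachable a b →
      (j :: s) <:+ a.1.1 → (j :: s) <:+ b.1.1 := by
    rintro a b ⟨w⟩
    induction w with
    | nil => exact id
    | @cons a b c hab _ ih =>
      refine fun ha => ih ?_
      have hab' : (∃ i, b.1.1 = i :: a.1.1) ∨ ∃ i, a.1.1 = i :: b.1.1 := hab
      rcases hab' with ⟨i, hi⟩ | ⟨i, hi⟩
      · rw [hi]; exact ha.trans (List.suffix_cons _ _)
      · rw [hi] at ha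
        rcases List.suffix_cons_iff.mp ha with h | h
        · have : s = b.1.1 := (List.cons.inj h).2
          refine absurd ⟨?_, ?_⟩ hs
          · rw [this]; exact b.1.2
          · convert b.2
        · exact h
  have := key ⟨_, hv⟩ ⟨_, T.root_mem⟩ (T.connected.preconnected _ _) List.suffix_rfl
  simp at this

/-- The rooted subtree with a given set of vertices: a set of alternating strings which contains
the empty string and is closed under deletion of the first letter. -/
def ofStrings (A : Set (List ι)) (h0 : [] ∈ A) (h1 : ∀ s ∈ A, s.IsChain (· ≠ ·))
    (h2 : ∀ j s, j :: s ∈ A → s ∈ A) : StringTree ι where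
  verts := {s | s.1 ∈ A}
  root_mem := h0
  connected := by
    have key : ∀ (s : List ι) (hs : s ∈ A),
        ((freeTree ι).induce {s : AltString ι | s.1 ∈ A}).Reachable ⟨⟨s, h1 s hs⟩, hs⟩
          ⟨⟨[], List.isChain_nil⟩, h0⟩ := by
      intro s
      induction s with
      | nil => intro _; exact SimpleGraph.Reachable.refl _
      | cons j s ih =>
        intro hs
        refine SimpleGraph.Reachable.trans (SimpleGraph.Adj.reachable ?_) (ih (h2 j s hs))
        exact Or.inr ⟨j, rfl⟩
    exact
      { preconnected := fun a b => (key a.1.1 a.2).trans (key b.1.1 b.2).symm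
        nonempty := ⟨⟨⟨[], List.isChain_nil⟩, h0⟩⟩ }

theorem strings_ofStrings (A : Set (List ι)) (h0 : [] ∈ A) (h1 : ∀ s ∈ A, s.IsChain (· ≠ ·))
    (h2 : ∀ j s, j :: s ∈ A → s ∈ A) : (ofStrings A h0 h1 h2).strings = A :=
  Set.ext fun s => ⟨fun h => h.2, fun h => ⟨h1 s h, h⟩⟩

/-- The indices `S_{T,j}`: vertices `s` of `T` with `s(1) ≠ j` and `j s` a vertex of `T`. -/
def branch (j : ι) : Set (List ι) := {s | s ∈ T.strings ∧ s.head? ≠ some j ∧ j :: s ∈ T.strings}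

theorem mem_branch_of_cons {j : ι} {s : List ι} (h : j :: s ∈ T.strings) : s ∈ T.branch j := by
  refine ⟨T.mem_of_cons h, fun h' => ?_, h⟩
  obtain ⟨t, rfl⟩ : ∃ t, s = j :: t := by
    cases s with
    | nil => simp at h'
    | cons a t => simp at h'; exact ⟨t, by rw [h']⟩
  have := T.alternating h
  simp at this

theorem ne_of_cons_mem {j : ι} {s : List ι} (h : j :: s ∈ T.strings) : s.head? ≠ some j :=
  (T.mem_branch_of_cons h).2.1

end StringTree

section product

variable {B : Type u} [CStarAlgebra B] [PartialOrder B] [StarOrderedRing B]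
variable {ι : Type} [DecidableEq ι] (T : StringTree ι) (H : ι → PointedCorr B)

/-- The bimodules `H_s° = H_{j₁}° ⊗ ⋯ ⊗ H_{jₗ}°` for strings `s = j₁ ⋯ jₗ`, with `B` for the empty
string (here `H_{j s}° = H_j° ⊗ H_s°`, before separation and completion). -/
noncomputable def word : List ι → PreCorr B
  | [] => ⟨B, SemiCorr.unit B⟩
  | j :: s => ⟨(H j).compl.carrier ⊗[ℂ] (word s).carrier, (H j).compl.form.tensor (word s).form⟩

/-- The unit `1 ∈ B = H_∅°`. -/
noncomputable def wordOne : (word H []).carrier := (1 : B)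

/-- The elementary tensors `h ⊗ v ∈ H_{j s}°`. -/
noncomputable def wordCons (j : ι) (s : List ι) :
    (H j).compl.carrier →ₗ[ℂ] (word H s).carrier →ₗ[ℂ] (word H (j :: s)).carrier :=
  TensorProduct.mk ℂ (H j).compl.carrier (word H s).carrier

theorem wordCons_ip (j : ι) (s : List ι) (h h' : (H j).compl.carrier) (v v' : (word H s).carrier) :
    (word H (j :: s)).form.ip (wordCons H j s h v) (wordCons H j s h' v') =
      (word H s).form.ip v ((word H s).form.left ((H j).compl.form.ip h h') v') :=
  SemiCorr.tensor_ip_tmul ..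

theorem wordCons_left (j : ι) (s : List ι) (b : B) (h : (H j).compl.carrier)
    (v : (word H s).carrier) : (word H (j :: s)).form.left b (wordCons H j s h v) =
      wordCons H j s ((H j).compl.form.left b h) v := rfl

theorem wordCons_induction {j : ι} {s : List ι} {p : (word H (j :: s)).carrier → Prop}
    (x : (word H (j :: s)).carrier) (h0 : p 0) (hadd : ∀ x y, p x → p y → p (x + y))
    (ht : ∀ h v, p (wordCons H j s h v)) : p x :=
  TensorProduct.induction_on (motive := p) x h0 ht hadd

/-- The direct sum of `H_s°` over a set of strings (before separation and completion). -/
noncomputable def wordSum (A : Set (List ι)) : PreCorr B :=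
  ⟨Π₀ s : A, (word H s).carrier, SemiCorr.directSum fun s : A => (word H s).form⟩

/-- The inclusion of the summand `H_s°`. -/
noncomputable def wordIncl (A : Set (List ι)) (s : List ι) (hs : s ∈ A) :
    (word H s).carrier →ₗ[ℂ] (wordSum H A).carrier :=
  DFinsupp.lsingle (M := fun s : A => (word H s).carrier) ⟨s, hs⟩

theorem wordIncl_ip (A : Set (List ι)) (s : List ι) (hs : s ∈ A) (v w : (word H s).carrier) :
    (wordSum H A).form.ip (wordIncl H A s hs v) (wordIncl H A s hs w) = (word H s).form.ip v w :=
  SemiCorr.directSum_ip_single (fun s : A => (word H s).form) ⟨s, hs⟩ v w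

theorem wordIncl_ip_ne (A : Set (List ι)) {s t : List ι} (hs : s ∈ A) (ht : t ∈ A) (h : s ≠ t)
    (v : (word H s).carrier) (w : (word H t).carrier) :
    (wordSum H A).form.ip (wordIncl H A s hs v) (wordIncl H A t ht w) = 0 :=
  SemiCorr.directSum_ip_single_ne (fun s : A => (word H s).form)
    (i := ⟨s, hs⟩) (j := ⟨t, ht⟩) (fun h' => h (congrArg Subtype.val h')) v w

theorem wordIncl_left (A : Set (List ι)) (s : List ι) (hs : s ∈ A) (b : B)
    (v : (word H s).carrier) : (wordSum H A).form.left b (wordIncl H A s hs v) =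
      wordIncl H A s hs ((word H s).form.left b v) :=
  DFinsupp.mapRange_single (f := fun (s : A) => (word H s).form.left b) (hf := fun _ => map_zero _)

theorem wordIncl_right (A : Set (List ι)) (s : List ι) (hs : s ∈ A) (b : Bᵐᵒᵖ)
    (v : (word H s).carrier) : (wordSum H A).form.right b (wordIncl H A s hs v) =
      wordIncl H A s hs ((word H s).form.right b v) :=
  DFinsupp.mapRange_single (f := fun (s : A) => (word H s).form.right b) (hf := fun _ => map_zero _)

theorem wordSum_induction {A : Set (List ι)} {p : (wordSum H A).carrier → Prop}
    (x : (wordSum H A).carrier) (h0 : p 0) (hadd : ∀ x y, p x → p y → p (x + y))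
    (hs : ∀ s hs v, p (wordIncl H A s hs v)) : p x :=
  DFinsupp.induction (β := fun s : A => (word H s).carrier) x h0
    fun s v _ _ _ h => hadd _ _ (hs s.1 s.2 v) h

/-- The linear map out of a direct sum with given restrictions to the summands. -/
noncomputable def wordLift (A : Set (List ι)) {M : Type*} [AddCommGroup M] [Module ℂ M]
    (f : ∀ s, s ∈ A → (word H s).carrier →ₗ[ℂ] M) : (wordSum H A).carrier →ₗ[ℂ] M :=
  DFinsupp.lsum ℂ (M := fun s : A => (word H s).carrier) fun s => f s.1 s.2

theorem wordLift_incl (A : Set (List ι)) {M : Type*} [AddCommGroup M] [Module ℂ M]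
    (f : ∀ s, s ∈ A → (word H s).carrier →ₗ[ℂ] M) (s : List ι) (hs : s ∈ A)
    (v : (word H s).carrier) : wordLift H A f (wordIncl H A s hs v) = f s hs v :=
  DFinsupp.lsum_single (M := fun s : A => (word H s).carrier) ℂ
    (F := fun s : A => f s.1 s.2) ⟨s, hs⟩ v

/-- The `T`-free product of the pointed correspondences `H j`: the completed direct sum of
`H_s°` over `s ∈ T`, with the unit vector `1 ∈ B = H_∅°`. -/
noncomputable def freeProd : PointedCorr B :=
  (wordSum H T.strings).pointedCompletion (wordIncl H T.strings [] T.nil_mem (wordOne H))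
    (by rw [wordIncl_ip]; change star (1 : B) * 1 = 1; simp)
    (fun b => by
      rw [wordIncl_left, wordIncl_right]
      congr 1
      change b * 1 = 1 * b
      simp)

variable (j : ι)

/-- The bimodule `H_j ⊗ ⨁_{s ∈ S_{T,j}} H_s°` (before separation and completion). -/
noncomputable def branchProd : PreCorr B :=
  ⟨(H j).carrier ⊗[ℂ] (wordSum H (T.branch j)).carrier,
    (H j).form.tensor (wordSum H (T.branch j)).form⟩

/-- The elementary tensors of `branchProd`. -/
noncomputable def branchMk : (H j).carrier →ₗ[ℂ] (wordSum H (T.branch j)).carrier →ₗ[ℂ]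
    (branchProd T H j).carrier :=
  TensorProduct.mk ℂ (H j).carrier (wordSum H (T.branch j)).carrier

theorem branchMk_ip (h h' : (H j).carrier) (v v' : (wordSum H (T.branch j)).carrier) :
    (branchProd T H j).form.ip (branchMk T H j h v) (branchMk T H j h' v') =
      (wordSum H (T.branch j)).form.ip v
        ((wordSum H (T.branch j)).form.left ((H j).form.ip h h') v') :=
  SemiCorr.tensor_ip_tmul ..

theorem branchProd_induction {p : (branchProd T H j).carrier → Prop}
    (x : (branchProd T H j).carrier) (h0 : p 0) (hadd : ∀ x y, p x → p y → p (x + y))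
    (ht : ∀ h s hs v, p (branchMk T H j h (wordIncl H (T.branch j) s hs v))) : p x :=
  TensorProduct.induction_on (motive := p) x h0
    (fun h y => wordSum_induction H (p := fun y => p (branchMk T H j h y)) y
      (by rw [map_zero]; exact h0) (fun x y hx hy => by rw [map_add]; exact hadd _ _ hx hy) (ht h)) hadd

/-- The restriction of `branchIns` to `h ⊗ H_s°`. -/
noncomputable def branchInsAux (s : List ι) (hs : s ∈ T.branch j) :
    (H j).carrier →ₗ[ℂ] (word H s).carrier →ₗ[ℂ] (wordSum H T.strings).carrier :=
  ((LinearMap.llcomp ℂ _ _ _ (wordIncl H T.strings s hs.1)) ∘ₗ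
    (word H s).form.left.toLinearMap ∘ₗ (H j).form.ipL (H j).ξ) +
  ((LinearMap.llcomp ℂ _ _ _ (wordIncl H T.strings (j :: s) hs.2.2)) ∘ₗ
    wordCons H j s ∘ₗ (H j).proj)

/-- The isometry `U_{T,j}^* : H_j ⊗ ⨁_{s ∈ S_{T,j}} H_s° → ⨁_{s ∈ T} H_s°`, given on
`H_j ⊗ H_s° = (ξ_j B ⊕ H_j°) ⊗ H_s°` by `h ⊗ v ↦ ⟨ξ_j, h⟩ v + (h - ξ_j ⟨ξ_j, h⟩) ⊗ v`. -/
noncomputable def branchIns : (branchProd T H j).carrier →ₗ[ℂ] (wordSum H T.strings).carrier :=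
  TensorProduct.lift
    (wordLift H (T.branch j) fun s hs => (branchInsAux T H j s hs).flip).flip

theorem branchIns_mk (h : (H j).carrier) (s : List ι) (hs : s ∈ T.branch j)
    (v : (word H s).carrier) :
    branchIns T H j (branchMk T H j h (wordIncl H (T.branch j) s hs v)) =
      wordIncl H T.strings s hs.1 ((word H s).form.left ((H j).form.ip (H j).ξ h) v) +
      wordIncl H T.strings (j :: s) hs.2.2 (wordCons H j s ((H j).proj h) v) := by
  refine (TensorProduct.lift.tmul _ _).trans ?_
  rw [LinearMap.flip_apply, wordLift_incl]
  rfl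

open Classical in
/-- The restriction to `H_s°` of `branchDec`. -/
noncomputable def branchDecAux : ∀ s, s ∈ T.strings →
    (word H s).carrier →ₗ[ℂ] (branchProd T H j).carrier
  | [], _ =>
    if h : [] ∈ T.branch j then
      branchMk T H j (H j).ξ ∘ₗ wordIncl H (T.branch j) [] h
    else 0
  | i :: s, hs =>
    if hij : i = j then
      TensorProduct.map (H j).incl
        (wordIncl H (T.branch j) s (T.mem_branch_of_cons (hij ▸ hs))) ∘ₗ
        (hij ▸ LinearMap.id : (word H (i :: s)).carrier →ₗ[ℂ] (word H (j :: s)).carrier)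
    else if h : i :: s ∈ T.branch j then
      branchMk T H j (H j).ξ ∘ₗ wordIncl H (T.branch j) (i :: s) h
    else 0

/-- The first component of `U_{T,j} : ⨁_{s ∈ T} H_s° → (H_j ⊗ ⨁_{s ∈ S_{T,j}} H_s°) ⊕ ⋯`:
it maps `v ∈ H_s°` to `ξ_j ⊗ v` and `h ⊗ v ∈ H_{j s}°` to `h ⊗ v` when `s ∈ S_{T,j}`, and it
vanishes on the other summands. -/
noncomputable def branchDec : (wordSum H T.strings).carrier →ₗ[ℂ] (branchProd T H j).carrier :=
  wordLift H T.strings (branchDecAux T H j)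

theorem branchDec_branch (s : List ι) (hs : s ∈ T.branch j) (v : (word H s).carrier) :
    branchDec T H j (wordIncl H T.strings s hs.1 v) =
      branchMk T H j (H j).ξ (wordIncl H (T.branch j) s hs v) := by
  rw [branchDec, wordLift_incl]
  cases s with
  | nil => rw [branchDecAux, dif_pos hs]; rfl
  | cons i s =>
    have hij : i ≠ j := fun h => hs.2.1 (by rw [h]; rfl)
    rw [branchDecAux, dif_neg hij, dif_pos hs]; rfl

theorem branchDec_cons (s : List ι) (hs : j :: s ∈ T.strings)
    (h : (H j).compl.carrier) (v : (word H s).carrier) :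
    branchDec T H j (wordIncl H T.strings (j :: s) hs (wordCons H j s h v)) =
      branchMk T H j ((H j).incl h)
        (wordIncl H (T.branch j) s (T.mem_branch_of_cons hs) v) := by
  rw [branchDec, wordLift_incl, branchDecAux, dif_pos rfl]
  rfl

theorem branchDec_other (s : List ι) (hs : s ∈ T.strings) (h1 : s ∉ T.branch j)
    (h2 : s.head? ≠ some j) (v : (word H s).carrier) :
    branchDec T H j (wordIncl H T.strings s hs v) = 0 := by
  rw [branchDec, wordLift_incl]
  cases s with
  | nil => rw [branchDecAux, dif_neg h1]; rfl
  | cons i s =>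
    have hij : i ≠ j := fun h => h2 (by rw [h]; rfl)
    rw [branchDecAux, dif_neg hij, dif_neg h1]; rfl

end product

section product

variable {B : Type u} [CStarAlgebra B] [PartialOrder B] [StarOrderedRing B]
variable {ι : Type} [DecidableEq ι] (T : StringTree ι) (H : ι → PointedCorr B) (j : ι)

theorem ip_branchIns (w : (branchProd T H j).carrier) (v : (wordSum H T.strings).carrier) :
    (wordSum H T.strings).form.ip (branchIns T H j w) v =
      (branchProd T H j).form.ip w (branchDec T H j v) := by
  refine branchProd_induction T H j (p := fun w => (wordSum H T.strings).form.ip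
    (branchIns T H j w) v = (branchProd T H j).form.ip w (branchDec T H j v)) w ?_ ?_ ?_
  · rw [map_zero, SemiCorr.ip_zero_left, SemiCorr.ip_zero_left]
  · intro x y hx hy
    rw [map_add, SemiCorr.ip_add_left, SemiCorr.ip_add_left, hx, hy]
  intro h s hs u
  refine wordSum_induction H (p := fun v => (wordSum H T.strings).form.ip
    (branchIns T H j (branchMk T H j h (wordIncl H (T.branch j) s hs u))) v =
    (branchProd T H j).form.ip (branchMk T H j h (wordIncl H (T.branch j) s hs u))
      (branchDec T H j v)) v ?_ ?_ ?_
  · rw [map_zero, SemiCorr.ip_zero_right, SemiCorr.ip_zero_right]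
  · intro x y hx hy
    rw [map_add, SemiCorr.ip_add_right, SemiCorr.ip_add_right, hx, hy]
  intro t ht v
  rw [branchIns_mk, SemiCorr.ip_add_left]
  by_cases h1 : t ∈ T.branch j
  · have hne : j :: s ≠ t := by rintro rfl; exact h1.2.1 rfl
    rw [branchDec_branch T H j t h1, branchMk_ip, wordIncl_left, wordIncl_ip_ne H _ _ _ hne,
      add_zero]
    by_cases hst : s = t
    · subst hst
      rw [wordIncl_ip, wordIncl_ip, SemiCorr.ip_left, SemiCorr.ip_star]
    · rw [wordIncl_ip_ne H _ _ _ hst, wordIncl_ip_ne H _ _ _ hst]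
  by_cases h2 : t.head? = some j
  · obtain ⟨t', rfl⟩ : ∃ t', t = j :: t' := by
      cases t with
      | nil => simp at h2
      | cons a t' => simp at h2; exact ⟨t', by rw [h2]⟩
    have hne : s ≠ j :: t' := by rintro rfl; exact hs.2.1 rfl
    rw [wordIncl_ip_ne H _ _ _ hne, zero_add]
    refine wordCons_induction H (p := fun v => (wordSum H T.strings).form.ip
      (wordIncl H T.strings (j :: s) hs.2.2 (wordCons H j s ((H j).proj h) u))
        (wordIncl H T.strings (j :: t') ht v) = (branchProd T H j).form.ip
      (branchMk T H j h (wordIncl H (T.branch j) s hs u))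
      (branchDec T H j (wordIncl H T.strings (j :: t') ht v))) v ?_ ?_ ?_
    · simp only [map_zero, SemiCorr.ip_zero_right]
    · intro x y hx hy
      simp only [map_add, SemiCorr.ip_add_right, hx, hy]
    intro k v
    rw [branchDec_cons, branchMk_ip, wordIncl_left]
    by_cases hst : s = t'
    · subst hst
      rw [wordIncl_ip, wordIncl_ip, wordCons_ip, PointedCorr.ip_proj_left]
    · rw [wordIncl_ip_ne H _ _ _ hst, wordIncl_ip_ne H _ _ _ (by simpa using hst)]
  · have hne : j :: s ≠ t := by rintro rfl; exact h2 rfl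
    have hne' : s ≠ t := by rintro rfl; exact h1 hs
    rw [branchDec_other T H j t ht h1 h2, SemiCorr.ip_zero_right, wordIncl_ip_ne H _ _ _ hne,
      wordIncl_ip_ne H _ _ _ hne', add_zero]

theorem branchMk_balanced (x : (branchProd T H j).carrier) (h : (H j).carrier) (b : B)
    (v : (wordSum H (T.branch j)).carrier) :
    (branchProd T H j).form.ip x (branchMk T H j ((H j).form.right (op b) h) v) =
      (branchProd T H j).form.ip x
        (branchMk T H j h ((wordSum H (T.branch j)).form.left b v)) := by
  refine branchProd_induction T H j (p := fun x =>
    (branchProd T H j).form.ip x (branchMk T H j ((H j).form.right (op b) h) v) =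
      (branchProd T H j).form.ip x
        (branchMk T H j h ((wordSum H (T.branch j)).form.left b v))) x ?_ ?_ ?_
  · rw [SemiCorr.ip_zero_left, SemiCorr.ip_zero_left]
  · intro x y hx hy
    rw [SemiCorr.ip_add_left, SemiCorr.ip_add_left, hx, hy]
  intro k s hs u
  rw [branchMk_ip, branchMk_ip, SemiCorr.ip_right, map_mul, Module.End.mul_apply]

/-- `branchIns` preserves the semi-inner product. -/
theorem branchIns_isometry (w w' : (branchProd T H j).carrier) :
    (wordSum H T.strings).form.ip (branchIns T H j w) (branchIns T H j w') =
      (branchProd T H j).form.ip w w' := by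
  rw [ip_branchIns]
  refine branchProd_induction T H j (p := fun w' =>
    (branchProd T H j).form.ip w (branchDec T H j (branchIns T H j w')) =
      (branchProd T H j).form.ip w w') w' ?_ ?_ ?_
  · simp only [map_zero]
  · intro x y hx hy
    simp only [map_add, SemiCorr.ip_add_right, hx, hy]
  intro h s hs v
  rw [branchIns_mk, map_add, branchDec_branch T H j s hs, branchDec_cons, SemiCorr.ip_add_right,
    ← wordIncl_left, ← branchMk_balanced, PointedCorr.incl_proj, map_sub, LinearMap.sub_apply,
    SemiCorr.ip_sub_right]
  abel

theorem nrm_branchIns (w : (branchProd T H j).carrier) :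
    (wordSum H T.strings).form.nrm (branchIns T H j w) = (branchProd T H j).form.nrm w := by
  rw [SemiCorr.nrm, branchIns_isometry, SemiCorr.nrm]

theorem nrm_branchDec_le (v : (wordSum H T.strings).carrier) :
    (branchProd T H j).form.nrm (branchDec T H j v) ≤ (wordSum H T.strings).form.nrm v := by
  have h : (branchProd T H j).form.nrm (branchDec T H j v) ^ 2 ≤
      (branchProd T H j).form.nrm (branchDec T H j v) * (wordSum H T.strings).form.nrm v := by
    rw [SemiCorr.nrm_sq, ← ip_branchIns]
    refine (SemiCorr.norm_ip_le _ _ _).trans ?_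
    rw [nrm_branchIns]
  have h1 := (branchProd T H j).form.nrm_nonneg (branchDec T H j v)
  have h2 := (wordSum H T.strings).form.nrm_nonneg v
  nlinarith

/-- `U_{T,j}^* ((x ⊗ 1) ⊕ 0) U_{T,j}` before completion. -/
noncomputable def lamPre (x : Module.End ℂ (H j).carrier) :
    Module.End ℂ (wordSum H T.strings).carrier :=
  branchIns T H j ∘ₗ LinearMap.rTensor (wordSum H (T.branch j)).carrier x ∘ₗ branchDec T H j

theorem ip_lamPre {x y : Module.End ℂ (H j).carrier}
    (h : ∀ u v, (H j).form.ip (x u) v = (H j).form.ip u (y v))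
    (u v : (wordSum H T.strings).carrier) :
    (wordSum H T.strings).form.ip (lamPre T H j x u) v =
      (wordSum H T.strings).form.ip u (lamPre T H j y v) := by
  have h1 : ∀ u w, (wordSum H T.strings).form.ip u (branchIns T H j w) =
      (branchProd T H j).form.ip (branchDec T H j u) w := fun u w => by
    rw [← SemiCorr.ip_star, ip_branchIns, SemiCorr.ip_star]
  refine (ip_branchIns ..).trans (Eq.trans ?_ (h1 ..).symm)
  exact SemiCorr.ip_rTensor _ _ h _ _

theorem lamPre_bound {x y : (H j).carrier →L[ℂ] (H j).carrier}
    (h : ∀ u v, (H j).form.ip (x u) v = (H j).form.ip u (y v)) :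
    ∃ C, ∀ v, (wordSum H T.strings).form.nrm (lamPre T H j x.toLinearMap v) ≤
      C * (wordSum H T.strings).form.nrm v := by
  refine ⟨√(‖y‖ * ‖x‖), fun v => ?_⟩
  refine (nrm_branchIns ..).le.trans ?_
  refine (SemiCorr.nrm_rTensor_le (H j).form (wordSum H (T.branch j)).form (S := y) h
    (c := ‖y‖ * ‖x‖) (by positivity) (fun u => ?_) _).trans ?_
  · have hn : ∀ u, (H j).form.nrm u = ‖u‖ := fun u => ((H j).norm_eq u).symm
    rw [hn, hn, mul_assoc]
    exact (y.le_opNorm _).trans (mul_le_mul_of_nonneg_left (x.le_opNorm _) (norm_nonneg _))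
  · exact mul_le_mul_of_nonneg_left (nrm_branchDec_le ..) (Real.sqrt_nonneg _)

theorem lamPre_bound_L (x : (H j).L) :
    ∃ C, ∀ v, (wordSum H T.strings).form.nrm (lamPre T H j x.1.toLinearMap v) ≤
      C * (wordSum H T.strings).form.nrm v :=
  x.2.2.elim fun _ h => lamPre_bound T H j h

/-- The extension of `lamPre` to the completion. -/
noncomputable def lamHat (x : Module.End ℂ (H j).carrier)
    (hx : ∃ C, ∀ v, (wordSum H T.strings).form.nrm (lamPre T H j x v) ≤
      C * (wordSum H T.strings).form.nrm v) :
    (freeProd T H).carrier →L[ℂ] (freeProd T H).carrier :=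
  SemiCorr.hatMap (F := (wordSum H T.strings).form) (G := (wordSum H T.strings).form)
    (lamPre T H j x) hx

theorem ip_lamHat {x y : Module.End ℂ (H j).carrier}
    (h : ∀ u v, (H j).form.ip (x u) v = (H j).form.ip u (y v)) (hx hy)
    (u v : (freeProd T H).carrier) :
    (freeProd T H).form.ip (lamHat T H j x hx u) v =
      (freeProd T H).form.ip u (lamHat T H j y hy v) := by
  let F := (wordSum H T.strings).form
  refine F.hat_ind₂ (p := fun u v => F.ipHat (SemiCorr.hatMap _ hx u) v =
    F.ipHat u (SemiCorr.hatMap _ hy v)) u v (isClosed_eq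
      (Continuous.ipHat F (by fun_prop) (by fun_prop))
      (Continuous.ipHat F (by fun_prop) (by fun_prop))) fun u v => ?_
  rw [SemiCorr.hatMap_toHat, SemiCorr.hatMap_toHat, F.ipHat_toHat, F.ipHat_toHat]
  exact ip_lamPre T H j h u v

theorem lamHat_mem (x : (H j).L) :
    lamHat T H j x.1.toLinearMap (lamPre_bound_L T H j x) ∈ (freeProd T H).L := by
  obtain ⟨y, h⟩ := x.2.2
  have h' : ∀ u v, (H j).form.ip (y u) v = (H j).form.ip u (x.1 v) := fun u v => by
    rw [← SemiCorr.ip_star, ← h, SemiCorr.ip_star]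
  exact HilbertCorr.mem_L_of_adjoint (H := (freeProd T H).toHilbertCorr)
    (S := lamHat T H j y.toLinearMap (lamPre_bound T H j h')) fun u v =>
      ip_lamHat T H j (x := x.1.toLinearMap) (y := y.toLinearMap) h _ _ u v

/-- The inclusion `λ_{T,j} : L(H_j) → L(H)`, `x ↦ U_{T,j}^* ((x ⊗ 1) ⊕ 0) U_{T,j}`. -/
noncomputable def treeLam (x : (H j).L) : (freeProd T H).L :=
  ⟨lamHat T H j x.1.toLinearMap (lamPre_bound_L T H j x), lamHat_mem T H j x⟩

theorem lam_symm {x : (H j).L} (h : ∀ u v, (H j).form.ip (x.1 u) v = (H j).form.ip u (x.1 v))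
    (u v : (freeProd T H).carrier) :
    (freeProd T H).form.ip ((treeLam T H j x).1 u) v = (freeProd T H).form.ip u ((treeLam T H j x).1 v) :=
  ip_lamHat T H j (x := x.1.toLinearMap) (y := x.1.toLinearMap) h (lamPre_bound_L T H j x)
    (lamPre_bound_L T H j x) u v

end product

namespace StringTree

/-- The alphabet of a composition: `i ↦ N₁ + ⋯ + N_{j-1} + i` for the `i`-th letter of the
`j`-th alphabet (counting from `1`). -/
def letter {k : ℕ} {n : Fin k → ℕ} (j : Fin k) (i : Fin (n j)) : Fin (∑ j, n j) :=
  finSigmaFinEquiv ⟨j, i⟩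

variable {k : ℕ} {n : Fin k → ℕ} (T : StringTree (Fin k)) (S : ∀ j, StringTree (Fin (n j)))

/-- The strings of `T(S₁, …, S_k)`: the concatenations of (relabelled) nonempty strings
`s₁ ∈ S_{i₁}, …, s_l ∈ S_{i_l}` with `i₁ ⋯ i_l ∈ T`. -/
def compStrings : Set (List (Fin (∑ j, n j))) :=
  {w | ∃ l : List (Σ j, List (Fin (n j))), l.map Sigma.fst ∈ T.strings ∧
    (∀ p ∈ l, p.2 ∈ (S p.1).strings ∧ p.2 ≠ []) ∧
    w = l.flatMap fun p => p.2.map (letter p.1)}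

/-- The composition `T(S₁, …, S_k)`. -/
def comp : StringTree (Fin (∑ j, n j)) :=
  ofStrings (T.compStrings S) ⟨[], T.nil_mem, by simp, rfl⟩
    (by
      rintro _ ⟨l, hl, h, rfl⟩
      rw [List.flatMap_def, List.isChain_flatten (by
        intro h0
        obtain ⟨p, hp, h0⟩ := List.mem_map.mp h0
        exact (h p hp).2 (List.map_eq_nil_iff.mp h0))]
      constructor
      · intro s hs
        obtain ⟨p, hp, rfl⟩ := List.mem_map.mp hs
        refine (List.isChain_map _).mpr (((S p.1).alternating (h p hp).1).imp fun a b hab hne => ?_)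
        have := finSigmaFinEquiv.injective hne
        simp at this
        exact hab this
      · have h2 := T.alternating hl
        rw [List.isChain_map] at h2 ⊢
        refine h2.imp fun p q hpq x hx y hy hxy => hpq ?_
        simp only [List.getLast?_map, List.head?_map, Option.mem_def, Option.map_eq_some_iff] at hx hy
        obtain ⟨a, -, rfl⟩ := hx
        obtain ⟨b, -, rfl⟩ := hy
        have : (⟨p.1, a⟩ : Σ j, Fin (n j)) = ⟨q.1, b⟩ := finSigmaFinEquiv.injective hxy
        have h3 := congrArg Sigma.fst this
        exact h3)
    (by
      rintro i s ⟨l, hl, h, hw⟩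
      cases l with
      | nil => simp at hw
      | cons p l =>
        obtain ⟨j, t⟩ := p
        have h0 := h ⟨j, t⟩ (by simp)
        cases t with
        | nil => exact absurd rfl h0.2
        | cons a t =>
          simp only [List.flatMap_cons, List.map_cons, List.cons_append, List.cons.injEq] at hw
          obtain ⟨-, rfl⟩ := hw
          by_cases ht : t = []
          · subst ht
            exact ⟨l, T.mem_of_cons hl, fun p hp => h p (by simp [hp]), by simp⟩
          · refine ⟨⟨j, t⟩ :: l, hl, fun p hp => ?_, by simp⟩
            rcases List.mem_cons.mp hp with rfl | hp
            · exact ⟨(S j).mem_of_cons h0.1, ht⟩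
            · exact h p (by simp [hp]))

/-- The identity of the operad: the tree with vertices `∅` and `1` on the alphabet `{1}`. -/
def identity : StringTree (Fin 1) :=
  ofStrings {[], [0]} (by simp) (by simp) (by rintro j s (h | h) <;> simp_all)

end StringTree

/-- Isomorphisms of pointed correspondences: inner-product-preserving `B`-`B`-bimodule isomorphisms
that map unit vector to unit vector. -/
structure PointedIso {B : Type u} [CStarAlgebra B] [PartialOrder B] (H K : PointedCorr B) where
  toEquiv : H.carrier ≃ₗᵢ[ℂ] K.carrier
  map_ip : ∀ u v, K.form.ip (toEquiv u) (toEquiv v) = H.form.ip u v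
  map_left : ∀ b v, toEquiv (H.form.left b v) = K.form.left b (toEquiv v)
  map_right : ∀ b v, toEquiv (H.form.right b v) = K.form.right b (toEquiv v)
  map_ξ : toEquiv H.ξ = K.ξ

/-- `Ad_Φ(x) = Φ x Φ^*`, for a unitary isomorphism `Φ : H → K`. -/
noncomputable def PointedIso.Ad {B : Type u} [CStarAlgebra B] [PartialOrder B]
    {H K : PointedCorr B} (Φ : PointedIso H K) (x : H.L) : K.L :=
  ⟨(Φ.toEquiv : H.carrier →L[ℂ] K.carrier) ∘L x.1 ∘L (Φ.toEquiv.symm : K.carrier →L[ℂ] H.carrier),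
    x.2.2.elim fun y h => HilbertCorr.mem_L_of_adjoint (H := K.toHilbertCorr)
      (S := (Φ.toEquiv : H.carrier →L[ℂ] K.carrier) ∘L y ∘L
        (Φ.toEquiv.symm : K.carrier →L[ℂ] H.carrier)) fun u v => by
      have h1 : ∀ a c, K.form.ip (Φ.toEquiv a) c = H.form.ip a (Φ.toEquiv.symm c) := fun a c => by
        rw [← Φ.map_ip, LinearIsometryEquiv.apply_symm_apply]
      have h2 : ∀ a c, K.form.ip c (Φ.toEquiv a) = H.form.ip (Φ.toEquiv.symm c) a := fun a c => by
        rw [← Φ.map_ip, LinearIsometryEquiv.apply_symm_apply]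
      change K.form.ip (Φ.toEquiv (x.1 (Φ.toEquiv.symm u))) v =
        K.form.ip u (Φ.toEquiv (y (Φ.toEquiv.symm v)))
      rw [h1, h2, h]⟩

/-- The relations which make the generators `some b` a copy of the algebra `B`. -/
inductive NCPoly.Rel (B : Type u) [CStarAlgebra B] :
    FreeAlgebra ℂ (Option B) → FreeAlgebra ℂ (Option B) → Prop
  | add (a b : B) : Rel B (FreeAlgebra.ι ℂ (some (a + b)))
      (FreeAlgebra.ι ℂ (some a) + FreeAlgebra.ι ℂ (some b))
  | mul (a b : B) : Rel B (FreeAlgebra.ι ℂ (some (a * b)))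
      (FreeAlgebra.ι ℂ (some a) * FreeAlgebra.ι ℂ (some b))
  | smul (z : ℂ) (b : B) : Rel B (FreeAlgebra.ι ℂ (some (z • b)))
      (z • FreeAlgebra.ι ℂ (some b))
  | one : Rel B (FreeAlgebra.ι ℂ (some 1)) 1

/-- The algebra `B⟨X⟩` of non-commutative polynomials: the unital `*`-algebra generated by `B` and
a self-adjoint indeterminate `X`. -/
def NCPoly (B : Type u) [CStarAlgebra B] : Type u := RingQuot (NCPoly.Rel B)

/-- The opposite algebra of `A` with the conjugate scalar multiplication. -/
def ConjOp (A : Type u) : Type u := Aᵐᵒᵖ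

namespace ConjOp

variable (A : Type u) [Ring A] [Algebra ℂ A]

noncomputable instance : Ring (ConjOp A) := inferInstanceAs (Ring Aᵐᵒᵖ)
noncomputable instance : Algebra ℂ (ConjOp A) :=
  RingHom.toAlgebra' ((algebraMap ℂ Aᵐᵒᵖ).comp (starRingEnd ℂ)) fun z x =>
    Algebra.commutes (A := Aᵐᵒᵖ) (starRingEnd ℂ z) x

variable {A}

/-- An element of `A` as an element of `ConjOp A`. -/
def mk (x : A) : ConjOp A := op x

theorem mk_one : mk (1 : A) = 1 := rfl
theorem mk_add (x y : A) : mk (x + y) = mk x + mk y := rfl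
theorem mk_mul (x y : A) : mk (x * y) = mk y * mk x := rfl

theorem mk_smul (z : ℂ) (x : A) : mk (star z • x) = z • mk x := by
  rw [Algebra.smul_def, Algebra.smul_def, Algebra.commutes]
  rfl

theorem unop_smul (z : ℂ) (x : ConjOp A) :
    MulOpposite.unop (z • x : ConjOp A) = star z • (MulOpposite.unop x : A) :=
  congrArg MulOpposite.unop (mk_smul z (MulOpposite.unop x : A)).symm

end ConjOp

namespace NCPoly

variable {B : Type u} [CStarAlgebra B]

noncomputable instance : Ring (NCPoly B) := inferInstanceAs (Ring (RingQuot (NCPoly.Rel B)))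
noncomputable instance : Algebra ℂ (NCPoly B) :=
  inferInstanceAs (Algebra ℂ (RingQuot (NCPoly.Rel B)))

noncomputable def mk : FreeAlgebra ℂ (Option B) →ₐ[ℂ] NCPoly B := RingQuot.mkAlgHom ℂ (NCPoly.Rel B)

theorem mk_rel {x y : FreeAlgebra ℂ (Option B)} (h : NCPoly.Rel B x y) : mk x = mk y :=
  RingQuot.mkAlgHom_rel ℂ h

/-- The inclusion `B → B⟨X⟩`. -/
noncomputable def coef : B →ₐ[ℂ] NCPoly B :=
  AlgHom.ofLinearMap
    { toFun := fun b => mk (FreeAlgebra.ι ℂ (some b))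
      map_add' := fun a b => by rw [mk_rel (.add a b), map_add]
      map_smul' := fun z b => by rw [mk_rel (.smul z b), map_smul]; rfl }
    ((mk_rel .one).trans (map_one _)) (fun a b => (mk_rel (.mul a b)).trans (map_mul _ _ _))

/-- The indeterminate. -/
noncomputable def X : NCPoly B := mk (FreeAlgebra.ι ℂ none)

/-- Evaluation: the extension of an algebra homomorphism on `B` with a prescribed value at `X`. -/
noncomputable def lift {C : Type*} [Ring C] [Algebra ℂ C] (f : B →ₐ[ℂ] C) (c : C) :
    NCPoly B →ₐ[ℂ] C :=
  RingQuot.liftAlgHom ℂ ⟨FreeAlgebra.lift ℂ fun o => o.elim c f, fun x y h => by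
    cases h <;> simp⟩

theorem lift_coef {C : Type*} [Ring C] [Algebra ℂ C] (f : B →ₐ[ℂ] C) (c : C) (b : B) :
    lift f c (coef b) = f b := by
  refine (RingQuot.liftAlgHom_mkAlgHom_apply ℂ _ _ _).trans ?_
  simp

theorem lift_X {C : Type*} [Ring C] [Algebra ℂ C] (f : B →ₐ[ℂ] C) (c : C) :
    lift f c X = c := by
  refine (RingQuot.liftAlgHom_mkAlgHom_apply ℂ _ _ _).trans ?_
  simp

theorem induction {p : NCPoly B → Prop} (hb : ∀ b, p (coef b)) (hX : p X)
    (hadd : ∀ x y, p x → p y → p (x + y)) (hmul : ∀ x y, p x → p y → p (x * y)) (x : NCPoly B) :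
    p x := by
  obtain ⟨y, rfl⟩ := RingQuot.mkAlgHom_surjective ℂ (NCPoly.Rel B) x
  refine FreeAlgebra.induction ℂ (Option B) (motive := fun y => p (mk y)) ?_ ?_ ?_ ?_ y
  · intro z
    have := hb (algebraMap ℂ B z)
    rwa [AlgHom.commutes, ← AlgHom.commutes mk] at this
  · intro o
    cases o with
    | none => exact hX
    | some b => exact hb b
  · intro a b ha hb; rw [map_mul]; exact hmul _ _ ha hb
  · intro a b ha hb; rw [map_add]; exact hadd _ _ ha hb

/-- The involution, with values in the conjugate opposite algebra. -/
noncomputable def starHom : NCPoly B →ₐ[ℂ] ConjOp (NCPoly B) :=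
  lift (AlgHom.ofLinearMap
    { toFun := fun b => ConjOp.mk (coef (star b))
      map_add' := fun a b => by rw [star_add, map_add, ConjOp.mk_add]
      map_smul' := fun z b => by rw [star_smul, map_smul, ConjOp.mk_smul]; rfl }
    (by
      change ConjOp.mk (coef (star 1)) = 1
      rw [star_one, map_one, ConjOp.mk_one])
    (fun a b => by
      change ConjOp.mk (coef (star (a * b))) = ConjOp.mk (coef (star a)) * ConjOp.mk (coef (star b))
      rw [star_mul, map_mul, ConjOp.mk_mul]))
    (ConjOp.mk X)

noncomputable instance : Star (NCPoly B) := ⟨fun p => MulOpposite.unop (starHom p)⟩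

theorem star_coef (b : B) : star (coef b) = coef (star b) :=
  congrArg MulOpposite.unop (lift_coef (C := ConjOp (NCPoly B)) _ _ b)

theorem star_X : star (X : NCPoly B) = X :=
  congrArg MulOpposite.unop (lift_X (C := ConjOp (NCPoly B)) _ _)

theorem star_add_aux (p q : NCPoly B) : star (p + q) = star p + star q :=
  congrArg MulOpposite.unop (map_add starHom p q)

theorem star_mul_aux (p q : NCPoly B) : star (p * q) = star q * star p :=
  congrArg MulOpposite.unop (map_mul starHom p q)

noncomputable instance : StarRing (NCPoly B) where
  star_involutive p := by
    refine induction (p := fun p => star (star p) = p) ?_ ?_ ?_ ?_ p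
    · intro b; rw [star_coef, star_coef, star_star]
    · rw [star_X, star_X]
    · intro p q hp hq; rw [star_add_aux, star_add_aux, hp, hq]
    · intro p q hp hq; rw [star_mul_aux, star_mul_aux, hp, hq]
  star_mul := star_mul_aux
  star_add := star_add_aux

instance : StarModule ℂ (NCPoly B) where
  star_smul z p := congrArg MulOpposite.unop
    (map_smul starHom z p) |>.trans (ConjOp.unop_smul z (starHom p))

/-- The monomial `b₀ X b₁ X b₂ ⋯ X bₗ`. -/
noncomputable def monomial (b₀ : B) (bs : List B) : NCPoly B :=
  coef b₀ * (bs.map fun b => X * coef b).prod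

/-- The product of a string of letters from `B ∪ {X}`, where `none` stands for `X`. -/
noncomputable def letters (w : List (Option B)) : NCPoly B := (w.map fun o => o.elim X coef).prod

theorem letters_append (w w' : List (Option B)) : letters (w ++ w') = letters w * letters w' := by
  simp [letters]

theorem letters_induction {p : NCPoly B → Prop} (h0 : p 0)
    (hadd : ∀ x y, p x → p y → p (x + y)) (hw : ∀ w, p (letters w)) (x : NCPoly B) : p x := by
  let S := AddSubmonoid.closure (Set.range (letters (B := B)))
  have hmul : ∀ x ∈ S, ∀ y ∈ S, x * y ∈ S := by
    intro x hx y hy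
    induction hx using AddSubmonoid.closure_induction with
    | zero => rw [zero_mul]; exact S.zero_mem
    | add a b _ _ ha hb => rw [add_mul]; exact S.add_mem ha hb
    | mem a ha =>
      obtain ⟨w, rfl⟩ := ha
      induction hy using AddSubmonoid.closure_induction with
      | zero => rw [mul_zero]; exact S.zero_mem
      | add a b _ _ ha hb => rw [mul_add]; exact S.add_mem ha hb
      | mem b hb =>
        obtain ⟨w', rfl⟩ := hb
        rw [← letters_append]
        exact AddSubmonoid.subset_closure ⟨_, rfl⟩
  have hx : x ∈ S := induction (p := (· ∈ S))
    (fun b => AddSubmonoid.subset_closure ⟨[some b], by simp [letters]⟩)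
    (AddSubmonoid.subset_closure ⟨[none], by simp [letters]⟩)
    (fun _ _ => S.add_mem) (fun x y hx hy => hmul x hx y hy) x
  induction hx using AddSubmonoid.closure_induction with
  | zero => exact h0
  | add a b _ _ ha hb => exact hadd _ _ ha hb
  | mem a ha => obtain ⟨w, rfl⟩ := ha; exact hw w

theorem norm_one_le : ‖(1 : B)‖ ≤ 1 := by
  nontriviality B
  exact CStarRing.norm_one.le

/-- The weight of a string of letters, where `X` has weight `R`. -/
noncomputable def weight (R : ℝ) (w : List (Option B)) : ℝ := (w.map fun o => o.elim R norm).prod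

theorem weight_nonneg {R : ℝ} (hR : 0 ≤ R) (w : List (Option B)) : 0 ≤ weight R w :=
  List.prod_nonneg fun x hx => by
    obtain ⟨o, -, rfl⟩ := List.mem_map.mp hx
    cases o
    exacts [hR, norm_nonneg _]

theorem letters_eq_monomial {R : ℝ} (hR : 0 ≤ R) (w : List (Option B)) : ∃ b₀ bs,
    letters w = monomial b₀ bs ∧ R ^ bs.length * (‖b₀‖ * (bs.map norm).prod) ≤ weight R w := by
  induction w with
  | nil => exact ⟨1, [], by simp [letters, monomial], by simpa [weight] using norm_one_le⟩
  | cons o w ih =>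
    obtain ⟨b₀, bs, h1, h2⟩ := ih
    have h3 : letters (o :: w) = o.elim X coef * letters w := by simp [letters]
    have h4 : weight R (o :: w) = o.elim R norm * weight R w := by simp [weight]
    have h5 : 0 ≤ (bs.map norm).prod := List.prod_nonneg fun x hx => by
      obtain ⟨o, -, rfl⟩ := List.mem_map.mp hx
      exact norm_nonneg _
    cases o with
    | none =>
      refine ⟨1, b₀ :: bs, ?_, ?_⟩
      · rw [h3, h1]; simp [monomial, mul_assoc]
      · rw [h4]
        calc _ = ‖(1 : B)‖ * (R * (R ^ bs.length * (‖b₀‖ * (bs.map norm).prod))) := by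
              simp only [List.length_cons, List.map_cons, List.prod_cons]; ring
          _ ≤ 1 * (R * weight R w) := by
              have := weight_nonneg hR w
              gcongr
              exact norm_one_le
          _ = _ := one_mul _
    | some b =>
      refine ⟨b * b₀, bs, ?_, ?_⟩
      · rw [h3, h1]; simp [monomial, mul_assoc]
      · rw [h4]
        calc _ ≤ R ^ bs.length * (‖b‖ * ‖b₀‖ * (bs.map norm).prod) := by
              gcongr; exact norm_mul_le _ _
          _ = ‖b‖ * (R ^ bs.length * (‖b₀‖ * (bs.map norm).prod)) := by ring
          _ ≤ ‖b‖ * weight R w := by gcongr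

theorem star_letters (w : List (Option B)) :
    star (letters w) = letters (w.reverse.map (Option.map star)) := by
  induction w with
  | nil => exact star_one _
  | cons o w ih =>
    have h3 : letters (o :: w) = letters [o] * letters w := by
      rw [← letters_append]; rfl
    rw [h3, star_mul, ih, List.reverse_cons, List.map_append, letters_append]
    congr 1
    cases o
    · simp [letters, star_X]
    · simp [letters, star_coef]

theorem weight_star (R : ℝ) (w : List (Option B)) :
    weight R (w.reverse.map (Option.map star)) = weight R w := by
  rw [weight, List.map_map, List.map_reverse, List.prod_reverse, weight]
  congr 1
  refine List.map_congr_left fun o _ => ?_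
  cases o <;> simp

theorem weight_append (R : ℝ) (w w' : List (Option B)) :
    weight R (w ++ w') = weight R w * weight R w' := by simp [weight]

end NCPoly

open NCPoly in
/-- A `B`-valued law: a linear map `μ : B⟨X⟩ → B` which is unital, a `B`-`B`-bimodule map,
completely positive, and exponentially bounded. -/
@[ext]
structure Law (B : Type u) [CStarAlgebra B] [PartialOrder B] [StarOrderedRing B] where
  toLin : NCPoly B →ₗ[ℂ] B
  unital : toLin 1 = 1
  bimodule : ∀ a p b, toLin (coef a * p * coef b) = a * toLin p * b
  completely_positive : ∀ (n : ℕ) (P : Matrix (Fin n) (Fin n) (NCPoly B)),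
    0 ≤ CStarMatrix.ofMatrix ((P.conjTranspose * P).map toLin)
  exp_bounded : ∃ M R : ℝ, 0 < M ∧ 0 < R ∧ ∀ b₀ bs,
    ‖toLin (monomial b₀ bs)‖ ≤ M * (R ^ bs.length * (‖b₀‖ * (bs.map norm).prod))

namespace Law

open NCPoly

variable {B : Type u} [CStarAlgebra B] [PartialOrder B] [StarOrderedRing B] (μ : Law B)

theorem nonneg (p : NCPoly B) : 0 ≤ μ.toLin (star p * p) := by
  have h := CStarMatrix.diag_nonneg (μ.completely_positive 1 fun _ _ => p) 0
  change 0 ≤ μ.toLin (∑ _ : Fin 1, star p * p) at h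
  rwa [Fin.sum_univ_one] at h

theorem map_star (p : NCPoly B) : μ.toLin (star p) = star (μ.toLin p) := by
  have h : ∀ z : ℂ, star (z • μ.toLin p + star z • μ.toLin (star p)) =
      z • μ.toLin p + star z • μ.toLin (star p) := by
    intro z
    have h1 := (μ.nonneg (1 + z • p)).isSelfAdjoint.star_eq
    have h2 := (μ.nonneg (z • p)).isSelfAdjoint.star_eq
    have h3 : μ.toLin (star (1 + z • p) * (1 + z • p)) =
        1 + μ.toLin (star (z • p) * (z • p)) + (z • μ.toLin p + star z • μ.toLin (star p)) := by
      rw [star_add, star_one, star_smul, add_mul, one_mul, mul_add, mul_one, map_add, map_add,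
        map_add, μ.unital, map_smul, map_smul]
      abel
    rw [h3, star_add, star_add, h2, star_one] at h1
    exact add_left_cancel h1
  have h1 := h 1
  have h2 := h Complex.I
  simp only [star_add, star_smul, star_one, one_smul, star_star] at h1 h2
  have h3 := congrArg (fun x => (-Complex.I) • x) h2
  simp only [smul_add, smul_smul] at h3
  simp at h3
  have h4 : (2 : ℂ) • star (μ.toLin p) = (2 : ℂ) • μ.toLin (star p) := by
    rw [two_smul, two_smul]
    have h5 : star (μ.toLin p) = μ.toLin p + μ.toLin (star p) - star (μ.toLin (star p)) :=
      eq_sub_of_add_eq h1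
    have h6 : star (μ.toLin (star p)) - star (μ.toLin p) = μ.toLin p - μ.toLin (star p) := by
      rw [sub_eq_add_neg, sub_eq_add_neg, add_comm, h3]
    have h7 : star (μ.toLin p) = star (μ.toLin (star p)) - (μ.toLin p - μ.toLin (star p)) := by
      rw [← h6]; abel
    nth_rewrite 1 [h5]
    rw [h7]
    abel
  exact (smul_right_injective B (two_ne_zero (α := ℂ)) h4).symm

/-- `B⟨X⟩` with the semi-inner product `⟨p, q⟩ = μ(p^* q)`. -/
noncomputable def form : SemiCorr B (NCPoly B) where
  left := (Algebra.lmul ℂ (NCPoly B)).comp coef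
  right := AlgHom.ofLinearMap
    { toFun := fun b => LinearMap.mulRight ℂ (coef b.unop)
      map_add' := fun a b => by ext; simp [mul_add]
      map_smul' := fun z b => by ext; simp }
    (by ext; simp) (fun a b => by ext; simp [mul_assoc])
  left_right a b p := (mul_assoc _ _ _).symm
  ip p q := μ.toLin (star p * q)
  ip_add_right p q r := by rw [mul_add, map_add]
  ip_right p q b := by
    have := μ.bimodule 1 (star p * q) b
    rw [map_one, one_mul, one_mul] at this
    rw [← this, mul_assoc]
    rfl
  ip_star p q := by rw [← μ.map_star, star_mul, star_star]
  ip_nonneg := μ.nonneg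
  ip_left b p q := by
    change μ.toLin (star (coef b * p) * q) = μ.toLin (star p * (coef (star b) * q))
    rw [star_mul, star_coef, mul_assoc]

/-- The pointed correspondence `L²(B⟨X⟩, μ)`, the separation-completion of `B⟨X⟩` with respect to
`⟨p, q⟩ = μ(p^* q)`, pointed by the class of `1`. -/
noncomputable def L2 : PointedCorr B :=
  (PreCorr.mk (NCPoly B) μ.form).pointedCompletion (1 : NCPoly B)
    (by
      change μ.toLin (star 1 * 1) = 1
      rw [star_one, one_mul, μ.unital])
    (fun b => (mul_one (coef b)).trans (one_mul (coef b)).symm)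

/-- Left multiplication by `X` on `B⟨X⟩`. -/
noncomputable def mulXPre : Module.End ℂ (NCPoly B) := LinearMap.mulLeft ℂ X

theorem ip_mulXPre (p q : NCPoly B) : μ.form.ip (mulXPre p) q = μ.form.ip p (mulXPre q) := by
  change μ.toLin (star (X * p) * q) = μ.toLin (star p * (X * q))
  rw [star_mul, star_X, mul_assoc]

theorem mulXPre_bound : ∃ C, ∀ p, μ.form.nrm (mulXPre p) ≤ C * μ.form.nrm p := by
  obtain ⟨M, R, hM, hR, h⟩ := μ.exp_bounded
  refine ⟨R, fun p => ?_⟩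
  have hgrow : ∃ C, ∀ m : ℕ, μ.form.nrm ((mulXPre ^ m) p) ≤ C * R ^ m := by
    refine letters_induction (p := fun p => ∃ C, ∀ m : ℕ,
      μ.form.nrm ((mulXPre ^ m) p) ≤ C * R ^ m) ?_ ?_ ?_ p
    · exact ⟨0, fun m => by simp [SemiCorr.nrm, SemiCorr.ip_zero_left]⟩
    · rintro x y ⟨C, hC⟩ ⟨C', hC'⟩
      refine ⟨C + C', fun m => ?_⟩
      rw [map_add, add_mul]
      exact (SemiCorr.nrm_add_le _ _ _).trans (add_le_add (hC m) (hC' m))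
    · intro w
      refine ⟨√M * weight R w, fun m => ?_⟩
      have h1 : (mulXPre ^ m) (letters w) = letters (List.replicate m none ++ w) := by
        have h2 : ∀ q : NCPoly B, (mulXPre ^ m) q = X ^ m * q := fun q => by
          rw [mulXPre, LinearMap.pow_mulLeft]; rfl
        rw [h2, letters_append]
        simp [letters]
      have h3 : weight R (List.replicate m none ++ w) = R ^ m * weight R w := by
        rw [weight_append]; simp [weight]
      rw [h1]
      have hw := weight_nonneg hR.le (List.replicate m none ++ w)
      have h4 : μ.form.nrm (letters (List.replicate m none ++ w)) ≤
          √M * weight R (List.replicate m none ++ w) := by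
        refine Real.sqrt_le_iff.mpr ⟨mul_nonneg (Real.sqrt_nonneg _) hw, ?_⟩
        change ‖μ.toLin (star (letters _) * letters _)‖ ≤ _
        rw [star_letters, ← letters_append]
        obtain ⟨b₀, bs, h5, h6⟩ := letters_eq_monomial hR.le
          ((List.replicate m none ++ w).reverse.map (Option.map star) ++
            (List.replicate m none ++ w))
        rw [h5]
        refine (h b₀ bs).trans ((mul_le_mul_of_nonneg_left h6 hM.le).trans ?_)
        rw [weight_append, weight_star, mul_pow, Real.sq_sqrt hM.le, pow_two]
      refine h4.trans (le_of_eq ?_)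
      rw [h3]; ring
  obtain ⟨C, hC⟩ := hgrow
  exact μ.form.nrm_le_of_growth _ μ.ip_mulXPre hR.le p hC

/-- The operator of left multiplication by `X` on `L²(B⟨X⟩, μ)`. -/
noncomputable def mulXHat : μ.L2.carrier →L[ℂ] μ.L2.carrier :=
  SemiCorr.hatMap (F := μ.form) (G := μ.form) mulXPre μ.mulXPre_bound

theorem mulXHat_symm (u v : μ.L2.carrier) :
    μ.L2.form.ip (μ.mulXHat u) v = μ.L2.form.ip u (μ.mulXHat v) := by
  let F := μ.form
  refine F.hat_ind₂ (p := fun u v => F.ipHat (SemiCorr.hatMap mulXPre μ.mulXPre_bound u) v =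
    F.ipHat u (SemiCorr.hatMap mulXPre μ.mulXPre_bound v)) u v (isClosed_eq
      (Continuous.ipHat F (by fun_prop) (by fun_prop))
      (Continuous.ipHat F (by fun_prop) (by fun_prop))) fun u v => ?_
  rw [SemiCorr.hatMap_toHat, F.ipHat_toHat, SemiCorr.hatMap_toHat, F.ipHat_toHat]
  exact μ.ip_mulXPre u v

/-- The operator of multiplication by `X` as an element of `L(L²(B⟨X⟩, μ))`. -/
noncomputable def mulX : μ.L2.L :=
  ⟨μ.mulXHat, HilbertCorr.mem_L_of_adjoint (H := μ.L2.toHilbertCorr) μ.mulXHat_symm⟩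

end Law

namespace PointedCorr

open NCPoly

variable {B : Type u} [CStarAlgebra B] [PartialOrder B] (H : PointedCorr B)

/-- Evaluation `p ↦ p(Y)` of non-commutative polynomials at an operator. -/
noncomputable def eval (Y : H.L) : NCPoly B →ₐ[ℂ] Module.End ℂ H.carrier :=
  lift H.form.left (Y.1.toLinearMap : Module.End ℂ H.carrier)

theorem eval_right (Y : H.L) (p : NCPoly B) : ∀ (b : B) (v : H.carrier),
    H.eval Y p (H.form.right (op b) v) = H.form.right (op b) (H.eval Y p v) := by
  refine induction (p := fun p => ∀ (b : B) (v : H.carrier),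
    H.eval Y p (H.form.right (op b) v) = H.form.right (op b) (H.eval Y p v)) ?_ ?_ ?_ ?_ p
  · intro a b v; rw [eval, lift_coef, H.form.left_right]
  · intro b v; rw [eval, lift_X]; exact Y.2.1 b v
  · intro p q hp hq b v; simp only [map_add, LinearMap.add_apply, hp, hq]
  · intro p q hp hq b v; simp only [map_mul, Module.End.mul_apply, hp, hq]

theorem eval_star {Y : H.L} (hY : ∀ u v, H.form.ip (Y.1 u) v = H.form.ip u (Y.1 v))
    (p : NCPoly B) : ∀ u v, H.form.ip (H.eval Y p u) v = H.form.ip u (H.eval Y (star p) v) := by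
  refine induction (p := fun p => ∀ u v,
    H.form.ip (H.eval Y p u) v = H.form.ip u (H.eval Y (star p) v)) ?_ ?_ ?_ ?_ p
  · intro a u v; rw [star_coef, eval, lift_coef, lift_coef, H.form.ip_left]
  · intro u v; rw [star_X, eval, lift_X]; exact hY u v
  · intro p q hp hq u v
    rw [star_add, map_add, map_add, LinearMap.add_apply, LinearMap.add_apply, H.form.ip_add_left,
      H.form.ip_add_right, hp, hq]
  · intro p q hp hq u v
    rw [star_mul, map_mul, map_mul, Module.End.mul_apply, Module.End.mul_apply, hp, hq]

variable [StarOrderedRing B]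

theorem nrm_eval_monomial (Y : H.L) (b₀ : B) (bs : List B) (v : H.carrier) :
    ‖H.eval Y (monomial b₀ bs) v‖ ≤
      (‖Y.1‖ + 1) ^ bs.length * (‖b₀‖ * (bs.map norm).prod) * ‖v‖ := by
  have hb : ∀ (b : B) (v : H.carrier), ‖H.form.left b v‖ ≤ ‖b‖ * ‖v‖ := fun b v => by
    rw [H.norm_eq, H.norm_eq v]; exact H.form.nrm_left_le b v
  have h0 : ∀ bs : List B, ‖H.eval Y (bs.map fun b => X * coef b).prod v‖ ≤
      (‖Y.1‖ + 1) ^ bs.length * (bs.map norm).prod * ‖v‖ := by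
    intro bs
    induction bs with
    | nil => simp
    | cons b bs ih =>
      rw [List.map_cons, List.prod_cons, map_mul, map_mul, Module.End.mul_apply,
        Module.End.mul_apply]
      set w := H.eval Y (bs.map fun b => X * coef b).prod v
      have h1 : H.eval Y X = Y.1.toLinearMap := lift_X _ _
      have h2 : H.eval Y (coef b) = H.form.left b := lift_coef _ _ _
      rw [h1, h2]
      calc _ ≤ ‖Y.1‖ * ‖H.form.left b w‖ := Y.1.le_opNorm _
        _ ≤ (‖Y.1‖ + 1) * (‖b‖ * ‖w‖) := by
            gcongr
            · linarith
            · exact hb b w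
        _ ≤ (‖Y.1‖ + 1) * (‖b‖ * ((‖Y.1‖ + 1) ^ bs.length * (bs.map norm).prod * ‖v‖)) := by
            gcongr
        _ = _ := by simp only [List.length_cons, List.map_cons, List.prod_cons]; ring
  rw [monomial, map_mul, Module.End.mul_apply]
  have h2 : H.eval Y (coef b₀) = H.form.left b₀ := lift_coef _ _ _
  rw [h2]
  calc _ ≤ ‖b₀‖ * _ := hb _ _
    _ ≤ ‖b₀‖ * _ := mul_le_mul_of_nonneg_left (h0 bs) (norm_nonneg _)
    _ = _ := by ring

/-- The law `p ↦ ⟨ξ, p(Y) ξ⟩` of a self-adjoint operator `Y ∈ L(H)`. -/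
noncomputable def law (Y : H.L) (hY : ∀ u v, H.form.ip (Y.1 u) v = H.form.ip u (Y.1 v)) :
    Law B where
  toLin := H.form.ipL H.ξ ∘ₗ LinearMap.applyₗ H.ξ ∘ₗ (H.eval Y).toLinearMap
  unital := by
    change H.form.ip H.ξ (H.eval Y 1 H.ξ) = 1
    rw [map_one]; exact H.ip_ξ
  bimodule a p b := by
    change H.form.ip H.ξ (H.eval Y (coef a * p * coef b) H.ξ) =
      a * H.form.ip H.ξ (H.eval Y p H.ξ) * b
    have h2 : ∀ b, H.eval Y (coef b) = H.form.left b := lift_coef _ _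
    rw [map_mul, map_mul, Module.End.mul_apply, Module.End.mul_apply, h2, h2, H.central,
      eval_right, H.form.left_right, H.form.ip_right]
    congr 1
    rw [← star_star a, ← H.form.ip_left, H.central, H.form.ip_right_left]
  completely_positive n P := by
    have h : CStarMatrix.ofMatrix ((P.conjTranspose * P).map
        (H.form.ipL H.ξ ∘ₗ LinearMap.applyₗ H.ξ ∘ₗ (H.eval Y).toLinearMap)) =
        ∑ k, (CStarMatrix.ofMatrix fun i j =>
          H.form.ip (H.eval Y (P k i) H.ξ) (H.eval Y (P k j) H.ξ) :
          CStarMatrix (Fin n) (Fin n) B) := by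
      have h1 : ∀ i j, H.form.ip H.ξ (H.eval Y ((P.conjTranspose * P) i j) H.ξ) =
          ∑ k, H.form.ip (H.eval Y (P k i) H.ξ) (H.eval Y (P k j) H.ξ) := by
        intro i j
        simp only [Matrix.mul_apply, Matrix.conjTranspose_apply, map_sum, LinearMap.sum_apply,
          H.form.ip_sum_right, H.eval_star hY, map_mul, Module.End.mul_apply]
      have h2 : ∀ (s : Finset (Fin n)) (f : Fin n → CStarMatrix (Fin n) (Fin n) B) (i j : Fin n),
          (∑ k ∈ s, f k) i j = ∑ k ∈ s, f k i j := by
        intro s f i j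
        induction s using Finset.cons_induction with
        | empty => rfl
        | cons a s ha ih => rw [Finset.sum_cons, Finset.sum_cons, CStarMatrix.add_apply, ih]
      ext i j
      exact (h1 i j).trans (h2 Finset.univ (fun k => CStarMatrix.ofMatrix fun i j =>
        H.form.ip (H.eval Y (P k i) H.ξ) (H.eval Y (P k j) H.ξ)) i j).symm
    rw [h]
    exact Finset.sum_nonneg fun k _ => H.form.gram_nonneg _
  exp_bounded := by
    refine ⟨1, ‖Y.1‖ + 1, one_pos, by positivity, fun b₀ bs => ?_⟩
    have h1 : ‖H.ξ‖ ≤ 1 := by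
      rw [H.norm_eq, H.ip_ξ, Real.sqrt_le_one]
      exact norm_one_le
    have h3 : 0 ≤ (bs.map norm).prod := List.prod_nonneg fun x hx => by
      obtain ⟨o, -, rfl⟩ := List.mem_map.mp hx
      exact norm_nonneg _
    rw [one_mul]
    change ‖H.form.ip H.ξ (H.eval Y (monomial b₀ bs) H.ξ)‖ ≤ _
    have hn : ∀ u, H.form.nrm u = ‖u‖ := fun u => (H.norm_eq u).symm
    refine (H.form.norm_ip_le _ _).trans ?_
    rw [hn, hn]
    calc _ ≤ 1 * ((‖Y.1‖ + 1) ^ bs.length * (‖b₀‖ * (bs.map norm).prod) * 1) := by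
          gcongr
          refine (H.nrm_eval_monomial Y b₀ bs H.ξ).trans ?_
          gcongr
      _ = _ := by ring

end PointedCorr

/-- The `T`-free convolution `⊞_T(μ₁, …, μ_N)`: the law of `∑ j, λ_{T,j}(X_j)`, where `X_j` is the
multiplication operator on `L²(B⟨X⟩, μ_j)`. -/
noncomputable def treeConv {B : Type u} [CStarAlgebra B] [PartialOrder B] [StarOrderedRing B] {N : ℕ}
    (T : StringTree (Fin N)) (μ : Fin N → Law B) : Law B :=
  (freeProd T fun j => (μ j).L2).law (∑ j, treeLam T (fun j => (μ j).L2) j (μ j).mulX) fun u v => by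
    rw [AddSubmonoidClass.coe_finsetSum, _root_.sum_apply, _root_.sum_apply, SemiCorr.ip_sum_left, SemiCorr.ip_sum_right]
    exact Finset.sum_congr rfl fun j _ => lam_symm T _ j (μ j).mulXHat_symm u v

/-!
The free product of pointed correspondences over a tree `T` is characterized by its
representations. For `g ∈ H_a` let `θ_g = g ⟨ξ, ·⟩ ∈ L(H_a)`. In the `T`-free product, an elementary
tensor `h₁ ⊗ ⋯ ⊗ h_l ⊗ b` of the summand of the string `a₁ ⋯ a_l` equals
`λ_{a₁}(θ_{h₁}) ⋯ λ_{a_l}(θ_{h_l}) b ξ`. Suppose that a pointed correspondence `K` carries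
representations `Λ_a` of the algebras `L(H_a)` and subspaces `E w` such that, for each letter `a` and
each `w ∈ T` which does not begin with `a`, either `a w ∈ T` and `Λ_a(θ_ξ)` is the identity on `E w`
while `Λ_a(θ_h)` maps `E w` into `E (a w)`, or `a w ∉ T` and `Λ_a` vanishes on `E w` (`FreeModel`).
Then the map which replaces `λ` by `Λ` in this formula intertwines the representations
(`FreeModel.sumMap_lamPre`). Since `Λ_a(θ_h)` may be moved to the other side of an inner product,
an induction on the length of words shows that the map is isometric (`FreeModel.ip_sumMap`). If `ξ`
is cyclic in `K`, it is a unitary, and cyclicity of `ξ` in the free product makes it the only one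
with these properties (`FreeModel.iso`, `FreeModel.iso_unique`).

The iterated product is such a realization for the composed tree (`FreeModel.comp`), with
`Λ_{ι_j(i)} = λ_{T,j} ∘ λ_{S_j,i}`. A string over the composed alphabet decomposes uniquely into
maximal blocks of letters from the same alphabet, and `E w` consists of vectors `g ⊗ z` with `g` in
the summand, indexed by the first block, of the inner product. A letter can be prepended to `w` if
it prolongs the first block inside the inner tree, or if it is a one-letter vertex of its inner tree
and its alphabet can be prepended to the string of blocks; these are the cases in which the
representation does not vanish on `E w` (`compLam_blockSpace`, `compLam_blockSpace_other`). This
gives the isomorphism with the product over the composed tree.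

For the convolutions, `⊞_T` of the laws of operators `Y_j ∈ L(G_j)` is the law of `∑ λ_{T,j}(Y_j)` on
the `T`-free product of the `G_j` (`treeConv_law`): the isometries `p ↦ p(Y_j) ξ` from the spaces
`L²(B⟨X⟩, μ_j)` to `G_j` need not be adjointable, but free products are functorial for isometries
(`freeFunc`). Hence the isomorphism above identifies the two sides of the composition law. For the
identity tree, every pointed correspondence is a realization of its own free product
(`identityModel`), and the law of `X` on `L²(B⟨X⟩, μ)` is `μ` (`Law.law_mulX`).
-/

/-! ### Operators on correspondences -/

namespace HilbertCorr

variable {B : Type u} [CStarAlgebra B] [PartialOrder B] [StarOrderedRing B] (H : HilbertCorr B)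

theorem norm_ip_le (u v : H.carrier) : ‖H.form.ip u v‖ ≤ ‖u‖ * ‖v‖ := by
  rw [H.norm_eq u, H.norm_eq v]
  exact H.form.norm_ip_le u v

theorem norm_left_le (b : B) (v : H.carrier) : ‖H.form.left b v‖ ≤ ‖b‖ * ‖v‖ := by
  rw [H.norm_eq, H.norm_eq v]
  exact H.form.nrm_left_le b v

theorem norm_right_le (b : B) (v : H.carrier) : ‖H.form.right (op b) v‖ ≤ ‖b‖ * ‖v‖ := by
  rw [H.norm_eq, H.norm_eq v]
  exact H.form.nrm_right_le b v

theorem continuous_ip : Continuous fun p : H.carrier × H.carrier => H.form.ip p.1 p.2 := by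
  let Φ : H.carrier →L⋆[ℂ] H.carrier →L[ℂ] B :=
    LinearMap.mkContinuous₂ H.form.ipL 1 fun u v => by
      rw [one_mul]; exact H.norm_ip_le u v
  exact (Φ.continuous.comp continuous_fst).clm_apply continuous_snd

theorem continuous_left (b : B) : Continuous (H.form.left b) :=
  (LinearMap.mkContinuous (H.form.left b) ‖b‖ (H.norm_left_le b)).continuous

theorem continuous_right (b : Bᵐᵒᵖ) : Continuous (H.form.right b) :=
  (LinearMap.mkContinuous (H.form.right b) ‖b.unop‖ (H.norm_right_le b.unop)).continuous

/-- The left action of `b ∈ B` as an element of `L(H)`. -/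
noncomputable def leftL (b : B) : H.L :=
  ⟨LinearMap.mkContinuous (H.form.left b) ‖b‖ (H.norm_left_le b), mem_L_of_adjoint
    (S := LinearMap.mkContinuous (H.form.left (star b)) ‖star b‖ (H.norm_left_le (star b)))
    (H.form.ip_left b)⟩

theorem leftL_apply (b : B) (v : H.carrier) : (H.leftL b).1 v = H.form.left b v := rfl

/-- The map `v ↦ g ⟨k, v⟩`. -/
noncomputable def rankOneCLM (g k : H.carrier) : H.carrier →L[ℂ] H.carrier :=
  LinearMap.mkContinuous
    (H.form.right.toLinearMap.flip g ∘ₗ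
      (MulOpposite.opLinearEquiv ℂ : B ≃ₗ[ℂ] Bᵐᵒᵖ).toLinearMap ∘ₗ H.form.ipL k)
    (‖k‖ * ‖g‖) fun v => by
      refine (H.norm_right_le (H.form.ip k v) g).trans ?_
      calc _ ≤ ‖k‖ * ‖v‖ * ‖g‖ := by gcongr; exact H.norm_ip_le k v
        _ = _ := by ring

theorem ip_rankOneCLM (g k u v : H.carrier) :
    H.form.ip (H.rankOneCLM g k u) v = H.form.ip u (H.rankOneCLM k g v) := by
  change H.form.ip (H.form.right (op (H.form.ip k u)) g) v =
    H.form.ip u (H.form.right (op (H.form.ip g v)) k)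
  rw [H.form.ip_right_left, H.form.ip_right, H.form.ip_star]

/-- The rank one operators `v ↦ g ⟨k, v⟩` in `L(H)`, linear in `g`. -/
noncomputable def rankOne (k : H.carrier) : H.carrier →ₗ[ℂ] H.L where
  toFun g := ⟨H.rankOneCLM g k, mem_L_of_adjoint (H.ip_rankOneCLM g k)⟩
  map_add' g g' := Subtype.ext <| ContinuousLinearMap.ext fun v =>
    map_add (H.form.right (op (H.form.ip k v))) g g'
  map_smul' z g := Subtype.ext <| ContinuousLinearMap.ext fun v =>
    map_smul (H.form.right (op (H.form.ip k v))) z g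

theorem rankOne_apply (g k v : H.carrier) :
    (H.rankOne k g).1 v = H.form.right (op (H.form.ip k v)) g := rfl

theorem ip_rankOne (g k u v : H.carrier) :
    H.form.ip ((H.rankOne k g).1 u) v = H.form.ip u ((H.rankOne g k).1 v) :=
  H.ip_rankOneCLM g k u v

theorem mul_rankOne (x : H.L) (g k : H.carrier) : x * H.rankOne k g = H.rankOne k (x.1 g) :=
  Subtype.ext <| ContinuousLinearMap.ext fun v => x.2.1 (H.form.ip k v) g

theorem ext_L {x y : H.L} (h : ∀ v, x.1 v = y.1 v) : x = y :=
  Subtype.ext (ContinuousLinearMap.ext h)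

end HilbertCorr

namespace PointedCorr

variable {B : Type u} [CStarAlgebra B] [PartialOrder B] [StarOrderedRing B] (H : PointedCorr B)

theorem rankOne_ξ (g : H.carrier) : (H.rankOne H.ξ g).1 H.ξ = g := by
  rw [H.rankOne_apply, H.ip_ξ]
  exact LinearMap.congr_fun (map_one H.form.right) g

theorem incl_injective : Function.Injective H.incl := Subtype.val_injective

theorem ip_ξ_left (b : B) (v : H.carrier) :
    H.form.ip H.ξ (H.form.left b v) = b * H.form.ip H.ξ v := by
  rw [← star_star b, ← H.form.ip_left, H.central, H.form.ip_right_left]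

theorem proj_left (b : B) (g : H.carrier) :
    H.proj (H.form.left b g) = H.compl.form.left b (H.proj g) := by
  apply H.incl_injective
  rw [H.incl_left, H.incl_proj, H.incl_proj, map_sub, H.ip_ξ_left, H.form.left_right, H.central,
    ← Module.End.mul_apply, ← map_mul, ← MulOpposite.op_mul]

/-- Every vector decomposes as `g = ⟨ξ, g⟩ ξ + g°` with `g° ∈ H°`. -/
theorem left_ξ_add_proj (g : H.carrier) :
    g = H.form.left (H.form.ip H.ξ g) H.ξ + H.incl (H.proj g) := by
  rw [H.incl_proj, H.central]
  abel

end PointedCorr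

namespace SemiCorr

variable {B : Type u} [CStarAlgebra B] [PartialOrder B] [StarOrderedRing B]
variable {V : Type u} [AddCommGroup V] [Module ℂ V] (F : SemiCorr B V)

theorem denseRange_toHat : DenseRange F.toHat :=
  UniformSpace.Completion.denseRange_coe (α := F.Pre)

variable {F}

theorem norm_of_ip {K : HilbertCorr B} {f : V →ₗ[ℂ] K.carrier}
    (hf : ∀ u v, K.form.ip (f u) (f v) = F.ip u v) (v : V) : ‖f v‖ ≤ 1 * ‖F.toHat v‖ := by
  rw [one_mul, norm_toHat, K.norm_eq, hf, nrm]

/-- The extension of a linear map to the separation-completion. It is meaningful for maps which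
preserve inner products, see `hatExt_toHat`; `LinearMap.extendOfNorm` is zero for unbounded maps. -/
noncomputable def hatExt {K : HilbertCorr B} (f : V →ₗ[ℂ] K.carrier) : F.Hat →L[ℂ] K.carrier :=
  f.extendOfNorm F.toHat

theorem hatExt_toHat {K : HilbertCorr B} {f : V →ₗ[ℂ] K.carrier}
    (hf : ∀ u v, K.form.ip (f u) (f v) = F.ip u v) (v : V) : hatExt f (F.toHat v) = f v :=
  LinearMap.extendOfNorm_eq F.denseRange_toHat ⟨1, norm_of_ip hf⟩ v

end SemiCorr

/-- Isometries of pointed correspondences: inner-product-preserving `B`-`B`-bimodule maps that map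
unit vector to unit vector. Adjointability is not required. -/
structure PointedIsometry {B : Type u} [CStarAlgebra B] [PartialOrder B] (H K : PointedCorr B) where
  toCLM : H.carrier →L[ℂ] K.carrier
  map_ip : ∀ u v, K.form.ip (toCLM u) (toCLM v) = H.form.ip u v
  map_left : ∀ b v, toCLM (H.form.left b v) = K.form.left b (toCLM v)
  map_right : ∀ b v, toCLM (H.form.right b v) = K.form.right b (toCLM v)
  map_ξ : toCLM H.ξ = K.ξ

namespace PointedIsometry

variable {B : Type u} [CStarAlgebra B] [PartialOrder B] [StarOrderedRing B] {H K : PointedCorr B}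

/-- An inner-product-preserving bimodule map on a semi-inner-product bimodule extends to the
separation-completion. -/
noncomputable def ofPre {V : PreCorr B} {ξ : V.carrier} {h1 : V.form.ip ξ ξ = 1}
    {hc : ∀ b, V.form.left b ξ = V.form.right (op b) ξ} (f : V.carrier →ₗ[ℂ] K.carrier)
    (hip : ∀ u v, K.form.ip (f u) (f v) = V.form.ip u v)
    (hl : ∀ b v, f (V.form.left b v) = K.form.left b (f v))
    (hr : ∀ b v, f (V.form.right b v) = K.form.right b (f v)) (hξ : f ξ = K.ξ) :
    PointedIsometry (V.pointedCompletion ξ h1 hc) K where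
  toCLM := SemiCorr.hatExt (K := K.toHilbertCorr) f
  map_ip u v := V.form.hat_ind₂ (p := fun u v =>
      K.form.ip (SemiCorr.hatExt (K := K.toHilbertCorr) f u)
        (SemiCorr.hatExt (K := K.toHilbertCorr) f v) = V.form.ipHat u v) u v
    (isClosed_eq (K.continuous_ip.comp (((SemiCorr.hatExt (K := K.toHilbertCorr) f).continuous.comp
        continuous_fst).prodMk ((SemiCorr.hatExt (K := K.toHilbertCorr) f).continuous.comp
        continuous_snd))) V.form.continuous_ipHat) fun u v => by
      rw [SemiCorr.hatExt_toHat hip, SemiCorr.hatExt_toHat hip, V.form.ipHat_toHat, hip]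
  map_left b := congrFun <| V.form.hat_ext
    (f := fun v => SemiCorr.hatExt (K := K.toHilbertCorr) f (V.form.hatLeft b v))
    (g := fun v => K.form.left b (SemiCorr.hatExt (K := K.toHilbertCorr) f v))
    ((ContinuousLinearMap.continuous _).comp (V.form.continuous_hatLeft b))
    ((K.continuous_left b).comp (ContinuousLinearMap.continuous _)) fun v => by
      simp only [V.form.hatLeft_toHat, SemiCorr.hatExt_toHat hip, hl]
  map_right b := congrFun <| V.form.hat_ext
    (f := fun v => SemiCorr.hatExt (K := K.toHilbertCorr) f (V.form.hatRight b v))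
    (g := fun v => K.form.right b (SemiCorr.hatExt (K := K.toHilbertCorr) f v))
    ((ContinuousLinearMap.continuous _).comp (V.form.continuous_hatRight b))
    ((K.continuous_right b).comp (ContinuousLinearMap.continuous _)) fun v => by
      simp only [V.form.hatRight_toHat, SemiCorr.hatExt_toHat hip, hr]
  map_ξ := (SemiCorr.hatExt_toHat hip ξ).trans hξ

theorem ofPre_toHat {V : PreCorr B} {ξ : V.carrier} {h1 : V.form.ip ξ ξ = 1}
    {hc : ∀ b, V.form.left b ξ = V.form.right (op b) ξ} (f : V.carrier →ₗ[ℂ] K.carrier)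
    (hip : ∀ u v, K.form.ip (f u) (f v) = V.form.ip u v)
    (hl : ∀ b v, f (V.form.left b v) = K.form.left b (f v))
    (hr : ∀ b v, f (V.form.right b v) = K.form.right b (f v)) (hξ : f ξ = K.ξ) (v : V.carrier) :
    (ofPre (h1 := h1) (hc := hc) f hip hl hr hξ).toCLM (V.form.toHat v) = f v :=
  SemiCorr.hatExt_toHat (K := K.toHilbertCorr) hip v

variable (V : PointedIsometry H K)

theorem norm_map (v : H.carrier) : ‖V.toCLM v‖ = ‖v‖ := by
  rw [K.norm_eq, V.map_ip, H.norm_eq]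

theorem isometry : Isometry V.toCLM :=
  AddMonoidHomClass.isometry_of_norm V.toCLM V.norm_map

theorem isClosed_range : IsClosed (Set.range V.toCLM) := V.isometry.isClosedEmbedding.isClosed_range

/-- The inverse of a surjective isometry of pointed correspondences. -/
noncomputable def symmIso (hV : Function.Surjective V.toCLM) : PointedIso K H :=
  let e : H.carrier ≃ₗᵢ[ℂ] K.carrier := LinearIsometryEquiv.ofSurjective
    ⟨V.toCLM.toLinearMap, V.norm_map⟩ hV
  have he : ∀ v, e v = V.toCLM v := fun _ => rfl
  { toEquiv := e.symm
    map_ip := fun u v => by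
      rw [← V.map_ip, ← he, ← he, e.apply_symm_apply, e.apply_symm_apply]
    map_left := fun b v => by
      rw [LinearIsometryEquiv.symm_apply_eq, he, V.map_left, ← he, e.apply_symm_apply]
    map_right := fun b v => by
      rw [LinearIsometryEquiv.symm_apply_eq, he, V.map_right, ← he, e.apply_symm_apply]
    map_ξ := by rw [LinearIsometryEquiv.symm_apply_eq, he, V.map_ξ] }

end PointedIsometry

namespace PointedIso

variable {B : Type u} [CStarAlgebra B] [PartialOrder B] {H K : PointedCorr B}

theorem Ad_apply (Φ : PointedIso H K) (x : H.L) (v : K.carrier) :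
    (Φ.Ad x).1 v = Φ.toEquiv (x.1 (Φ.toEquiv.symm v)) := rfl

theorem ext_equiv {Φ Ψ : PointedIso H K} (h : ∀ v, Φ.toEquiv.symm v = Ψ.toEquiv.symm v) :
    Φ = Ψ := by
  have h1 : Φ.toEquiv.symm = Ψ.toEquiv.symm := LinearIsometryEquiv.ext h
  have h2 : Φ.toEquiv = Ψ.toEquiv := LinearIsometryEquiv.symm_bijective.injective h1
  cases Φ
  cases Ψ
  cases h2
  rfl

end PointedIso

/-! ### The representations `λ_{T,j}` on a free product -/

section product

variable {B : Type u} [CStarAlgebra B] [PartialOrder B] [StarOrderedRing B]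
variable {ι : Type} [DecidableEq ι] (T : StringTree ι) (H : ι → PointedCorr B)

/-- The canonical map from `H_s°` to the free product, for `s ∈ T`. -/
noncomputable def freeIncl (s : List ι) (hs : s ∈ T.strings) :
    (word H s).carrier →ₗ[ℂ] (freeProd T H).carrier :=
  (wordSum H T.strings).form.toHat ∘ₗ wordIncl H T.strings s hs

theorem freeIncl_ip (s : List ι) (hs : s ∈ T.strings) (v w : (word H s).carrier) :
    (freeProd T H).form.ip (freeIncl T H s hs v) (freeIncl T H s hs w) =
      (word H s).form.ip v w :=
  ((wordSum H T.strings).form.ipHat_toHat _ _).trans (wordIncl_ip H _ _ _ _ _)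

theorem freeIncl_ip_ne {s t : List ι} (hs : s ∈ T.strings) (ht : t ∈ T.strings) (h : s ≠ t)
    (v : (word H s).carrier) (w : (word H t).carrier) :
    (freeProd T H).form.ip (freeIncl T H s hs v) (freeIncl T H t ht w) = 0 :=
  ((wordSum H T.strings).form.ipHat_toHat _ _).trans (wordIncl_ip_ne H _ _ _ h _ _)

theorem freeIncl_left (s : List ι) (hs : s ∈ T.strings) (b : B) (v : (word H s).carrier) :
    (freeProd T H).form.left b (freeIncl T H s hs v) =
      freeIncl T H s hs ((word H s).form.left b v) :=
  ((wordSum H T.strings).form.hatLeft_toHat _ _).trans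
    (congrArg _ (wordIncl_left H _ _ _ _ _))

theorem freeIncl_right (s : List ι) (hs : s ∈ T.strings) (b : Bᵐᵒᵖ) (v : (word H s).carrier) :
    (freeProd T H).form.right b (freeIncl T H s hs v) =
      freeIncl T H s hs ((word H s).form.right b v) :=
  ((wordSum H T.strings).form.hatRight_toHat _ _).trans
    (congrArg _ (wordIncl_right H _ _ _ _ _))

theorem freeIncl_one : freeIncl T H [] T.nil_mem (wordOne H) = (freeProd T H).ξ := rfl

theorem freeIncl_nil (b : B) :
    freeIncl T H [] T.nil_mem b = (freeProd T H).form.left b (freeProd T H).ξ := by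
  rw [← freeIncl_one, freeIncl_left]
  exact congrArg _ (mul_one b).symm

theorem ip_ξ_freeIncl {s : List ι} (hs : s ∈ T.strings) (h : s ≠ []) (v : (word H s).carrier) :
    (freeProd T H).form.ip (freeProd T H).ξ (freeIncl T H s hs v) = 0 :=
  freeIncl_ip_ne T H T.nil_mem hs h.symm _ _

/-- A closed additive property of vectors which holds on each `H_s°` holds everywhere. -/
theorem freeProd_induction_incl {p : (freeProd T H).carrier → Prop} (v : (freeProd T H).carrier)
    (hc : IsClosed {v | p v}) (hadd : ∀ u v, p u → p v → p (u + v))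
    (h : ∀ s hs v, p (freeIncl T H s hs v)) : p v := by
  refine (wordSum H T.strings).form.hat_ind v hc fun y => ?_
  refine wordSum_induction H (p := fun y => p ((wordSum H T.strings).form.toHat y)) y ?_ ?_ h
  · have := h [] T.nil_mem 0
    rw [map_zero] at this
    rwa [map_zero]
  · intro x y hx hy
    rw [map_add]
    exact hadd _ _ hx hy

variable (j : ι)

/-- The vector `U_{T,j}^* (h ⊗ v)` of the free product, for `v ∈ H_s°` and `s ∈ S_{T,j}`. -/
noncomputable def freeIns (s : List ι) (hs : s ∈ T.branch j) (h : (H j).carrier)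
    (v : (word H s).carrier) : (freeProd T H).carrier :=
  (wordSum H T.strings).form.toHat
    (branchIns T H j (branchMk T H j h (wordIncl H (T.branch j) s hs v)))

theorem freeIns_eq (s : List ι) (hs : s ∈ T.branch j) (h : (H j).carrier)
    (v : (word H s).carrier) : freeIns T H j s hs h v =
      freeIncl T H s hs.1 ((word H s).form.left ((H j).form.ip (H j).ξ h) v) +
      freeIncl T H (j :: s) hs.2.2 (wordCons H j s ((H j).proj h) v) := by
  rw [freeIns, branchIns_mk, map_add]
  rfl

theorem freeIns_ξ (s : List ι) (hs : s ∈ T.branch j) (v : (word H s).carrier) :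
    freeIns T H j s hs (H j).ξ v = freeIncl T H s hs.1 v := by
  rw [freeIns_eq, (H j).ip_ξ, (H j).proj_ξ, map_zero, LinearMap.zero_apply, map_zero, add_zero,
    map_one]
  rfl

theorem freeIns_incl (s : List ι) (hs : s ∈ T.branch j) (h : (H j).compl.carrier)
    (v : (word H s).carrier) : freeIns T H j s hs ((H j).incl h) v =
      freeIncl T H (j :: s) hs.2.2 (wordCons H j s h v) := by
  rw [freeIns_eq, (H j).ip_ξ_incl, (H j).proj_incl, map_zero, LinearMap.zero_apply, map_zero,
    zero_add]

theorem freeIns_zero (s : List ι) (hs : s ∈ T.branch j) (v : (word H s).carrier) :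
    freeIns T H j s hs 0 v = 0 := by
  rw [freeIns, map_zero, LinearMap.zero_apply, map_zero]
  exact map_zero _

theorem freeIns_add (s : List ι) (hs : s ∈ T.branch j) (g h : (H j).carrier)
    (v : (word H s).carrier) :
    freeIns T H j s hs (g + h) v = freeIns T H j s hs g v + freeIns T H j s hs h v := by
  rw [freeIns, map_add, LinearMap.add_apply, map_add, map_add]
  rfl

theorem freeIns_smul (s : List ι) (hs : s ∈ T.branch j) (z : ℂ) (h : (H j).carrier)
    (v : (word H s).carrier) :
    freeIns T H j s hs (z • h) v = z • freeIns T H j s hs h v := by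
  rw [freeIns, map_smul, LinearMap.smul_apply, map_smul, map_smul]
  rfl

/-- The vectors `h b ⊗ v` and `h ⊗ b v` differ by a null vector, so that they have the same image in
the completion. -/
theorem freeIns_right (s : List ι) (hs : s ∈ T.branch j) (b : B) (h : (H j).carrier)
    (v : (word H s).carrier) :
    freeIns T H j s hs ((H j).form.right (op b) h) v =
      freeIns T H j s hs h ((word H s).form.left b v) := by
  rw [← sub_eq_zero]
  refine (((wordSum H T.strings).form.toHat.map_sub _ _).symm.trans ?_)
  rw [← map_sub]
  refine norm_eq_zero.mp
    (((wordSum H T.strings).form.norm_toHat _).trans ((nrm_branchIns T H j _).trans ?_))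
  rw [SemiCorr.nrm, SemiCorr.ip_sub_right, branchMk_balanced, wordIncl_left, sub_self, norm_zero,
    Real.sqrt_zero]

theorem freeIns_left (s : List ι) (hs : s ∈ T.branch j) (b : B) (h : (H j).carrier)
    (v : (word H s).carrier) :
    freeIns T H j s hs ((H j).form.left b h) v =
      (freeProd T H).form.left b (freeIns T H j s hs h v) := by
  rw [freeIns_eq, freeIns_eq, map_add, freeIncl_left, freeIncl_left, wordCons_left,
    (H j).proj_left, (H j).ip_ξ_left, map_mul]
  rfl

theorem norm_freeIns_le (s : List ι) (hs : s ∈ T.branch j) (h : (H j).carrier)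
    (v : (word H s).carrier) : ‖freeIns T H j s hs h v‖ ≤
      (wordSum H (T.branch j)).form.nrm (wordIncl H (T.branch j) s hs v) * ‖h‖ := by
  rw [mul_comm, (H j).norm_eq]
  refine ((wordSum H T.strings).form.norm_toHat _).le.trans ((nrm_branchIns T H j _).le.trans ?_)
  exact SemiCorr.nrm_tmul_le _ _ _ _

theorem continuous_freeIns (s : List ι) (hs : s ∈ T.branch j) (v : (word H s).carrier) :
    Continuous fun h => freeIns T H j s hs h v :=
  (LinearMap.mkContinuous (σ := RingHom.id ℂ)
    { toFun := fun h => freeIns T H j s hs h v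
      map_add' := fun g h => freeIns_add T H j s hs g h v
      map_smul' := fun z h => freeIns_smul T H j s hs z h v } _
    fun h => norm_freeIns_le T H j s hs h v).continuous

theorem lamPre_branch (x : Module.End ℂ (H j).carrier) (s : List ι) (hs : s ∈ T.branch j)
    (v : (word H s).carrier) : lamPre T H j x (wordIncl H T.strings s hs.1 v) =
      branchIns T H j (branchMk T H j (x (H j).ξ) (wordIncl H (T.branch j) s hs v)) :=
  congrArg (fun w => branchIns T H j
    (LinearMap.rTensor (wordSum H (T.branch j)).carrier x w)) (branchDec_branch T H j s hs v)

theorem lamPre_cons (x : Module.End ℂ (H j).carrier) (s : List ι) (hs : j :: s ∈ T.strings)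
    (h : (H j).compl.carrier) (v : (word H s).carrier) :
    lamPre T H j x (wordIncl H T.strings (j :: s) hs (wordCons H j s h v)) =
      branchIns T H j (branchMk T H j (x ((H j).incl h))
        (wordIncl H (T.branch j) s (T.mem_branch_of_cons hs) v)) :=
  congrArg (fun w => branchIns T H j
    (LinearMap.rTensor (wordSum H (T.branch j)).carrier x w)) (branchDec_cons T H j s hs h v)

theorem lamPre_other (x : Module.End ℂ (H j).carrier) (s : List ι) (hs : s ∈ T.strings)
    (h1 : s ∉ T.branch j) (h2 : s.head? ≠ some j) (v : (word H s).carrier) :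
    lamPre T H j x (wordIncl H T.strings s hs v) = 0 :=
  (congrArg (fun w => branchIns T H j
    (LinearMap.rTensor (wordSum H (T.branch j)).carrier x w))
    (branchDec_other T H j s hs h1 h2 v)).trans
    ((congrArg (branchIns T H j) (map_zero _)).trans (map_zero _))

/-- A string of `T` lies in `S_{T,j}`, or begins with `j`, or neither; `λ_{T,j}` vanishes on the
summands of the third kind. -/
theorem StringTree.branch_cases {p : ∀ s, s ∈ T.strings → Prop}
    (h1 : ∀ s (hs : s ∈ T.branch j), p s hs.1) (h2 : ∀ s (hs : j :: s ∈ T.strings), p (j :: s) hs)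
    (h3 : ∀ s hs, s ∉ T.branch j → s.head? ≠ some j → p s hs) (s : List ι) (hs : s ∈ T.strings) :
    p s hs := by
  by_cases hb : s ∈ T.branch j
  · exact h1 s hb
  by_cases hh : s.head? = some j
  · obtain ⟨t, rfl⟩ : ∃ t, s = j :: t := by
      cases s with
      | nil => simp at hh
      | cons a t => simp at hh; exact ⟨t, by rw [hh]⟩
    exact h2 t hs
  · exact h3 s hs hb hh

theorem treeLam_toHat (x : (H j).L) (v : (wordSum H T.strings).carrier) :
    (treeLam T H j x).1 ((wordSum H T.strings).form.toHat v) =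
      (wordSum H T.strings).form.toHat (lamPre T H j x.1.toLinearMap v) :=
  SemiCorr.hatMap_toHat (F := (wordSum H T.strings).form) (G := (wordSum H T.strings).form)
    (lamPre T H j x.1.toLinearMap) (lamPre_bound_L T H j x) v

theorem treeLam_branch (x : (H j).L) (s : List ι) (hs : s ∈ T.branch j) (v : (word H s).carrier) :
    (treeLam T H j x).1 (freeIncl T H s hs.1 v) = freeIns T H j s hs (x.1 (H j).ξ) v :=
  (treeLam_toHat T H j x _).trans (congrArg _ (lamPre_branch T H j _ s hs v))

theorem treeLam_cons (x : (H j).L) (s : List ι) (hs : j :: s ∈ T.strings)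
    (h : (H j).compl.carrier) (v : (word H s).carrier) :
    (treeLam T H j x).1 (freeIncl T H (j :: s) hs (wordCons H j s h v)) =
      freeIns T H j s (T.mem_branch_of_cons hs) (x.1 ((H j).incl h)) v :=
  (treeLam_toHat T H j x _).trans (congrArg _ (lamPre_cons T H j _ s hs h v))

theorem treeLam_other (x : (H j).L) (s : List ι) (hs : s ∈ T.strings)
    (h1 : s ∉ T.branch j) (h2 : s.head? ≠ some j) (v : (word H s).carrier) :
    (treeLam T H j x).1 (freeIncl T H s hs v) = 0 :=
  (treeLam_toHat T H j x _).trans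
    ((congrArg _ (lamPre_other T H j _ s hs h1 h2 v)).trans (map_zero _))

theorem treeLam_freeIns (x : (H j).L) (s : List ι) (hs : s ∈ T.branch j) (h : (H j).carrier)
    (v : (word H s).carrier) :
    (treeLam T H j x).1 (freeIns T H j s hs h v) = freeIns T H j s hs (x.1 h) v := by
  rw [freeIns_eq, map_add, treeLam_branch T H j x s hs, treeLam_cons, ← freeIns_right,
    ← freeIns_add, ← x.2.1, ← map_add, ← (H j).central, ← (H j).left_ξ_add_proj]

theorem ip_treeLam {x y : (H j).L} (h : ∀ u v, (H j).form.ip (x.1 u) v = (H j).form.ip u (y.1 v))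
    (u v : (freeProd T H).carrier) :
    (freeProd T H).form.ip ((treeLam T H j x).1 u) v =
      (freeProd T H).form.ip u ((treeLam T H j y).1 v) :=
  ip_lamHat T H j (x := x.1.toLinearMap) (y := y.1.toLinearMap) h (lamPre_bound_L T H j x)
    (lamPre_bound_L T H j y) u v

/-- A closed additive property holds everywhere if it holds for the vectors `U_{T,j}^* (h ⊗ v)` and
on the summands annihilated by `λ_{T,j}`. -/
theorem freeProd_induction_ins {p : (freeProd T H).carrier → Prop} (v : (freeProd T H).carrier)
    (hc : IsClosed {v | p v}) (hadd : ∀ u v, p u → p v → p (u + v))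
    (h1 : ∀ s hs h v, p (freeIns T H j s hs h v))
    (h2 : ∀ s hs, s ∉ T.branch j → s.head? ≠ some j → ∀ v, p (freeIncl T H s hs v)) : p v := by
  refine freeProd_induction_incl T H v hc hadd (T.branch_cases j ?_ ?_ h2)
  · intro s hs v
    rw [← freeIns_ξ]
    exact h1 s hs _ v
  · intro s hs v
    have hb := T.mem_branch_of_cons hs
    refine wordCons_induction H (p := fun v => p (freeIncl T H (j :: s) hs v)) v ?_
      (fun u v hu hv => by rw [map_add]; exact hadd _ _ hu hv) fun h v => ?_
    · rw [map_zero, ← freeIns_zero T H j s hb 0]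
      exact h1 s hb _ _
    · rw [← freeIns_incl T H j s hb]
      exact h1 s hb _ v

theorem freeProd_ext {x y : (freeProd T H).L}
    (h1 : ∀ s hs h v, x.1 (freeIns T H j s hs h v) = y.1 (freeIns T H j s hs h v))
    (h2 : ∀ s hs, s ∉ T.branch j → s.head? ≠ some j → ∀ v,
      x.1 (freeIncl T H s hs v) = y.1 (freeIncl T H s hs v)) : x = y :=
  (freeProd T H).ext_L fun v => freeProd_induction_ins T H j
    (p := fun v => x.1 v = y.1 v) v (isClosed_eq x.1.continuous y.1.continuous)
    (fun u v hu hv => by rw [map_add, map_add, hu, hv]) h1 h2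

/-- `λ_{T,j}` is compatible with the left action of `B`: `λ_{T,j}(b x) = b λ_{T,j}(x)`. -/
theorem treeLam_left (b : B) (x : (H j).L) (v : (freeProd T H).carrier) :
    (treeLam T H j ((H j).leftL b * x)).1 v =
      (freeProd T H).form.left b ((treeLam T H j x).1 v) := by
  refine LinearMap.congr_fun (congrArg (fun y : (freeProd T H).L => y.1.toLinearMap)
    (freeProd_ext T H j (x := treeLam T H j ((H j).leftL b * x))
      (y := (freeProd T H).leftL b * treeLam T H j x) ?_ ?_)) v
  · intro s hs h v
    rw [treeLam_freeIns]
    exact (freeIns_left T H j s hs b _ v).trans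
      (congrArg _ (treeLam_freeIns T H j x s hs h v).symm)
  · intro s hs h1 h2 v
    rw [treeLam_other T H j _ s hs h1 h2]
    exact (map_zero ((freeProd T H).form.left b)).symm.trans
      (congrArg _ (treeLam_other T H j x s hs h1 h2 v).symm)

/-- `λ_{T,j}` as a homomorphism of algebras (which is not unital in general). -/
noncomputable def treeLamHom : (H j).L →ₙₐ[ℂ] (freeProd T H).L where
  toFun := treeLam T H j
  map_smul' z x := freeProd_ext T H j
    (fun s hs h v => by
      rw [treeLam_freeIns]
      exact (freeIns_smul T H j s hs z _ v).trans
        (congrArg _ (treeLam_freeIns T H j x s hs h v).symm))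
    fun s hs h1 h2 v => by
      rw [treeLam_other T H j _ s hs h1 h2]
      exact (smul_zero z).symm.trans (congrArg _ (treeLam_other T H j x s hs h1 h2 v).symm)
  map_zero' := freeProd_ext T H j
    (fun s hs h v => (treeLam_freeIns T H j 0 s hs h v).trans (freeIns_zero T H j s hs v))
    fun s hs h1 h2 v => treeLam_other T H j _ s hs h1 h2 v
  map_add' x y := freeProd_ext T H j
    (fun s hs h v => by
      rw [treeLam_freeIns]
      exact (freeIns_add T H j s hs _ _ v).trans (congrArg₂ _
        (treeLam_freeIns T H j x s hs h v) (treeLam_freeIns T H j y s hs h v)).symm)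
    fun s hs h1 h2 v => by
      refine (treeLam_other T H j _ s hs h1 h2 v).trans ((add_zero 0).symm.trans ?_)
      exact (congrArg₂ _ (treeLam_other T H j x s hs h1 h2 v)
        (treeLam_other T H j y s hs h1 h2 v)).symm
  map_mul' x y := freeProd_ext T H j
    (fun s hs h v => by
      change _ = (treeLam T H j x).1 ((treeLam T H j y).1 _)
      rw [treeLam_freeIns, treeLam_freeIns, treeLam_freeIns]
      rfl)
    fun s hs h1 h2 v => by
      change _ = (treeLam T H j x).1 ((treeLam T H j y).1 _)
      rw [treeLam_other T H j y s hs h1 h2, map_zero, treeLam_other T H j _ s hs h1 h2]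

theorem treeLamHom_apply (x : (H j).L) : treeLamHom T H j x = treeLam T H j x := rfl

/-- The unit vector is cyclic: a closed additive property which holds on `B ξ` and is inherited
under all `λ_{T,j}(x)` holds everywhere, because
`h₁ ⊗ ⋯ ⊗ h_l ⊗ b = λ_{T,j₁}(θ₁) ⋯ λ_{T,j_l}(θ_l) b ξ` with `θ_i = h_i ⟨ξ, ·⟩`. -/
theorem freeProd_induction {p : (freeProd T H).carrier → Prop} (v : (freeProd T H).carrier)
    (hc : IsClosed {v | p v}) (hadd : ∀ u v, p u → p v → p (u + v))
    (h0 : ∀ b, p ((freeProd T H).form.left b (freeProd T H).ξ))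
    (hlam : ∀ j x v, p v → p ((treeLam T H j x).1 v)) : p v := by
  refine freeProd_induction_incl T H v hc hadd fun s => ?_
  induction s with
  | nil => intro hs b; exact (freeIncl_nil T H b) ▸ h0 b
  | cons j s ih =>
    intro hs v
    refine wordCons_induction H (p := fun v => p (freeIncl T H (j :: s) hs v)) v ?_ ?_
      fun h v => ?_
    · have := h0 0
      rw [map_zero, LinearMap.zero_apply] at this
      rwa [map_zero]
    · intro x y hx hy
      rw [map_add]
      exact hadd _ _ hx hy
    · have hb := T.mem_branch_of_cons hs
      have := hlam j ((H j).rankOne (H j).ξ ((H j).incl h)) _ (ih hb.1 v)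
      rwa [treeLam_branch T H j _ s hb, (H j).rankOne_ξ, freeIns_incl] at this

end product

/-! ### Characterization of the free product by its representations -/

/-- A realization of the `T`-free product of the `H a` on a pointed correspondence `K`:
representations `Λ a : L(H a) → L(K)` and subspaces `E w ⊆ K` which play the role of the summands
`H_w°`. With `θ_g = g ⟨ξ, ·⟩ ∈ L(H a)`, the operators `Λ a θ_h` with `h ∈ (H a)°` move `E w` into
`E (a w)` if `a w ∈ T`, in which case `Λ a θ_ξ` is the identity on `E w`; the representation `Λ a`
vanishes on `E w` if `w ∈ T` does not begin with `a` and `a w ∉ T`; and the unit vector of `K` is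
cyclic. -/
structure FreeModel {B : Type u} [CStarAlgebra B] [PartialOrder B] [StarOrderedRing B]
    {ι : Type} (T : StringTree ι) (H : ι → PointedCorr B) (K : PointedCorr B) where
  Λ : ∀ a, (H a).L →ₙₐ[ℂ] K.L
  ip_Λ : ∀ a x y, (∀ u v, (H a).form.ip (x.1 u) v = (H a).form.ip u (y.1 v)) →
    ∀ u v, K.form.ip ((Λ a x).1 u) v = K.form.ip u ((Λ a y).1 v)
  Λ_left : ∀ a b x v, (Λ a ((H a).leftL b * x)).1 v = K.form.left b ((Λ a x).1 v)
  E : List ι → Submodule ℂ K.carrier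
  ξ_mem : ∀ b, K.form.left b K.ξ ∈ E []
  Λ_unit : ∀ a w, a :: w ∈ T.strings → ∀ u ∈ E w, (Λ a ((H a).rankOne (H a).ξ (H a).ξ)).1 u = u
  Λ_mem : ∀ a w, a :: w ∈ T.strings → ∀ u ∈ E w, ∀ h : (H a).compl.carrier,
    (Λ a ((H a).rankOne (H a).ξ ((H a).incl h))).1 u ∈ E (a :: w)
  Λ_other : ∀ a w, w ∈ T.strings → w ∉ T.branch a → w.head? ≠ some a → ∀ u ∈ E w, ∀ x,
    (Λ a x).1 u = 0
  cyclic : ∀ p : K.carrier → Prop, IsClosed {v | p v} → (∀ u v, p u → p v → p (u + v)) →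
    (∀ b, p (K.form.left b K.ξ)) → (∀ a x v, p v → p ((Λ a x).1 v)) → ∀ v, p v

namespace FreeModel

variable {B : Type u} [CStarAlgebra B] [PartialOrder B] [StarOrderedRing B]
variable {ι : Type} [DecidableEq ι] {T : StringTree ι} {H : ι → PointedCorr B} {K : PointedCorr B}
variable (M : FreeModel T H K)

/-- The operator `Λ a θ_g` for `θ_g = g ⟨ξ, ·⟩`, linear in `g`. -/
noncomputable def creation (a : ι) : (H a).carrier →ₗ[ℂ] Module.End ℂ K.carrier where
  toFun g := (M.Λ a ((H a).rankOne (H a).ξ g)).1.toLinearMap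
  map_add' g g' := by rw [map_add, map_add]; rfl
  map_smul' z g := by rw [map_smul, map_smul]; rfl

theorem creation_apply (a : ι) (g : (H a).carrier) (u : K.carrier) :
    M.creation a g u = (M.Λ a ((H a).rankOne (H a).ξ g)).1 u := rfl

/-- The map `h₁ ⊗ ⋯ ⊗ h_l ⊗ b ↦ Λ_{a₁}(θ_{h₁}) ⋯ Λ_{a_l}(θ_{h_l}) b ξ` on `H_w°`, where
`w = a₁ ⋯ a_l`. -/
noncomputable def wordMap : ∀ w, (word H w).carrier →ₗ[ℂ] K.carrier
  | [] => K.form.left.toLinearMap.flip K.ξ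
  | a :: w => TensorProduct.lift
      ((LinearMap.lcomp ℂ K.carrier (wordMap w)) ∘ₗ M.creation a ∘ₗ (H a).incl)

theorem wordMap_cons (a : ι) (w : List ι) (h : (H a).compl.carrier) (v : (word H w).carrier) :
    M.wordMap (a :: w) (wordCons H a w h v) =
      (M.Λ a ((H a).rankOne (H a).ξ ((H a).incl h))).1 (M.wordMap w v) := rfl

theorem wordMap_mem (w : List ι) (hw : w ∈ T.strings) (v : (word H w).carrier) :
    M.wordMap w v ∈ M.E w := by
  induction w with
  | nil => exact M.ξ_mem v
  | cons a w ih =>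
    refine wordCons_induction H (p := fun v => M.wordMap (a :: w) v ∈ M.E (a :: w)) v ?_ ?_ ?_
    · rw [map_zero]; exact Submodule.zero_mem _
    · intro x y hx hy; rw [map_add]; exact Submodule.add_mem _ hx hy
    · intro h v
      exact M.Λ_mem a w hw _ (ih (T.mem_of_cons hw) v) h

theorem wordMap_left (b : B) (w : List ι) (v : (word H w).carrier) :
    M.wordMap w ((word H w).form.left b v) = K.form.left b (M.wordMap w v) := by
  cases w with
  | nil => exact LinearMap.congr_fun (map_mul K.form.left b v) K.ξ
  | cons a w =>
    refine wordCons_induction H (p := fun v => M.wordMap (a :: w)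
      ((word H (a :: w)).form.left b v) = K.form.left b (M.wordMap (a :: w) v)) v ?_ ?_ ?_
    · simp only [map_zero]
    · intro x y hx hy; simp only [map_add, hx, hy]
    · intro h v
      rw [wordCons_left, wordMap_cons, wordMap_cons, ← M.Λ_left, HilbertCorr.mul_rankOne,
        HilbertCorr.leftL_apply, PointedCorr.incl_left]

theorem wordMap_right (b : Bᵐᵒᵖ) (w : List ι) (v : (word H w).carrier) :
    M.wordMap w ((word H w).form.right b v) = K.form.right b (M.wordMap w v) := by
  induction w with
  | nil =>
    have h : ∀ c : B, K.form.left (c * b.unop) K.ξ = K.form.right b (K.form.left c K.ξ) := by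
      intro c
      rw [map_mul, Module.End.mul_apply, K.central, K.form.left_right, MulOpposite.op_unop]
    exact h v
  | cons a w ih =>
    refine wordCons_induction H (p := fun v => M.wordMap (a :: w)
      ((word H (a :: w)).form.right b v) = K.form.right b (M.wordMap (a :: w) v)) v ?_ ?_ ?_
    · simp only [map_zero]
    · intro x y hx hy; simp only [map_add, hx, hy]
    · intro h v
      refine (M.wordMap_cons a w h ((word H w).form.right b v)).trans ?_
      rw [ih, wordMap_cons]
      exact (M.Λ a _).2.1 b.unop _

/-- The map `⨁_{w ∈ T} H_w° → K` before completion. -/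
noncomputable def sumMap : (wordSum H T.strings).carrier →ₗ[ℂ] K.carrier :=
  wordLift H T.strings fun w _ => M.wordMap w

theorem sumMap_incl (w : List ι) (hw : w ∈ T.strings) (v : (word H w).carrier) :
    M.sumMap (wordIncl H T.strings w hw v) = M.wordMap w v := wordLift_incl H _ _ _ _ _

theorem sumMap_left (b : B) (v : (wordSum H T.strings).carrier) :
    M.sumMap ((wordSum H T.strings).form.left b v) = K.form.left b (M.sumMap v) := by
  refine wordSum_induction H (p := fun v => M.sumMap ((wordSum H T.strings).form.left b v) =
    K.form.left b (M.sumMap v)) v ?_ ?_ ?_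
  · simp only [map_zero]
  · intro x y hx hy; simp only [map_add, hx, hy]
  · intro s hs v
    rw [wordIncl_left, sumMap_incl, sumMap_incl, wordMap_left]

theorem sumMap_right (b : Bᵐᵒᵖ) (v : (wordSum H T.strings).carrier) :
    M.sumMap ((wordSum H T.strings).form.right b v) = K.form.right b (M.sumMap v) := by
  refine wordSum_induction H (p := fun v => M.sumMap ((wordSum H T.strings).form.right b v) =
    K.form.right b (M.sumMap v)) v ?_ ?_ ?_
  · simp only [map_zero]
  · intro x y hx hy; simp only [map_add, hx, hy]
  · intro s hs v
    rw [wordIncl_right, sumMap_incl, sumMap_incl, wordMap_right]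

/-- The analogue in `K` of the formula `U_{T,a}^* (g ⊗ v) = ⟨ξ, g⟩ v + g° ⊗ v`. -/
theorem creation_wordMap (a : ι) (w : List ι) (hw : w ∈ T.branch a) (g : (H a).carrier)
    (v : (word H w).carrier) : M.creation a g (M.wordMap w v) =
      M.sumMap (branchIns T H a (branchMk T H a g (wordIncl H (T.branch a) w hw v))) := by
  rw [branchIns_mk, map_add, sumMap_incl, sumMap_incl, wordMap_left, wordMap_cons]
  conv_lhs => rw [(H a).left_ξ_add_proj g, map_add, LinearMap.add_apply, creation_apply,
    creation_apply, ← HilbertCorr.leftL_apply, ← HilbertCorr.mul_rankOne, M.Λ_left,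
    M.Λ_unit a w hw.2.2 _ (M.wordMap_mem w hw.1 v)]

/-- `sumMap` intertwines `λ_{T,a}` and `Λ a`. -/
theorem sumMap_lamPre (a : ι) (x : (H a).L) (v : (wordSum H T.strings).carrier) :
    M.sumMap (lamPre T H a x.1.toLinearMap v) = (M.Λ a x).1 (M.sumMap v) := by
  have hx : ∀ (g : (H a).carrier) u, (M.Λ a x).1 (M.creation a g u) = M.creation a (x.1 g) u := by
    intro g u
    rw [creation_apply, creation_apply, ← HilbertCorr.mul_rankOne, map_mul]
    rfl
  refine wordSum_induction H (p := fun v => M.sumMap (lamPre T H a x.1.toLinearMap v) =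
    (M.Λ a x).1 (M.sumMap v)) v ?_ ?_ ?_
  · simp only [map_zero]
  · intro y z hy hz; simp only [map_add, hy, hz]
  refine T.branch_cases a ?_ ?_ ?_
  · intro s hs v
    rw [lamPre_branch T H a _ s hs, sumMap_incl, ← creation_wordMap]
    conv_rhs => rw [← M.Λ_unit a s hs.2.2 _ (M.wordMap_mem s hs.1 v)]
    exact (hx _ _).symm
  · intro s hs v
    refine wordCons_induction H (p := fun v =>
      M.sumMap (lamPre T H a x.1.toLinearMap (wordIncl H T.strings (a :: s) hs v)) =
      (M.Λ a x).1 (M.sumMap (wordIncl H T.strings (a :: s) hs v))) v ?_ ?_ ?_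
    · simp only [map_zero]
    · intro y z hy hz; simp only [map_add, hy, hz]
    intro h v
    rw [lamPre_cons, sumMap_incl, wordMap_cons, ← creation_wordMap]
    exact (hx _ _).symm
  · intro s hs h1 h2 v
    rw [lamPre_other T H a _ s hs h1 h2, map_zero, sumMap_incl,
      M.Λ_other a s hs h1 h2 _ (M.wordMap_mem s hs v)]

/-- `sumMap` preserves inner products: by induction on the length of a word, since
`⟨Λ_a(θ_h) u, v⟩ = ⟨u, Λ_a(θ_h^*) v⟩` and `sumMap` intertwines `λ_{T,a}` and `Λ a`. -/
theorem ip_sumMap (u v : (wordSum H T.strings).carrier) :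
    K.form.ip (M.sumMap u) (M.sumMap v) = (wordSum H T.strings).form.ip u v := by
  refine wordSum_induction H (p := fun u => K.form.ip (M.sumMap u) (M.sumMap v) =
    (wordSum H T.strings).form.ip u v) u ?_ ?_ ?_
  · rw [map_zero, SemiCorr.ip_zero_left, SemiCorr.ip_zero_left]
  · intro x y hx hy
    rw [map_add, SemiCorr.ip_add_left, SemiCorr.ip_add_left, hx, hy]
  -- Reduction of the word on the left by its first letter, for an arbitrary vector on the right.
  have hstep : ∀ a s (hs : a :: s ∈ T.strings) (h : (H a).compl.carrier) (u : (word H s).carrier)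
      (v : (wordSum H T.strings).carrier),
      (K.form.ip (M.sumMap (wordIncl H T.strings s (T.mem_of_cons hs) u))
        (M.sumMap (lamPre T H a ((H a).rankOne ((H a).incl h) (H a).ξ).1.toLinearMap v)) =
        K.form.ip (M.sumMap (wordIncl H T.strings (a :: s) hs (wordCons H a s h u)))
          (M.sumMap v)) ∧
      ((wordSum H T.strings).form.ip (wordIncl H T.strings s (T.mem_of_cons hs) u)
        (lamPre T H a ((H a).rankOne ((H a).incl h) (H a).ξ).1.toLinearMap v) =
        (wordSum H T.strings).form.ip (wordIncl H T.strings (a :: s) hs (wordCons H a s h u))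
          v) := by
    intro a s hs h u v
    constructor
    · rw [sumMap_lamPre, sumMap_incl, sumMap_incl, wordMap_cons]
      exact (M.ip_Λ a _ _ ((H a).ip_rankOne _ _) _ _).symm
    · refine (ip_lamPre T H a (x := ((H a).rankOne (H a).ξ ((H a).incl h)).1.toLinearMap)
        ((H a).ip_rankOne _ _) _ _).symm.trans ?_
      rw [lamPre_branch T H a _ s (T.mem_branch_of_cons hs)]
      have h1 : ((H a).rankOne (H a).ξ ((H a).incl h)).1.toLinearMap (H a).ξ = (H a).incl h :=
        (H a).rankOne_ξ _
      rw [h1, branchIns_mk, (H a).ip_ξ_incl, (H a).proj_incl, map_zero, LinearMap.zero_apply,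
        map_zero, zero_add]
  intro s
  induction s generalizing v with
  | nil =>
    intro hs b
    refine wordSum_induction H (p := fun v => K.form.ip (M.sumMap (wordIncl H T.strings [] hs b))
      (M.sumMap v) = (wordSum H T.strings).form.ip (wordIncl H T.strings [] hs b) v) v ?_ ?_ ?_
    · rw [map_zero, SemiCorr.ip_zero_right, SemiCorr.ip_zero_right]
    · intro x y hx hy
      rw [map_add, SemiCorr.ip_add_right, SemiCorr.ip_add_right, hx, hy]
    intro t ht v
    cases t with
    | nil =>
      rw [wordIncl_ip, sumMap_incl, sumMap_incl]
      have h : ∀ c d : B, K.form.ip (K.form.left c K.ξ) (K.form.left d K.ξ) = star c * d := by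
        intro c d
        rw [K.form.ip_left, K.ip_ξ_left, K.ip_ξ_left, K.ip_ξ, mul_one]
      exact h b v
    | cons a t =>
      rw [wordIncl_ip_ne H _ _ _ (List.cons_ne_nil a t).symm]
      refine wordCons_induction H (p := fun v => K.form.ip (M.sumMap (wordIncl H T.strings [] hs b))
        (M.sumMap (wordIncl H T.strings (a :: t) ht v)) = 0) v ?_ ?_ ?_
      · rw [map_zero, map_zero, SemiCorr.ip_zero_right]
      · intro x y hx hy
        rw [map_add, map_add, SemiCorr.ip_add_right, hx, hy, add_zero]
      intro h v
      rw [← K.form.ip_star, ← (hstep a t ht h v _).1]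
      -- `θ_h^*` annihilates `ξ`, because `h ∈ (H a)°`.
      have h1 : ((H a).rankOne ((H a).incl h) (H a).ξ).1.toLinearMap (H a).ξ = 0 := by
        refine ((H a).rankOne_apply _ _ _).trans ?_
        rw [← (H a).form.ip_star, (H a).ip_ξ_incl, star_zero, MulOpposite.op_zero, map_zero,
          LinearMap.zero_apply]
      have h2 : lamPre T H a ((H a).rankOne ((H a).incl h) (H a).ξ).1.toLinearMap
          (wordIncl H T.strings [] hs b) = 0 := by
        by_cases hb : [] ∈ T.branch a
        · rw [lamPre_branch T H a _ [] hb, h1, map_zero, LinearMap.zero_apply, map_zero]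
        · exact lamPre_other T H a _ [] hs hb (by simp) b
      rw [h2, map_zero, SemiCorr.ip_zero_right, star_zero]
  | cons a s ih =>
    intro hs u
    refine wordCons_induction H (p := fun u => K.form.ip
      (M.sumMap (wordIncl H T.strings (a :: s) hs u)) (M.sumMap v) =
      (wordSum H T.strings).form.ip (wordIncl H T.strings (a :: s) hs u) v) u ?_ ?_ ?_
    · rw [map_zero, map_zero, SemiCorr.ip_zero_left, SemiCorr.ip_zero_left]
    · intro x y hx hy
      rw [map_add, map_add, SemiCorr.ip_add_left, SemiCorr.ip_add_left, hx, hy]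
    intro h u
    rw [← (hstep a s hs h u v).1, ← (hstep a s hs h u v).2]
    exact ih _ (T.mem_of_cons hs) u

/-- The isometry from the free product to a realization. -/
noncomputable def isometry : PointedIsometry (freeProd T H) K :=
  PointedIsometry.ofPre (V := wordSum H T.strings) M.sumMap M.ip_sumMap M.sumMap_left
    M.sumMap_right (by
      rw [sumMap_incl]
      exact LinearMap.congr_fun (map_one K.form.left) K.ξ)

theorem isometry_toHat (v : (wordSum H T.strings).carrier) :
    M.isometry.toCLM ((wordSum H T.strings).form.toHat v) = M.sumMap v :=
  PointedIsometry.ofPre_toHat ..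

theorem isometry_treeLam (a : ι) (x : (H a).L) (v : (freeProd T H).carrier) :
    M.isometry.toCLM ((treeLam T H a x).1 v) = (M.Λ a x).1 (M.isometry.toCLM v) := by
  refine (wordSum H T.strings).form.hat_ind
    (p := fun v => M.isometry.toCLM ((treeLam T H a x).1 v) =
      (M.Λ a x).1 (M.isometry.toCLM v)) v (isClosed_eq (by fun_prop) (by fun_prop)) fun v => ?_
  rw [treeLam_toHat, isometry_toHat, isometry_toHat, sumMap_lamPre]

theorem isometry_surjective : Function.Surjective M.isometry.toCLM := by
  refine M.cyclic (fun v => v ∈ Set.range M.isometry.toCLM) M.isometry.isClosed_range ?_ ?_ ?_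
  · rintro _ _ ⟨u, rfl⟩ ⟨v, rfl⟩
    exact ⟨u + v, map_add _ _ _⟩
  · intro b
    exact ⟨(freeProd T H).form.left b (freeProd T H).ξ, by
      rw [M.isometry.map_left, M.isometry.map_ξ]⟩
  · rintro a x _ ⟨u, rfl⟩
    exact ⟨_, M.isometry_treeLam a x u⟩

/-- A realization of the free product is isomorphic to the free product. -/
noncomputable def iso : PointedIso K (freeProd T H) := M.isometry.symmIso M.isometry_surjective

theorem Ad_iso (a : ι) (x : (H a).L) : M.iso.Ad (M.Λ a x) = treeLam T H a x := by
  refine (freeProd T H).ext_L fun v => ?_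
  rw [PointedIso.Ad_apply, ← LinearIsometryEquiv.eq_symm_apply]
  exact (M.isometry_treeLam a x v).symm

/-- The isomorphism of a realization with the free product is determined by the
representations. -/
theorem iso_unique {Φ Ψ : PointedIso K (freeProd T H)}
    (hΦ : ∀ a x, Φ.Ad (M.Λ a x) = treeLam T H a x)
    (hΨ : ∀ a x, Ψ.Ad (M.Λ a x) = treeLam T H a x) : Φ = Ψ := by
  have hl : ∀ (Φ : PointedIso K (freeProd T H)) b,
      Φ.toEquiv.symm ((freeProd T H).form.left b (freeProd T H).ξ) = K.form.left b K.ξ := by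
    intro Φ b
    rw [LinearIsometryEquiv.symm_apply_eq, Φ.map_left, Φ.map_ξ]
  have hs : ∀ (Φ : PointedIso K (freeProd T H)), (∀ a x, Φ.Ad (M.Λ a x) = treeLam T H a x) →
      ∀ a x v, Φ.toEquiv.symm ((treeLam T H a x).1 v) = (M.Λ a x).1 (Φ.toEquiv.symm v) := by
    intro Φ hΦ a x v
    rw [LinearIsometryEquiv.symm_apply_eq, ← hΦ, PointedIso.Ad_apply]
  refine PointedIso.ext_equiv fun v => freeProd_induction T H
    (p := fun v => Φ.toEquiv.symm v = Ψ.toEquiv.symm v) v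
    (isClosed_eq (LinearIsometryEquiv.continuous _) (LinearIsometryEquiv.continuous _)) ?_ ?_ ?_
  · intro u v hu hv
    rw [map_add, map_add, hu, hv]
  · intro b
    rw [hl, hl]
  · intro a x v hv
    rw [hs Φ hΦ, hs Ψ hΨ, hv]

end FreeModel

/-! ### Functoriality of the free product -/

section functoriality

variable {B : Type u} [CStarAlgebra B] [PartialOrder B] [StarOrderedRing B]
variable {ι : Type} [DecidableEq ι] (T : StringTree ι) {H G : ι → PointedCorr B}
variable (V : ∀ j, PointedIsometry (H j) (G j)) (j : ι)

/-- The restriction of an isometry of pointed correspondences to `H° → K°`. -/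
noncomputable def PointedIsometry.complMap {H K : PointedCorr B} (V : PointedIsometry H K) :
    H.compl.carrier →ₗ[ℂ] K.compl.carrier :=
  K.proj ∘ₗ V.toCLM.toLinearMap ∘ₗ H.incl

theorem PointedIsometry.ip_ξ_map {H K : PointedCorr B} (V : PointedIsometry H K) (h : H.carrier) :
    K.form.ip K.ξ (V.toCLM h) = H.form.ip H.ξ h := by
  rw [← V.map_ξ, V.map_ip]

theorem PointedIsometry.proj_map {H K : PointedCorr B} (V : PointedIsometry H K) (h : H.carrier) :
    K.proj (V.toCLM h) = V.complMap (H.proj h) := by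
  change _ = K.proj (V.toCLM (H.incl (H.proj h)))
  rw [H.incl_proj, map_sub, map_sub, V.map_right, V.map_ξ, ← K.central, K.proj_left, K.proj_ξ,
    map_zero, sub_zero]

theorem PointedIsometry.incl_complMap {H K : PointedCorr B} (V : PointedIsometry H K)
    (h : H.compl.carrier) : K.incl (V.complMap h) = V.toCLM (H.incl h) := by
  change K.incl (K.proj (V.toCLM (H.incl h))) = _
  rw [K.incl_proj, V.ip_ξ_map, H.ip_ξ_incl, MulOpposite.op_zero, map_zero, LinearMap.zero_apply,
    sub_zero]

theorem PointedIsometry.complMap_left {H K : PointedCorr B} (V : PointedIsometry H K) (b : B)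
    (h : H.compl.carrier) :
    V.complMap (H.compl.form.left b h) = K.compl.form.left b (V.complMap h) := by
  apply K.incl_injective
  rw [V.incl_complMap, K.incl_left, V.incl_complMap, H.incl_left, V.map_left]

theorem PointedIsometry.ip_complMap {H K : PointedCorr B} (V : PointedIsometry H K)
    (h h' : H.compl.carrier) :
    K.compl.form.ip (V.complMap h) (V.complMap h') = H.compl.form.ip h h' := by
  rw [← K.ip_incl, V.incl_complMap, V.incl_complMap, V.map_ip, H.ip_incl]

/-- The map `V_{j₁} ⊗ ⋯ ⊗ V_{j_l} : H_s° → G_s°`. -/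
noncomputable def wordFunc : ∀ s, (word H s).carrier →ₗ[ℂ] (word G s).carrier
  | [] => (LinearMap.id : B →ₗ[ℂ] B)
  | j :: s => TensorProduct.map (V j).complMap (wordFunc s)

theorem wordFunc_cons (s : List ι) (h : (H j).compl.carrier) (v : (word H s).carrier) :
    wordFunc V (j :: s) (wordCons H j s h v) =
      wordCons G j s ((V j).complMap h) (wordFunc V s v) := rfl

theorem wordFunc_left (b : B) (s : List ι) (v : (word H s).carrier) :
    wordFunc V s ((word H s).form.left b v) = (word G s).form.left b (wordFunc V s v) := by
  cases s with
  | nil => rfl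
  | cons j s =>
    refine wordCons_induction H (p := fun v => wordFunc V (j :: s)
      ((word H (j :: s)).form.left b v) =
      (word G (j :: s)).form.left b (wordFunc V (j :: s) v)) v ?_ ?_ ?_
    · simp only [map_zero]
    · intro x y hx hy; simp only [map_add, hx, hy]
    · intro h v
      rw [wordCons_left, wordFunc_cons, wordFunc_cons, wordCons_left, (V j).complMap_left]

theorem wordFunc_right (b : Bᵐᵒᵖ) (s : List ι) (v : (word H s).carrier) :
    wordFunc V s ((word H s).form.right b v) = (word G s).form.right b (wordFunc V s v) := by
  induction s with
  | nil => rfl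
  | cons j s ih =>
    refine wordCons_induction H (p := fun v => wordFunc V (j :: s)
      ((word H (j :: s)).form.right b v) =
      (word G (j :: s)).form.right b (wordFunc V (j :: s) v)) v ?_ ?_ ?_
    · simp only [map_zero]
    · intro x y hx hy; simp only [map_add, hx, hy]
    · intro h v
      exact (wordFunc_cons V j s h _).trans (congrArg (wordCons G j s ((V j).complMap h)) (ih v))

theorem ip_wordFunc (s : List ι) (u v : (word H s).carrier) :
    (word G s).form.ip (wordFunc V s u) (wordFunc V s v) = (word H s).form.ip u v := by
  induction s with
  | nil => rfl
  | cons j s ih =>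
    refine wordCons_induction H (p := fun u => (word G (j :: s)).form.ip
      (wordFunc V (j :: s) u) (wordFunc V (j :: s) v) = (word H (j :: s)).form.ip u v) u ?_ ?_ ?_
    · rw [map_zero, SemiCorr.ip_zero_left, SemiCorr.ip_zero_left]
    · intro x y hx hy
      rw [map_add, SemiCorr.ip_add_left, SemiCorr.ip_add_left, hx, hy]
    intro h u
    refine wordCons_induction H (p := fun v => (word G (j :: s)).form.ip
      (wordFunc V (j :: s) (wordCons H j s h u)) (wordFunc V (j :: s) v) =
      (word H (j :: s)).form.ip (wordCons H j s h u) v) v ?_ ?_ ?_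
    · rw [map_zero, SemiCorr.ip_zero_right, SemiCorr.ip_zero_right]
    · intro x y hx hy
      rw [map_add, SemiCorr.ip_add_right, SemiCorr.ip_add_right, hx, hy]
    intro h' v
    rw [wordFunc_cons, wordFunc_cons, wordCons_ip, wordCons_ip, (V j).ip_complMap, ← wordFunc_left,
      ih]

/-- The direct sum of the maps `wordFunc` over the strings of `T`, with values in the free
product. -/
noncomputable def sumFunc : (wordSum H T.strings).carrier →ₗ[ℂ] (freeProd T G).carrier :=
  wordLift H T.strings fun s hs => freeIncl T G s hs ∘ₗ wordFunc V s

theorem sumFunc_incl (s : List ι) (hs : s ∈ T.strings) (v : (word H s).carrier) :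
    sumFunc T V (wordIncl H T.strings s hs v) = freeIncl T G s hs (wordFunc V s v) :=
  wordLift_incl H _ _ _ _ _

/-- The isometry between free products induced by isometries of the factors. -/
noncomputable def freeFunc : PointedIsometry (freeProd T H) (freeProd T G) :=
  PointedIsometry.ofPre (V := wordSum H T.strings) (sumFunc T V)
    (fun u v => by
      refine wordSum_induction H (p := fun u => (freeProd T G).form.ip (sumFunc T V u)
        (sumFunc T V v) = (wordSum H T.strings).form.ip u v) u ?_ ?_ ?_
      · rw [map_zero, SemiCorr.ip_zero_left, SemiCorr.ip_zero_left]
      · intro x y hx hy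
        rw [map_add, SemiCorr.ip_add_left, SemiCorr.ip_add_left, hx, hy]
      intro s hs u
      refine wordSum_induction H (p := fun v => (freeProd T G).form.ip
        (sumFunc T V (wordIncl H T.strings s hs u)) (sumFunc T V v) =
        (wordSum H T.strings).form.ip (wordIncl H T.strings s hs u) v) v ?_ ?_ ?_
      · rw [map_zero, SemiCorr.ip_zero_right, SemiCorr.ip_zero_right]
      · intro x y hx hy
        rw [map_add, SemiCorr.ip_add_right, SemiCorr.ip_add_right, hx, hy]
      intro t ht v
      rw [sumFunc_incl, sumFunc_incl]
      by_cases hst : s = t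
      · subst hst
        rw [wordIncl_ip, freeIncl_ip, ip_wordFunc]
      · rw [wordIncl_ip_ne H _ _ _ hst, freeIncl_ip_ne T G _ _ hst])
    (fun b v => by
      refine wordSum_induction H (p := fun v => sumFunc T V ((wordSum H T.strings).form.left b v) =
        (freeProd T G).form.left b (sumFunc T V v)) v ?_ ?_ ?_
      · simp only [map_zero]
      · intro x y hx hy; simp only [map_add, hx, hy]
      intro s hs v
      rw [wordIncl_left, sumFunc_incl, sumFunc_incl, wordFunc_left, freeIncl_left])
    (fun b v => by
      refine wordSum_induction H (p := fun v =>
        sumFunc T V ((wordSum H T.strings).form.right b v) =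
        (freeProd T G).form.right b (sumFunc T V v)) v ?_ ?_ ?_
      · simp only [map_zero]
      · intro x y hx hy; simp only [map_add, hx, hy]
      intro s hs v
      rw [wordIncl_right, sumFunc_incl, sumFunc_incl, wordFunc_right, freeIncl_right])
    (sumFunc_incl T V [] T.nil_mem (wordOne H))

theorem freeFunc_incl (s : List ι) (hs : s ∈ T.strings) (v : (word H s).carrier) :
    (freeFunc T V).toCLM (freeIncl T H s hs v) = freeIncl T G s hs (wordFunc V s v) :=
  (PointedIsometry.ofPre_toHat ..).trans (sumFunc_incl T V s hs v)

theorem freeFunc_ins (s : List ι) (hs : s ∈ T.branch j) (h : (H j).carrier)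
    (v : (word H s).carrier) :
    (freeFunc T V).toCLM (freeIns T H j s hs h v) =
      freeIns T G j s hs ((V j).toCLM h) (wordFunc V s v) := by
  rw [freeIns_eq, freeIns_eq, map_add, freeFunc_incl, freeFunc_incl, wordFunc_left,
    wordFunc_cons, (V j).ip_ξ_map, (V j).proj_map]

theorem freeFunc_treeLam {x : (H j).L} {y : (G j).L}
    (hxy : ∀ v, (V j).toCLM (x.1 v) = y.1 ((V j).toCLM v)) (v : (freeProd T H).carrier) :
    (freeFunc T V).toCLM ((treeLam T H j x).1 v) =
      (treeLam T G j y).1 ((freeFunc T V).toCLM v) := by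
  refine freeProd_induction_ins T H j (p := fun v => (freeFunc T V).toCLM ((treeLam T H j x).1 v) =
      (treeLam T G j y).1 ((freeFunc T V).toCLM v)) v
    (isClosed_eq (by fun_prop) (by fun_prop)) ?_ ?_ ?_
  · intro u v hu hv
    simp only [map_add, hu, hv]
  · intro s hs h v
    rw [treeLam_freeIns, freeFunc_ins, freeFunc_ins, treeLam_freeIns, hxy]
  · intro s hs h1 h2 v
    rw [treeLam_other T H j x s hs h1 h2, map_zero, freeFunc_incl,
      treeLam_other T G j y s hs h1 h2]

end functoriality

/-! ### Laws of operators -/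

section laws

open NCPoly

variable {B : Type u} [CStarAlgebra B] [PartialOrder B] [StarOrderedRing B] {H K : PointedCorr B}

theorem PointedCorr.law_apply (Y : H.L) (hY) (p : NCPoly B) :
    (H.law Y hY).toLin p = H.form.ip H.ξ (H.eval Y p H.ξ) := rfl

theorem PointedCorr.eval_coef (Y : H.L) (b : B) : H.eval Y (coef b) = H.form.left b :=
  lift_coef _ _ _

theorem PointedCorr.eval_X (Y : H.L) (v : H.carrier) : H.eval Y X v = Y.1 v :=
  LinearMap.congr_fun (lift_X _ _) v

theorem PointedIsometry.map_eval (V : PointedIsometry H K) {Y : H.L} {Z : K.L}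
    (h : ∀ v, V.toCLM (Y.1 v) = Z.1 (V.toCLM v)) (p : NCPoly B) :
    ∀ v, V.toCLM (H.eval Y p v) = K.eval Z p (V.toCLM v) := by
  refine induction (p := fun p => ∀ v, V.toCLM (H.eval Y p v) = K.eval Z p (V.toCLM v))
    ?_ ?_ ?_ ?_ p
  · intro b v
    rw [H.eval_coef, K.eval_coef, V.map_left]
  · intro v
    rw [H.eval_X, K.eval_X, h]
  · intro p q hp hq v
    rw [map_add, map_add, LinearMap.add_apply, LinearMap.add_apply, map_add, hp, hq]
  · intro p q hp hq v
    rw [map_mul, map_mul, Module.End.mul_apply, Module.End.mul_apply, hp, hq]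

/-- Intertwining isometries preserve laws. -/
theorem PointedIsometry.law_eq (V : PointedIsometry H K) {Y : H.L} {Z : K.L}
    (h : ∀ v, V.toCLM (Y.1 v) = Z.1 (V.toCLM v)) (hY hZ) : H.law Y hY = K.law Z hZ := by
  ext p
  rw [PointedCorr.law_apply, PointedCorr.law_apply, ← V.map_ip, V.map_eval h, V.map_ξ]

namespace Law

variable (μ : Law B)

theorem mulX_toHat (p : NCPoly B) :
    μ.mulX.1 (μ.form.toHat p) = μ.form.toHat (X * p) :=
  SemiCorr.hatMap_toHat (F := μ.form) (G := μ.form) mulXPre μ.mulXPre_bound p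

theorem eval_mulX (p : NCPoly B) :
    ∀ q, μ.L2.eval μ.mulX p (μ.form.toHat q) = μ.form.toHat (p * q) := by
  refine induction (p := fun p => ∀ q,
    μ.L2.eval μ.mulX p (μ.form.toHat q) = μ.form.toHat (p * q)) ?_ ?_ ?_ ?_ p
  · intro b q
    rw [PointedCorr.eval_coef]
    exact μ.form.hatLeft_toHat b q
  · intro q
    exact (PointedCorr.eval_X _ _).trans (μ.mulX_toHat q)
  · intro p p' hp hp' q
    refine (LinearMap.congr_fun (map_add (μ.L2.eval μ.mulX) p p') _).trans ?_
    refine (congrArg₂ (· + ·) (hp q) (hp' q)).trans ?_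
    rw [add_mul]
    exact (map_add μ.form.toHat _ _).symm
  · intro p p' hp hp' q
    refine (LinearMap.congr_fun (map_mul (μ.L2.eval μ.mulX) p p') _).trans ?_
    refine (congrArg (μ.L2.eval μ.mulX p) (hp' q)).trans ?_
    rw [hp, mul_assoc]

/-- The law of the multiplication operator on `L²(B⟨X⟩, μ)` is `μ`. -/
theorem law_mulX : μ.L2.law μ.mulX μ.mulXHat_symm = μ := by
  ext p
  refine (congrArg (μ.L2.form.ip μ.L2.ξ) (μ.eval_mulX p 1)).trans
    ((μ.form.ipHat_toHat 1 (p * 1)).trans ?_)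
  change μ.toLin (star 1 * (p * 1)) = _
  rw [star_one, one_mul, mul_one]

end Law

/-- If `μ` is the law of `Y ∈ L(K)`, then `p ↦ p(Y) ξ` is an isometry from `L²(B⟨X⟩, μ)` to `K`. -/
noncomputable def PointedCorr.cyclicIsometry (Y : K.L)
    (hY : ∀ u v, K.form.ip (Y.1 u) v = K.form.ip u (Y.1 v)) :
    PointedIsometry (K.law Y hY).L2 K :=
  PointedIsometry.ofPre (V := ⟨NCPoly B, (K.law Y hY).form⟩) (ξ := (1 : NCPoly B))
    (LinearMap.applyₗ K.ξ ∘ₗ (K.eval Y).toLinearMap)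
    (fun p q => by
      change K.form.ip (K.eval Y p K.ξ) (K.eval Y q K.ξ) =
        K.form.ip K.ξ (K.eval Y (star p * q) K.ξ)
      rw [K.eval_star hY, map_mul]
      rfl)
    (fun b p => by
      change K.eval Y (coef b * p) K.ξ = K.form.left b (K.eval Y p K.ξ)
      rw [map_mul, K.eval_coef]
      rfl)
    (fun b p => by
      change K.eval Y (p * coef b.unop) K.ξ = K.form.right b (K.eval Y p K.ξ)
      rw [map_mul, K.eval_coef, Module.End.mul_apply, K.central, K.eval_right, MulOpposite.op_unop])
    (by
      change K.eval Y 1 K.ξ = K.ξ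
      rw [map_one]
      rfl)

theorem PointedCorr.cyclicIsometry_toHat (Y : K.L) (hY) (p : NCPoly B) :
    (K.cyclicIsometry Y hY).toCLM ((K.law Y hY).form.toHat p) = K.eval Y p K.ξ :=
  PointedIsometry.ofPre_toHat (V := ⟨NCPoly B, (K.law Y hY).form⟩) ..

theorem PointedCorr.cyclicIsometry_mulX (Y : K.L) (hY) (v : (K.law Y hY).L2.carrier) :
    (K.cyclicIsometry Y hY).toCLM ((K.law Y hY).mulX.1 v) =
      Y.1 ((K.cyclicIsometry Y hY).toCLM v) := by
  refine (K.law Y hY).form.hat_ind (p := fun v => (K.cyclicIsometry Y hY).toCLM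
    ((K.law Y hY).mulX.1 v) = Y.1 ((K.cyclicIsometry Y hY).toCLM v)) v
    (isClosed_eq (by fun_prop) (by fun_prop)) fun p => ?_
  rw [(K.law Y hY).mulX_toHat, cyclicIsometry_toHat, cyclicIsometry_toHat, map_mul,
    Module.End.mul_apply, K.eval_X]

theorem coe_sum_L {ι : Type*} (s : Finset ι) (f : ι → H.L) (v : H.carrier) :
    (∑ i ∈ s, f i).1 v = ∑ i ∈ s, (f i).1 v := by
  rw [AddSubmonoidClass.coe_finsetSum, _root_.sum_apply]

/-- In the definition of `⊞_T`, the spaces `L²(B⟨X⟩, μ_j)` may be replaced by arbitrary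
correspondences which carry operators of law `μ_j`. -/
theorem treeConv_law {N : ℕ} (T : StringTree (Fin N)) (G : Fin N → PointedCorr B)
    (Y : ∀ j, (G j).L) (hY : ∀ j u v, (G j).form.ip ((Y j).1 u) v = (G j).form.ip u ((Y j).1 v))
    (hs) : treeConv T (fun j => (G j).law (Y j) (hY j)) =
      (freeProd T G).law (∑ j, treeLam T G j (Y j)) hs := by
  refine (freeFunc T fun j => (G j).cyclicIsometry (Y j) (hY j)).law_eq (fun v => ?_) _ hs
  rw [coe_sum_L, coe_sum_L, map_sum]
  exact Finset.sum_congr rfl fun j _ =>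
    freeFunc_treeLam T _ j ((G j).cyclicIsometry_mulX (Y j) (hY j)) v

/-- Every pointed correspondence is a realization of its free product over the identity tree. -/
noncomputable def identityModel (H : PointedCorr B) :
    FreeModel StringTree.identity (fun _ => H) H where
  Λ _ := NonUnitalAlgHom.id ℂ _
  ip_Λ _ _ _ h := h
  Λ_left _ _ _ _ := rfl
  E
    | [] => LinearMap.range (H.form.left.toLinearMap.flip H.ξ)
    | _ :: _ => ⊤
  ξ_mem b := ⟨b, rfl⟩
  Λ_unit a w hw u hu := by
    rw [StringTree.identity, StringTree.strings_ofStrings] at hw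
    obtain ⟨-, rfl⟩ : a = 0 ∧ w = [] := by simpa using hw
    obtain ⟨b, rfl⟩ := hu
    change (H.rankOne H.ξ H.ξ).1 (H.form.left b H.ξ) = H.form.left b H.ξ
    rw [H.rankOne_apply, H.ip_ξ_left, H.ip_ξ, mul_one, H.central]
  Λ_mem _ _ _ _ _ _ := Submodule.mem_top
  Λ_other a w hw h1 h2 u hu x := by
    rw [StringTree.identity, StringTree.strings_ofStrings] at hw
    obtain rfl : a = 0 := Subsingleton.elim _ _
    rcases hw with rfl | rfl
    · refine absurd (StringTree.mem_branch_of_cons _ ?_) h1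
      rw [StringTree.identity, StringTree.strings_ofStrings]
      exact Or.inr rfl
    · exact absurd rfl h2
  cyclic p _ _ h0 h v := by
    have := h 0 (H.rankOne H.ξ v) _ (h0 1)
    rw [map_one] at this
    change p ((H.rankOne H.ξ v).1 H.ξ) at this
    rwa [H.rankOne_ξ] at this

theorem treeConv_identity (μ : Law B) : treeConv StringTree.identity (fun _ => μ) = μ := by
  refine Eq.trans ?_ μ.law_mulX
  refine ((identityModel μ.L2).isometry.law_eq (fun v => ?_) _ _)
  rw [coe_sum_L, Fin.sum_univ_one]
  exact (identityModel μ.L2).isometry_treeLam 0 μ.mulX v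

end laws

/-! ### Block decomposition of the strings of a composition -/

namespace StringTree

variable {k : ℕ} {n : Fin k → ℕ} (T : StringTree (Fin k)) (S : ∀ j, StringTree (Fin (n j)))

theorem exists_letter (a : Fin (∑ j, n j)) : ∃ (j : Fin k) (i : Fin (n j)), a = letter j i :=
  ⟨(finSigmaFinEquiv.symm a).1, (finSigmaFinEquiv.symm a).2,
    (finSigmaFinEquiv.apply_symm_apply a).symm⟩

/-- The string obtained by concatenation of relabelled blocks. -/
def flat (l : List (Σ j, List (Fin (n j)))) : List (Fin (∑ j, n j)) :=
  l.flatMap fun p => p.2.map (letter p.1)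

/-- Prepend the `i`-th letter of the `j`-th alphabet to a sequence of blocks: it is absorbed by the
first block if this block belongs to the `j`-th alphabet, and is a block of its own otherwise. -/
def consBlock (j : Fin k) (i : Fin (n j)) :
    List (Σ j, List (Fin (n j))) → List (Σ j, List (Fin (n j)))
  | [] => [⟨j, [i]⟩]
  | p :: l => if h : j = p.1 then ⟨p.1, Fin.cast (congrArg n h) i :: p.2⟩ :: l
      else ⟨j, [i]⟩ :: p :: l

theorem consBlock_same (j : Fin k) (i : Fin (n j)) (t : List (Fin (n j)))
    (l : List (Σ j, List (Fin (n j)))) : consBlock j i (⟨j, t⟩ :: l) = ⟨j, i :: t⟩ :: l := by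
  rw [consBlock, dif_pos rfl]
  rfl

theorem consBlock_of_head (j : Fin k) (i : Fin (n j)) {l : List (Σ j, List (Fin (n j)))}
    (h : (l.map Sigma.fst).head? ≠ some j) : consBlock j i l = ⟨j, [i]⟩ :: l := by
  cases l with
  | nil => rfl
  | cons p l =>
    rw [consBlock, dif_neg]
    rintro rfl
    exact h rfl

/-- The decomposition of a string into maximal blocks of letters from the same alphabet. -/
def blocks (w : List (Fin (∑ j, n j))) : List (Σ j, List (Fin (n j))) :=
  w.foldr (fun a l => consBlock (finSigmaFinEquiv.symm a).1 (finSigmaFinEquiv.symm a).2 l) []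

theorem blocks_cons (j : Fin k) (i : Fin (n j)) (w : List (Fin (∑ j, n j))) :
    blocks (letter j i :: w) = consBlock j i (blocks w) := by
  have h : ∀ p : Σ j, Fin (n j), p = ⟨j, i⟩ → consBlock p.1 p.2 (blocks w) =
      consBlock j i (blocks w) := by
    rintro _ rfl
    rfl
  exact h _ (finSigmaFinEquiv.symm_apply_apply ⟨j, i⟩)

theorem head_cases (j : Fin k) (l : List (Σ j, List (Fin (n j)))) :
    (l.map Sigma.fst).head? ≠ some j ∨ ∃ t l', l = ⟨j, t⟩ :: l' := by
  cases l with
  | nil => exact Or.inl (by simp)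
  | cons p l =>
    obtain ⟨j', t⟩ := p
    by_cases h : j' = j
    · subst h
      exact Or.inr ⟨t, l, rfl⟩
    · exact Or.inl (by simpa using h)

theorem flat_consBlock (j : Fin k) (i : Fin (n j)) (l : List (Σ j, List (Fin (n j)))) :
    flat (consBlock j i l) = letter j i :: flat l := by
  rcases head_cases j l with h | ⟨t, l, rfl⟩
  · rw [consBlock_of_head j i h]
    rfl
  · rw [consBlock_same]
    rfl

theorem flat_blocks (w : List (Fin (∑ j, n j))) : flat (blocks w) = w := by
  induction w with
  | nil => rfl
  | cons a w ih =>
    obtain ⟨j, i, rfl⟩ := exists_letter a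
    rw [blocks_cons, flat_consBlock, ih]

theorem blocks_flat {l : List (Σ j, List (Fin (n j)))} (hl : (l.map Sigma.fst).IsChain (· ≠ ·))
    (h : ∀ p ∈ l, p.2 ≠ []) : blocks (flat l) = l := by
  induction l with
  | nil => rfl
  | cons p l ih =>
    obtain ⟨j, t⟩ := p
    have h1 : blocks (flat l) = l := ih hl.tail fun p hp => h p (List.mem_cons_of_mem _ hp)
    have h2 : (l.map Sigma.fst).head? ≠ some j := by
      cases l with
      | nil => simp
      | cons p l =>
        rw [List.map_cons, List.map_cons, List.isChain_cons_cons] at hl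
        simpa using hl.1.symm
    have h3 : ∀ t : List (Fin (n j)), t ≠ [] →
        blocks (t.map (letter j) ++ flat l) = ⟨j, t⟩ :: l := by
      intro t
      induction t with
      | nil => exact fun h => absurd rfl h
      | cons i t ih' =>
        intro _
        rw [List.map_cons, List.cons_append, blocks_cons]
        by_cases ht : t = []
        · subst ht
          rw [List.map_nil, List.nil_append, h1, consBlock_of_head j i h2]
        · rw [ih' ht, consBlock_same]
    exact h3 t (h ⟨j, t⟩ List.mem_cons_self)

/-- A sequence of nonempty blocks from the `S j` whose sequence of alphabets is a string of `T`. -/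
def IsBlocks (l : List (Σ j, List (Fin (n j)))) : Prop :=
  l.map Sigma.fst ∈ T.strings ∧ ∀ p ∈ l, p.2 ∈ (S p.1).strings ∧ p.2 ≠ []

theorem mem_comp_strings (w : List (Fin (∑ j, n j))) :
    w ∈ (T.comp S).strings ↔ T.IsBlocks S (blocks w) := by
  have hcomp : (T.comp S).strings = T.compStrings S := strings_ofStrings _ _ _ _
  rw [hcomp]
  constructor
  · rintro ⟨l, hl, h, rfl⟩
    have h1 : blocks (flat l) = l := blocks_flat (T.alternating hl) fun p hp => (h p hp).2
    rw [← flat, h1]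
    exact ⟨hl, h⟩
  · rintro ⟨hl, h⟩
    exact ⟨blocks w, hl, h, (flat_blocks w).symm⟩

end StringTree

/-! ### The iterated product is a realization of the product over the composed tree -/

namespace FreeModel

open StringTree

variable {B : Type u} [CStarAlgebra B] [PartialOrder B] [StarOrderedRing B]
variable {k : ℕ} {n : Fin k → ℕ} (T : StringTree (Fin k)) (S : ∀ j, StringTree (Fin (n j)))
variable (H : Fin (∑ j, n j) → PointedCorr B)

/-- The `S j`-free product of the correspondences with letters in the `j`-th alphabet. -/
noncomputable abbrev inner (j : Fin k) : PointedCorr B :=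
  freeProd (S j) fun i => H (letter j i)

/-- The representations `λ_{T,j} ∘ λ_{S_j,i}`, indexed by the letters of the composed tree. -/
noncomputable def compLam (a : Fin (∑ j, n j)) : (H a).L →ₙₐ[ℂ] (freeProd T (inner S H)).L :=
  Equiv.piCongrLeft (fun a => (H a).L →ₙₐ[ℂ] (freeProd T (inner S H)).L) finSigmaFinEquiv
    (fun p => (treeLamHom T (inner S H) p.1).comp
      (treeLamHom (S p.1) (fun i => H (letter p.1 i)) p.2)) a

theorem compLam_letter (j : Fin k) (i : Fin (n j)) (x : (H (letter j i)).L) :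
    compLam T S H (letter j i) x =
      treeLam T (inner S H) j (treeLam (S j) (fun i => H (letter j i)) i x) :=
  congrArg (fun f : (H (letter j i)).L →ₙₐ[ℂ] (freeProd T (inner S H)).L => f x)
    (Equiv.piCongrLeft_apply_apply
      (fun a => (H a).L →ₙₐ[ℂ] (freeProd T (inner S H)).L) finSigmaFinEquiv
      (fun p => (treeLamHom T (inner S H) p.1).comp
        (treeLamHom (S p.1) (fun i => H (letter p.1 i)) p.2)) ⟨j, i⟩)

/-- The subspace of the iterated product which corresponds to a sequence of blocks: if the first
block is `t ∈ S j`, it is spanned by the vectors `g ⊗ z` with `g` in the summand of the `S j`-free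
product indexed by `t`; there is no condition on `z`, because representations act on the first
factor only. The empty sequence gives `B ξ`. -/
noncomputable def blockSpace : List (Σ j, List (Fin (n j))) →
    Submodule ℂ (freeProd T (inner S H)).carrier
  | [] => LinearMap.range ((freeProd T (inner S H)).form.left.toLinearMap.flip
      (freeProd T (inner S H)).ξ)
  | ⟨j, t⟩ :: l => Submodule.span ℂ {u | ∃ (hl : j :: l.map Sigma.fst ∈ T.strings)
      (ht : t ∈ (S j).strings) (y : (word (fun i => H (letter j i)) t).carrier)
      (z : (word (inner S H) (l.map Sigma.fst)).carrier),
      u = freeIns T (inner S H) j _ (T.mem_branch_of_cons hl)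
        (freeIncl (S j) (fun i => H (letter j i)) t ht y) z}

variable {T S}

theorem exists_of_mem_blockSpace {l : List (Σ j, List (Fin (n j)))} (hl : T.IsBlocks S l)
    {u : (freeProd T (inner S H)).carrier} (hu : u ∈ blockSpace T S H l) :
    ∃ z, u = freeIncl T (inner S H) (l.map Sigma.fst) hl.1 z := by
  cases l with
  | nil =>
    obtain ⟨b, rfl⟩ := hu
    exact ⟨b, (freeIncl_nil T (inner S H) b).symm⟩
  | cons p l =>
    obtain ⟨j, t⟩ := p
    have h : blockSpace T S H (⟨j, t⟩ :: l) ≤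
        LinearMap.range (freeIncl T (inner S H) _ hl.1) := by
      refine Submodule.span_le.mpr ?_
      rintro _ ⟨h1, h2, y, z, rfl⟩
      refine ⟨wordCons (inner S H) j _ ((inner S H j).proj
        (freeIncl (S j) (fun i => H (letter j i)) t h2 y)) z, ?_⟩
      rw [freeIns_eq, ip_ξ_freeIncl _ _ _ (hl.2 ⟨j, t⟩ List.mem_cons_self).2, map_zero,
        LinearMap.zero_apply, map_zero, zero_add]
      rfl
    obtain ⟨z, hz⟩ := h hu
    exact ⟨z, hz.symm⟩

theorem freeIns_mem_blockSpace {l : List (Σ j, List (Fin (n j)))} {j : Fin k}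
    {t : List (Fin (n j))} (hs : l.map Sigma.fst ∈ T.branch j) (ht : t ∈ (S j).strings)
    (y : (word (fun i => H (letter j i)) t).carrier)
    (z : (word (inner S H) (l.map Sigma.fst)).carrier) :
    freeIns T (inner S H) j _ hs (freeIncl (S j) (fun i => H (letter j i)) t ht y) z ∈
      blockSpace T S H (⟨j, t⟩ :: l) :=
  Submodule.subset_span ⟨hs.2.2, ht, y, z, rfl⟩

/-- The action of `λ_{T,j} ∘ λ_{S_j,i}` on `blockSpace l` when the letter can be prepended to `l`.
If the letter forms a block of its own, the inner representation acts on the unit vector of the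
`j`-th inner product; otherwise it acts on the first tensor factor. -/
theorem compLam_blockSpace {j : Fin k} {i : Fin (n j)} {l : List (Σ j, List (Fin (n j)))}
    (hl : T.IsBlocks S l) (hc : T.IsBlocks S (consBlock j i l))
    {u : (freeProd T (inner S H)).carrier} (hu : u ∈ blockSpace T S H l) :
    ((compLam T S H (letter j i) ((H (letter j i)).rankOne (H (letter j i)).ξ
        (H (letter j i)).ξ)).1 u = u) ∧
      ∀ h : (H (letter j i)).compl.carrier, (compLam T S H (letter j i)
        ((H (letter j i)).rankOne (H (letter j i)).ξ ((H (letter j i)).incl h))).1 u ∈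
          blockSpace T S H (consBlock j i l) := by
  simp only [compLam_letter]
  rcases head_cases j l with h | ⟨t, l, rfl⟩
  · -- The letter is a new block: `λ_{S_j,i}(x)` acts on the unit vector in `u = ξ ⊗ z`.
    obtain ⟨z, rfl⟩ := exists_of_mem_blockSpace H hl hu
    rw [consBlock_of_head j i h] at hc ⊢
    have hb : l.map Sigma.fst ∈ T.branch j := T.mem_branch_of_cons hc.1
    have hi : [] ∈ (S j).branch i :=
      (S j).mem_branch_of_cons (hc.2 ⟨j, [i]⟩ List.mem_cons_self).1
    have key : ∀ x : (H (letter j i)).L,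
        (treeLam T (inner S H) j (treeLam (S j) (fun i => H (letter j i)) i x)).1
          (freeIncl T (inner S H) (l.map Sigma.fst) hb.1 z) =
        freeIns T (inner S H) j _ hb
          (freeIns (S j) (fun i => H (letter j i)) i [] hi (x.1 (H (letter j i)).ξ)
            (wordOne fun i => H (letter j i))) z := by
      intro x
      rw [treeLam_branch T (inner S H) j _ _ hb]
      exact congrArg (fun g => freeIns T (inner S H) j _ hb g z)
        (treeLam_branch (S j) (fun i => H (letter j i)) i x [] hi _)
    constructor
    · rw [key, PointedCorr.rankOne_ξ, freeIns_ξ (S j) (fun i => H (letter j i)) i]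
      exact freeIns_ξ T (inner S H) j _ hb z
    · intro h
      rw [key, PointedCorr.rankOne_ξ, freeIns_incl (S j) (fun i => H (letter j i)) i]
      exact freeIns_mem_blockSpace H hb _ _ _
  · -- The letter prolongs the first block `t`: `λ_{S_j,i}(x)` acts on the summand of `t`.
    rw [consBlock_same] at hc ⊢
    have hi : t ∈ (S j).branch i :=
      (S j).mem_branch_of_cons (hc.2 ⟨j, i :: t⟩ List.mem_cons_self).1
    rw [blockSpace] at hu
    induction hu using Submodule.span_induction with
    | zero =>
      refine ⟨map_zero _, fun h => ?_⟩
      rw [map_zero]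
      exact Submodule.zero_mem _
    | add u v _ _ hu hv =>
      refine ⟨by rw [map_add, hu.1, hv.1], fun h => ?_⟩
      rw [map_add]
      exact Submodule.add_mem _ (hu.2 h) (hv.2 h)
    | smul c u _ hu =>
      refine ⟨by rw [map_smul, hu.1], fun h => ?_⟩
      rw [map_smul]
      exact Submodule.smul_mem _ _ (hu.2 h)
    | mem u hu =>
      obtain ⟨hl', ht, y, z, rfl⟩ := hu
      constructor
      · rw [treeLam_freeIns, treeLam_branch (S j) _ i _ t hi, PointedCorr.rankOne_ξ, freeIns_ξ]
      · intro h
        rw [treeLam_freeIns, treeLam_branch (S j) _ i _ t hi, PointedCorr.rankOne_ξ,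
          freeIns_incl (S j) (fun i => H (letter j i)) i]
        exact freeIns_mem_blockSpace H _ _ _ _

/-- `λ_{T,j} ∘ λ_{S_j,i}` vanishes on `blockSpace l` when the letter can neither be prepended to
`l` nor is its first letter. -/
theorem compLam_blockSpace_other {j : Fin k} {i : Fin (n j)} {l : List (Σ j, List (Fin (n j)))}
    (hl : T.IsBlocks S l) (hc : ¬ T.IsBlocks S (consBlock j i l))
    (hh : (flat l).head? ≠ some (letter j i))
    {u : (freeProd T (inner S H)).carrier} (hu : u ∈ blockSpace T S H l) (x : (H (letter j i)).L) :
    (compLam T S H (letter j i) x).1 u = 0 := by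
  rw [compLam_letter]
  rcases head_cases j l with h | ⟨t, l, rfl⟩
  · obtain ⟨z, rfl⟩ := exists_of_mem_blockSpace H hl hu
    rw [consBlock_of_head j i h] at hc
    by_cases hb : l.map Sigma.fst ∈ T.branch j
    · have hi : [] ∉ (S j).branch i := fun hi => hc ⟨hb.2.2, fun p hp => by
        rcases List.mem_cons.mp hp with rfl | hp
        · exact ⟨hi.2.2, List.cons_ne_nil _ _⟩
        · exact hl.2 p hp⟩
      rw [treeLam_branch T (inner S H) j _ _ hb]
      have h0 : (treeLam (S j) (fun i => H (letter j i)) i x).1 (inner S H j).ξ = 0 :=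
        treeLam_other (S j) (fun i => H (letter j i)) i x [] (S j).nil_mem hi (by simp)
          (wordOne fun i => H (letter j i))
      rw [h0, freeIns_zero]
    · exact treeLam_other T (inner S H) j _ _ _ hb h _
  · rw [consBlock_same] at hc
    have hti : t.head? ≠ some i := by
      intro h
      refine hh ?_
      rw [flat, List.flatMap_cons, List.head?_append, List.head?_map, h]
      rfl
    have hi : t ∉ (S j).branch i := fun hi => hc ⟨hl.1, fun p hp => by
      rcases List.mem_cons.mp hp with rfl | hp
      · exact ⟨hi.2.2, List.cons_ne_nil _ _⟩
      · exact hl.2 p (List.mem_cons_of_mem _ hp)⟩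
    rw [blockSpace] at hu
    induction hu using Submodule.span_induction with
    | zero => exact map_zero _
    | add u v _ _ hu hv => rw [map_add, hu, hv, add_zero]
    | smul c u _ hu => rw [map_smul, hu, smul_zero]
    | mem u hu =>
      obtain ⟨hl', ht, y, z, rfl⟩ := hu
      rw [treeLam_freeIns, treeLam_other (S j) (fun i => H (letter j i)) i x t ht hi hti, freeIns_zero]

variable (T S)

/-- The unit vector of the iterated product is cyclic for the representations
`λ_{T,j} ∘ λ_{S_j,i}`. The first tensor factor of a vector `g ⊗ z` is approximated from the unit
vector of the inner product by means of `λ_{T,j}(y) U_{T,j}^* (g ⊗ z) = U_{T,j}^* (y g ⊗ z)`. -/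
theorem comp_cyclic (p : (freeProd T (inner S H)).carrier → Prop) (hc : IsClosed {v | p v})
    (hadd : ∀ u v, p u → p v → p (u + v))
    (h0 : ∀ b, p ((freeProd T (inner S H)).form.left b (freeProd T (inner S H)).ξ))
    (hlam : ∀ j i x v, p v → p ((treeLam T (inner S H) j
      (treeLam (S j) (fun i => H (letter j i)) i x)).1 v)) (v) : p v := by
  refine freeProd_induction_incl T (inner S H) v hc hadd fun s => ?_
  induction s with
  | nil => intro hs b; exact (freeIncl_nil T (inner S H) b) ▸ h0 b
  | cons j s ih =>
    intro hs v
    have hb := T.mem_branch_of_cons hs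
    have key : ∀ g z, p (freeIns T (inner S H) j s hb g z) := by
      intro g
      refine freeProd_induction (S j) (fun i => H (letter j i))
        (p := fun g => ∀ z, p (freeIns T (inner S H) j s hb g z)) g ?_ ?_ ?_ ?_
      · simp only [Set.ofPred_forall]
        exact isClosed_iInter fun z => hc.preimage (continuous_freeIns T (inner S H) j s hb z)
      · intro g g' hg hg' z
        rw [freeIns_add]
        exact hadd _ _ (hg z) (hg' z)
      · intro b z
        rw [(inner S H j).central, freeIns_right, freeIns_ξ]
        exact ih hb.1 _
      · intro i x g hg z
        rw [← treeLam_freeIns]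
        exact hlam j i x _ (hg z)
    refine wordCons_induction (inner S H)
      (p := fun v => p (freeIncl T (inner S H) (j :: s) hs v)) v ?_ ?_ fun g z => ?_
    · have := h0 0
      rw [map_zero, LinearMap.zero_apply] at this
      rwa [map_zero]
    · intro x y hx hy
      rw [map_add]
      exact hadd _ _ hx hy
    · rw [← freeIns_incl T (inner S H) j s hb]
      exact key _ z

/-- The iterated free product as a realization of the free product over the composed tree. -/
noncomputable def comp : FreeModel (T.comp S) H (freeProd T (inner S H)) where
  Λ := compLam T S H
  ip_Λ a x y h := by
    obtain ⟨j, i, rfl⟩ := exists_letter a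
    rw [compLam_letter, compLam_letter]
    exact ip_treeLam T (inner S H) j (ip_treeLam (S j) (fun i => H (letter j i)) i h)
  Λ_left a b x v := by
    obtain ⟨j, i, rfl⟩ := exists_letter a
    have h : treeLam (S j) (fun i => H (letter j i)) i ((H (letter j i)).leftL b * x) =
        (inner S H j).leftL b * treeLam (S j) (fun i => H (letter j i)) i x :=
      (inner S H j).ext_L fun v => treeLam_left (S j) (fun i => H (letter j i)) i b x v
    rw [compLam_letter, compLam_letter, h, treeLam_left]
  E w := blockSpace T S H (blocks w)
  ξ_mem b := ⟨b, rfl⟩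
  Λ_unit a w hw u hu := by
    obtain ⟨j, i, rfl⟩ := exists_letter a
    have hw' := (mem_comp_strings T S w).mp ((T.comp S).mem_of_cons hw)
    rw [mem_comp_strings, blocks_cons] at hw
    exact (compLam_blockSpace H hw' hw hu).1
  Λ_mem a w hw u hu h := by
    obtain ⟨j, i, rfl⟩ := exists_letter a
    have hw' := (mem_comp_strings T S w).mp ((T.comp S).mem_of_cons hw)
    rw [mem_comp_strings, blocks_cons] at hw
    rw [blocks_cons]
    exact (compLam_blockSpace H hw' hw hu).2 h
  Λ_other a w hw h1 h2 u hu x := by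
    obtain ⟨j, i, rfl⟩ := exists_letter a
    have h3 : letter j i :: w ∉ (T.comp S).strings := fun h => h1 (mem_branch_of_cons _ h)
    rw [mem_comp_strings] at hw h3
    rw [blocks_cons] at h3
    exact compLam_blockSpace_other H hw h3 (by rwa [flat_blocks]) hu x
  cyclic p hc hadd h0 h v := comp_cyclic T S H p hc hadd h0
    (fun j i x v hv => by
      have := h (letter j i) x v hv
      rwa [compLam_letter] at this) v

theorem comp_Λ_letter (j : Fin k) (i : Fin (n j)) (x : (H (letter j i)).L) :
    (comp T S H).Λ (letter j i) x =
      treeLam T (inner S H) j (treeLam (S j) (fun i => H (letter j i)) i x) :=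
  compLam_letter T S H j i x

end FreeModel

/-- The isomorphism of the iterated product with the product over the composed tree carries
`∑ j, λ_{T,j}(∑ i, λ_{S_j,i}(X_{j,i}))` to `∑ a, λ_{T(S₁, …, S_k),a}(X_a)`, so that these operators
have the same law. -/
theorem treeConv_comp {B : Type u} [CStarAlgebra B] [PartialOrder B] [StarOrderedRing B]
    {k : ℕ} {n : Fin k → ℕ} (T : StringTree (Fin k)) (S : ∀ j, StringTree (Fin (n j)))
    (μ : Fin (∑ j, n j) → Law B) :
    treeConv (T.comp S) μ =
      treeConv T fun j => treeConv (S j) fun i => μ (StringTree.letter j i) := by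
  have hY : ∀ j u v, (FreeModel.inner S (fun a => (μ a).L2) j).form.ip
      ((∑ i, treeLam (S j) (fun i => (μ (StringTree.letter j i)).L2) i
        (μ (StringTree.letter j i)).mulX).1 u) v =
      (FreeModel.inner S (fun a => (μ a).L2) j).form.ip u
      ((∑ i, treeLam (S j) (fun i => (μ (StringTree.letter j i)).L2) i
        (μ (StringTree.letter j i)).mulX).1 v) := by
    intro j u v
    rw [coe_sum_L, coe_sum_L, SemiCorr.ip_sum_left, SemiCorr.ip_sum_right]
    exact Finset.sum_congr rfl fun i _ => lam_symm (S j) _ i (μ _).mulXHat_symm u v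
  have hs : ∀ u v, (freeProd T (FreeModel.inner S fun a => (μ a).L2)).form.ip
      ((∑ j, treeLam T (FreeModel.inner S fun a => (μ a).L2) j
        (∑ i, treeLam (S j) (fun i => (μ (StringTree.letter j i)).L2) i
          (μ (StringTree.letter j i)).mulX)).1 u) v =
      (freeProd T (FreeModel.inner S fun a => (μ a).L2)).form.ip u
      ((∑ j, treeLam T (FreeModel.inner S fun a => (μ a).L2) j
        (∑ i, treeLam (S j) (fun i => (μ (StringTree.letter j i)).L2) i
          (μ (StringTree.letter j i)).mulX)).1 v) := by
    intro u v
    rw [coe_sum_L, coe_sum_L, SemiCorr.ip_sum_left, SemiCorr.ip_sum_right]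
    exact Finset.sum_congr rfl fun j _ => lam_symm T _ j (hY j) u v
  refine Eq.trans ?_ (treeConv_law T (FreeModel.inner S fun a => (μ a).L2) _ hY hs).symm
  refine (FreeModel.comp T S fun a => (μ a).L2).isometry.law_eq (fun v => ?_) _ _
  rw [coe_sum_L, coe_sum_L, map_sum, ← finSigmaFinEquiv.sum_comp, Fintype.sum_sigma]
  refine Finset.sum_congr rfl fun j _ => ?_
  rw [← treeLamHom_apply, map_sum, coe_sum_L]
  refine Finset.sum_congr rfl fun i _ => ?_
  refine ((FreeModel.comp T S fun a => (μ a).L2).isometry_treeLam _ _ v).trans ?_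
  exact congrArg (fun x : (freeProd T (FreeModel.inner S fun a => (μ a).L2)).L => x.1 _)
    (FreeModel.comp_Λ_letter T S (fun a => (μ a).L2) j i _)

theorem mainTheorem2 {B : Type u} [CStarAlgebra B] [PartialOrder B] [StarOrderedRing B]
    {k : ℕ} (n : Fin k → ℕ) (T : StringTree (Fin k)) (S : ∀ j, StringTree (Fin (n j))) :
    -- the iterated product and the product over the composed tree
    (∀ H : Fin (∑ j, n j) → PointedCorr B,
      ∃! Φ : PointedIso
          (freeProd T fun j => freeProd (S j) fun i => H (StringTree.letter j i))
          (freeProd (T.comp S) H),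
        ∀ (j : Fin k) (i : Fin (n j)) (x : (H (StringTree.letter j i)).L),
          Φ.Ad (treeLam T (fun j => freeProd (S j) fun i => H (StringTree.letter j i)) j
              (treeLam (S j) (fun i => H (StringTree.letter j i)) i x)) =
            treeLam (T.comp S) H (StringTree.letter j i) x) ∧
    -- compatibility of the convolutions with composition
    (∀ μ : Fin (∑ j, n j) → Law B,
      treeConv (T.comp S) μ =
        treeConv T fun j => treeConv (S j) fun i => μ (StringTree.letter j i)) ∧
    -- compatibility with the identities
    (∀ μ : Fin 1 → Law B, treeConv StringTree.identity μ = μ 0) := by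
  refine ⟨fun H => ?_, treeConv_comp T S, fun μ => ?_⟩
  · have hΛ : ∀ Φ : PointedIso (freeProd T fun j => freeProd (S j) fun i =>
        H (StringTree.letter j i)) (freeProd (T.comp S) H),
        (∀ (j : Fin k) (i : Fin (n j)) (x : (H (StringTree.letter j i)).L),
          Φ.Ad (treeLam T (fun j => freeProd (S j) fun i => H (StringTree.letter j i)) j
              (treeLam (S j) (fun i => H (StringTree.letter j i)) i x)) =
            treeLam (T.comp S) H (StringTree.letter j i) x) →
        ∀ a x, Φ.Ad ((FreeModel.comp T S H).Λ a x) = treeLam (T.comp S) H a x := by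
      intro Φ hΦ a x
      obtain ⟨j, i, rfl⟩ := StringTree.exists_letter a
      exact (congrArg Φ.Ad (FreeModel.comp_Λ_letter T S H j i x)).trans (hΦ j i x)
    refine ⟨(FreeModel.comp T S H).iso, fun j i x => ?_, fun Φ hΦ => ?_⟩
    · exact (congrArg (FreeModel.comp T S H).iso.Ad
        (FreeModel.comp_Λ_letter T S H j i x).symm).trans
          ((FreeModel.comp T S H).Ad_iso (StringTree.letter j i) x)
    · exact (FreeModel.comp T S H).iso_unique (hΛ Φ hΦ) (FreeModel.comp T S H).Ad_iso
  · obtain ⟨ν, rfl⟩ : ∃ ν, μ = fun _ => ν :=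
      ⟨μ 0, funext fun a => congrArg μ (Subsingleton.elim a 0)⟩
    exact treeConv_identity ν
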